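/- Let $W\in\mathbb{C}[x_1,\dots,x_n]$ be a weighted homogeneous polynomial of weight $(w_1,\dots,w_n;h)$, where $w_i,h$ are positive integers with $\gcd(w_1,\dots,w_n,h)=1$. Assume that $W$ is non-degenerate: it contains no monomial $x_ix_j$ with $i\ne j$, and it has an isolated singularity at the origin. Let $G_W=\{g\in(\mathbb{C}^*)^n : W(g_1x_1,\dots,g_nx_n)=W(x_1,\dots,x_n)\}$. For $g\in G_W$ let $\theta_{g,i}\in[0,1)$ be defined by $g_i=e^{2\pi i\theta_{g,i}}$ (the group $G_W$ is finite, so $|g_i|=1$), and let $\theta_{J,i}=w_i/h$. Let $\mathcal R_t=\mathrm{diag}(e^{2\pi i t\theta_{J,1}},\dots,e^{2\pi i t\theta_{J,n}})$; this is the Reeb flow on the link $L_{W,\delta}=W^{-1}(0)\cap\{\sum_k|z_k|^2=\delta^2\}$, $\delta>0$, for the contact form $\frac{h}{\delta^2}\lambda$, where $\lambda=\sum_k\frac{i}{4\pi w_k}(z_kd\bar z_k-\bar z_kdz_k)$. For $l>0$ put $(\mathbb{C}^n)^{g,l}=\{x: g\mathcal R_l(x)=x\}$, $\Sigma_{g,l}=(\mathbb{C}^n)^{g,l}\cap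 L_{W,\delta}$ (the $g$-twisted Reeb orbits of period $l$, a point $p$ standing for $\gamma(t)=\mathcal R_tp$, $0\le t\le l$, with $g\gamma(l)=\gamma(0)$), and $$I=I_{g,l}=\{i:\ \partial_iW|_{(\mathbb{C}^n)^{g,l}}=0\},\qquad I^c=\{1,\dots,n\}\setminus I.$$ Let $p\in\Sigma_{g,l}$. The Robbin–Salamon index of the linearized Reeb flow along $\gamma$ is defined as follows. Along $\gamma$ the tangent bundle of the Milnor fiber is $\ker dW$, with its complex structure and the symplectic form $d\lambda$. Choose a $C^1$ unitary frame $F(t)$ of $\ker dW_{\gamma(t)}$, $t\in[0,l]$, with $gF(l)=F(0)$, such that the linearized flow $\mathcal R_t:\ker dW_p\to\ker dW_{\gamma(t)}$, written in $F$, is a path $A:[0,l]\to U(n-1)\subset Sp(2n-2)$ all of whose crossings (times with $\ker(A(t)-1)\neq0$) are regular. Its Robbin–Salamon index $\mu(A)$ is the sum over all crossings of the signatures of the crossing forms $v\mapsto\omega_0(v,A'(t)v)$ on $\ker(A(t)-1)$, where the crossings at $t=0$ and $t=l$ are counted with the factor $\frac12$. Let $\mathrm{rot}_\Omega(F)\in\mathbb{R}$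 be the rotation number of $F$ with respect to the residue form $\Omega=(dz_1\wedge\dots\wedge dz_n)/dW$, i.e. the total change of $\frac1{2\pi}\arg\Omega(F(t))$ over $[0,l]$. The index is $\mu(A)+2\,\mathrm{rot}_\Omega(F)$. Then such frames $F$ exist, the index is the same number for all of them, and it is given for every $p\in\Sigma_{g,l}$ by $$\mu_{\mathrm{RS}}(\Sigma_{g,l})=2\Big(-\sum_{i\in I}\theta_{g,i}+\sum_{j\in I^c}(l\theta_{J,j}-l)\Big)+\sum_{i\in I}Q(l\theta_{J,i}+\theta_{g,i})+(|I^c|-1)\,Q(l),$$ where $Q(s)=2s$ if $s\in\mathbb{Z}$ and $Q(s)=2\lfloor s\rfloor+1$ otherwise. -/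

import Mathlib

noncomputable section

/-! ## Signature, crossing forms and the Robbin–Salamon index of a symplectic path -/

namespace RobbinSalamon

/-- The standard symplectic form `ω₀(u, v) = Im ⟪u, v⟫ = ∑ₖ Im (ūₖ vₖ) = ∑ₖ dxₖ ∧ dyₖ (u, v)` on
`ℂᵐ = ℝ²ᵐ`, as a real bilinear form. -/
def omega (m : ℕ) : LinearMap.BilinForm ℝ (EuclideanSpace ℂ (Fin m)) :=
  LinearMap.mk₂ ℝ (fun u v => (inner ℂ u v).im)
    (fun u u' v => by simp)
    (fun c u v => by simp [inner_smul_left_eq_smul])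
    (fun u v v' => by simp)
    (fun c u v => by simp [inner_smul_right_eq_smul])

/-- A real endomorphism of `ℂᵐ = ℝ²ᵐ` is symplectic if it preserves `ω₀`. -/
def IsSymplectic {m : ℕ} (A : EuclideanSpace ℂ (Fin m) →L[ℝ] EuclideanSpace ℂ (Fin m)) : Prop :=
  ∀ u v, omega m (A u) (A v) = omega m u v

/-- The crossing form of a path `Ψ : [a, b] → Sp(2m)` at the time `t`: the quadratic form
`v ↦ ω₀(v, Ψ'(t) v)` on the real vector space `ker (Ψ(t) - 1)`.  (If `Ψ' = J₀ S Ψ` with `S`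
symmetric and `J₀` the multiplication by `i`, this is `v ↦ ⟨v, S(t) v⟩`.) -/
def crossingForm {m : ℕ} (Ψ : ℝ → EuclideanSpace ℂ (Fin m) →L[ℝ] EuclideanSpace ℂ (Fin m))
    (a b t : ℝ) : QuadraticForm ℝ (LinearMap.ker (Ψ t - 1).toLinearMap) :=
  (LinearMap.BilinMap.toQuadraticMap
    ((omega m).compl₂ (derivWithin Ψ (Set.Icc a b) t).toLinearMap)).restrict _

/-- The signature of the crossing form at the time `t` (zero if `t` is not a crossing, i.e. if
`ker (Ψ(t) - 1) = 0`). -/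
def crossingSignature {m : ℕ}
    (Ψ : ℝ → EuclideanSpace ℂ (Fin m) →L[ℝ] EuclideanSpace ℂ (Fin m)) (a b t : ℝ) : ℝ :=
  (sigPos (crossingForm Ψ a b t) : ℝ) - (sigNeg (crossingForm Ψ a b t) : ℝ)

/-- A `C¹` path `Ψ : [a, b] → Sp(2m)` all of whose crossings are regular, i.e. have a nondegenerate
crossing form.  Regular crossings are isolated, so there are finitely many of them. -/
structure IsRegularPath {m : ℕ}
    (Ψ : ℝ → EuclideanSpace ℂ (Fin m) →L[ℝ] EuclideanSpace ℂ (Fin m)) (a b : ℝ) : Prop where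
  contDiffOn : ContDiffOn ℝ 1 Ψ (Set.Icc a b)
  symplectic : ∀ t ∈ Set.Icc a b, IsSymplectic (Ψ t)
  regular : ∀ t ∈ Set.Icc a b, (crossingForm Ψ a b t).radical = ⊥

/-- The Robbin–Salamon index of a path with regular crossings: the sum of the signatures of the
crossing forms over all crossings, where the two ends of the interval count one half. -/
def index {m : ℕ} (Ψ : ℝ → EuclideanSpace ℂ (Fin m) →L[ℝ] EuclideanSpace ℂ (Fin m))
    (a b : ℝ) : ℝ :=
  crossingSignature Ψ a b a / 2 + (∑ᶠ t ∈ Set.Ioo a b, crossingSignature Ψ a b t)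
    + crossingSignature Ψ a b b / 2

/-- `ρ` is the rotation number of the nowhere vanishing path `c : [a, b] → ℂ`, i.e. the total change
of a continuous choice of `arg c / 2π`. -/
def IsRotationNumber (c : ℝ → ℂ) (a b ρ : ℝ) : Prop :=
  ∃ φ : ℝ → ℝ, ContinuousOn φ (Set.Icc a b) ∧
    (∀ t ∈ Set.Icc a b, c t ≠ 0 ∧ c t = ‖c t‖ * Complex.exp (2 * Real.pi * Complex.I * φ t)) ∧
    φ b - φ a = ρ

/-- `Q(s) = 2s` if `s` is an integer, and `Q(s) = 2⌊s⌋ + 1` otherwise. -/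
def Q (s : ℝ) : ℝ :=
  open Classical in if ∃ k : ℤ, (k : ℝ) = s then 2 * s else 2 * (⌊s⌋ : ℝ) + 1

end RobbinSalamon

/-! ## Weighted homogeneous polynomials, diagonal symmetries and twisted Reeb orbits -/

namespace LGOrbifold

/-- `W` is weighted homogeneous of weight `(w₁, …, wₙ; h)`. -/
structure HasWeight {n : ℕ} (W : MvPolynomial (Fin n) ℂ) (w : Fin n → ℕ) (h : ℕ) : Prop where
  weight_pos : ∀ i, 0 < w i
  degree_pos : 0 < h
  gcd_eq_one : (Finset.univ.gcd w).gcd h = 1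
  homogeneous : MvPolynomial.IsWeightedHomogeneous w W h

/-- The partial derivative `∂ᵢW (x)`. -/
def partialAt {n : ℕ} (W : MvPolynomial (Fin n) ℂ) (i : Fin n) (x : Fin n → ℂ) : ℂ :=
  MvPolynomial.eval x (MvPolynomial.pderiv i W)

/-- `W` is non-degenerate: it contains no monomial `xᵢ xⱼ` with `i ≠ j`, and it has an isolated
singularity at the origin. -/
structure IsNondegenerate {n : ℕ} (W : MvPolynomial (Fin n) ℂ) : Prop where
  no_cross_term : ∀ i j : Fin n, i ≠ j →
    MvPolynomial.coeff (Finsupp.single i 1 + Finsupp.single j 1) W = 0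
  singular : ∀ i, partialAt W i 0 = 0
  isolated : ∀ᶠ x in nhdsWithin (0 : Fin n → ℂ) {0}ᶜ, ∃ i, partialAt W i x ≠ 0

/-- The maximal diagonal symmetry group
`G_W = {g ∈ (ℂˣ)ⁿ : W (g₁x₁, …, gₙxₙ) = W (x₁, …, xₙ)}`. -/
def symmetryGroup {n : ℕ} (W : MvPolynomial (Fin n) ℂ) : Subgroup (Fin n → ℂˣ) where
  carrier := {g | ∀ x : Fin n → ℂ,
    MvPolynomial.eval (fun i => (g i : ℂ) * x i) W = MvPolynomial.eval x W}
  mul_mem' := by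
    intro a b ha hb x
    have h1 := ha (fun i => (b i : ℂ) * x i)
    rw [hb x] at h1
    rw [← h1]
    simp [mul_assoc]
  one_mem' := by intro x; simp
  inv_mem' := by
    intro a ha x
    have h1 := ha (fun i => ((a i)⁻¹ : ℂ) * x i)
    simpa using h1.symm

/-- The diagonal action of `g ∈ (ℂˣ)ⁿ` on `ℂⁿ`. -/
def act {n : ℕ} (g : Fin n → ℂˣ) (x : Fin n → ℂ) : Fin n → ℂ := fun i => (g i : ℂ) * x i

/-- `θ_{g,i} ∈ [0, 1)` with `gᵢ = exp (2πi θ_{g,i})` (for `|gᵢ| = 1`). -/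
def theta {n : ℕ} (g : Fin n → ℂˣ) (i : Fin n) : ℝ :=
  Int.fract (Complex.arg (g i : ℂ) / (2 * Real.pi))

/-- `θ_{J,i} = wᵢ / h`. -/
def thetaJ {n : ℕ} (w : Fin n → ℕ) (h : ℕ) (i : Fin n) : ℝ := (w i : ℝ) / (h : ℝ)

/-- The Reeb flow `R_t = exp (2πi t θ_J)`.  It is linear on `ℂⁿ`, so it is also its own
linearization. -/
def reebFlow {n : ℕ} (w : Fin n → ℕ) (h : ℕ) (t : ℝ) (x : Fin n → ℂ) : Fin n → ℂ :=
  fun i => Complex.exp (2 * Real.pi * Complex.I * ((t * thetaJ w h i : ℝ) : ℂ)) * x i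

/-- The link `L_{W,δ} = W⁻¹(0) ∩ S_δ`. -/
def link {n : ℕ} (W : MvPolynomial (Fin n) ℂ) (δ : ℝ) : Set (Fin n → ℂ) :=
  {x | MvPolynomial.eval x W = 0 ∧ ∑ i, ‖x i‖ ^ 2 = δ ^ 2}

/-- `(ℂⁿ)^{g,l}`, the fixed locus of `g ∘ R_l`. -/
def fixedLocus {n : ℕ} (w : Fin n → ℕ) (h : ℕ) (g : Fin n → ℂˣ) (l : ℝ) : Set (Fin n → ℂ) :=
  {x | act g (reebFlow w h l x) = x}

/-- `Σ_{g,l}`, the space of `g`-twisted Reeb orbits of period `l` in the link; a point `p` stands for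
the orbit `γ(t) = R_t p`, `t ∈ [0, l]`, which satisfies `g γ(l) = γ(0)`. -/
def twistedOrbits {n : ℕ} (W : MvPolynomial (Fin n) ℂ) (w : Fin n → ℕ) (h : ℕ) (δ : ℝ)
    (g : Fin n → ℂˣ) (l : ℝ) : Set (Fin n → ℂ) :=
  fixedLocus w h g l ∩ link W δ

/-- `I_{g,l}`, the set of the indices `i` such that `∂ᵢW` vanishes identically on `(ℂⁿ)^{g,l}`. -/
def indexSet {n : ℕ} (W : MvPolynomial (Fin n) ℂ) (w : Fin n → ℕ) (h : ℕ) (g : Fin n → ℂˣ)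
    (l : ℝ) : Finset (Fin n) :=
  open Classical in Finset.univ.filter fun i => ∀ x ∈ fixedLocus w h g l, partialAt W i x = 0

/-- The Hermitian form `∑ₖ ūₖ vₖ / (π wₖ)`.  Its imaginary part is the symplectic form
`dλ = ∑ₖ (i / 2π wₖ) dzₖ ∧ dz̄ₖ`. -/
def herm {n : ℕ} (w : Fin n → ℕ) (u v : Fin n → ℂ) : ℂ :=
  ∑ k, (starRingEnd ℂ) (u k) * v k / (Real.pi * (w k : ℂ))

/-- The value at `v` of the Liouville form `λ = ∑ₖ (i / 4π wₖ) (zₖ dz̄ₖ - z̄ₖ dzₖ)` at the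
point `x`. -/
def liouville {n : ℕ} (w : Fin n → ℕ) (x v : Fin n → ℂ) : ℂ :=
  ∑ k, Complex.I / (4 * Real.pi * (w k : ℂ)) *
    (x k * (starRingEnd ℂ) (v k) - (starRingEnd ℂ) (x k) * v k)

/-- The vector field that generates `R_t`. -/
def reebField {n : ℕ} (w : Fin n → ℕ) (h : ℕ) (x : Fin n → ℂ) : Fin n → ℂ :=
  fun k => 2 * Real.pi * Complex.I * (thetaJ w h k : ℂ) * x k

/-- `R_t` is the flow of `reebField`. -/
theorem hasDerivAt_reebFlow {n : ℕ} (w : Fin n → ℕ) (h : ℕ) (x : Fin n → ℂ) (t : ℝ) :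
    HasDerivAt (fun s => reebFlow w h s x) (reebField w h (reebFlow w h t x)) t := by
  rw [hasDerivAt_pi]
  intro k
  have h1 : HasDerivAt (fun s : ℝ => 2 * Real.pi * Complex.I * ((s * thetaJ w h k : ℝ) : ℂ))
      (2 * Real.pi * Complex.I * (thetaJ w h k : ℂ)) t := by
    have := ((hasDerivAt_id t).mul_const (thetaJ w h k)).ofReal_comp.const_mul
      (2 * Real.pi * Complex.I)
    simpa using this
  have h2 := (h1.cexp).mul_const (x k)
  refine h2.congr_deriv ?_
  simp only [reebFlow, reebField]
  ring

/-- On the sphere of radius `δ` the form `(h / δ²) λ` takes the value `1` on `reebField`. -/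
theorem liouville_reebField {n : ℕ} (w : Fin n → ℕ) (h : ℕ) (hw : ∀ i, 0 < w i) (hh : 0 < h)
    (x : Fin n → ℂ) :
    liouville w x (reebField w h x) = ((∑ k, ‖x k‖ ^ 2 : ℝ) : ℂ) / (h : ℂ) := by
  simp only [liouville, reebField, thetaJ]
  push_cast
  rw [Finset.sum_div]
  refine Finset.sum_congr rfl fun k _ => ?_
  have h1 : (w k : ℂ) ≠ 0 := by exact_mod_cast (hw k).ne'
  have h2 : (h : ℂ) ≠ 0 := by exact_mod_cast hh.ne'
  have h3 : (Real.pi : ℂ) ≠ 0 := by exact_mod_cast Real.pi_ne_zero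
  have h4 : (starRingEnd ℂ) (x k) * x k = (‖x k‖ : ℂ) ^ 2 := Complex.conj_mul' (x k)
  simp only [map_mul, map_div₀, map_natCast, Complex.conj_I, Complex.conj_ofReal, map_ofNat]
  rw [← h4]
  field_simp
  rw [Complex.I_sq]
  ring

/-- `dλ (reebField, v) = 0` for `v` tangent to the sphere.  So `R_t` is the Reeb flow of the contact
form `(h / δ²) λ` on the link. -/
theorem herm_reebField {n : ℕ} (w : Fin n → ℕ) (h : ℕ) (hw : ∀ i, 0 < w i)
    (x v : Fin n → ℂ) (hv : ∑ k, ((starRingEnd ℂ) (x k) * v k).re = 0) :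
    (herm w (reebField w h x) v).im = 0 := by
  have h0 : herm w (reebField w h x) v
      = ((-2 / (h : ℝ) : ℝ) : ℂ) * Complex.I * ∑ k, (starRingEnd ℂ) (x k) * v k := by
    simp only [herm, reebField, thetaJ]
    rw [Finset.mul_sum]
    refine Finset.sum_congr rfl fun k _ => ?_
    have h1 : (w k : ℂ) ≠ 0 := by exact_mod_cast (hw k).ne'
    have h3 : (Real.pi : ℂ) ≠ 0 := by exact_mod_cast Real.pi_ne_zero
    simp only [map_mul, Complex.conj_I, Complex.conj_ofReal, map_ofNat]
    push_cast
    field_simp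
  rw [h0, mul_assoc, Complex.im_ofReal_mul, Complex.I_mul_im, Complex.re_sum, hv, mul_zero]

/-- `ker dW_x`.  Along the link this is the tangent space of `W⁻¹(0)`, which is the tangent space of
the Milnor fiber `{W = ψ(|x|²)}` there, as the cutoff function `ψ` vanishes near the boundary. -/
def tangentSpace {n : ℕ} (W : MvPolynomial (Fin n) ℂ) (x : Fin n → ℂ) : Submodule ℂ (Fin n → ℂ) :=
  LinearMap.ker (∑ i, partialAt W i x • (LinearMap.proj i : (Fin n → ℂ) →ₗ[ℂ] ℂ))

/-- The residue form `Ω = (dz₁ ∧ ⋯ ∧ dzₙ) / dW` on `ker dW_x`, evaluated at `n - 1` vectors: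
`Ω (v₁, …, vₙ₋₁) = det (ν, v₁, …, vₙ₋₁) / dW_x ν`, with `ν` the conjugate of the gradient of `W`. -/
def residueForm {m : ℕ} (W : MvPolynomial (Fin (m + 1)) ℂ) (x : Fin (m + 1) → ℂ)
    (v : Fin m → Fin (m + 1) → ℂ) : ℂ :=
  Matrix.det (Matrix.of (Fin.cons (fun i => (starRingEnd ℂ) (partialAt W i x)) v)) /
    ∑ i, partialAt W i x * (starRingEnd ℂ) (partialAt W i x)

/-- `residueForm` does not depend on the choice of the normal vector: `dW ∧ Ω = dz₁ ∧ ⋯ ∧ dzₙ`. -/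
theorem mul_residueForm {m : ℕ} (W : MvPolynomial (Fin (m + 1)) ℂ) (x ν : Fin (m + 1) → ℂ)
    (v : Fin m → Fin (m + 1) → ℂ) (hx : ∃ i, partialAt W i x ≠ 0)
    (hv : ∀ j, ∑ i, partialAt W i x * v j i = 0) :
    (∑ i, partialAt W i x * ν i) * residueForm W x v = Matrix.det (Matrix.of (Fin.cons ν v)) := by
  set n : Fin (m + 1) → ℂ := fun i => (starRingEnd ℂ) (partialAt W i x) with hn
  set D : (Fin (m + 1) → ℂ) → ℂ := fun u => Matrix.det (Matrix.of (Fin.cons u v)) with hD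
  have hupd : ∀ u, D u = Matrix.det ((Matrix.of (Fin.cons n v)).updateRow 0 u) := by
    intro u
    simp only [hD]
    congr 1
    ext i j
    refine Fin.cases ?_ (fun i => ?_) i
    · simp
    · rw [Matrix.updateRow_ne (Fin.succ_ne_zero i)]; simp
  have hc : ∑ i, partialAt W i x * n i ≠ 0 := by
    have h1 : ∑ i, partialAt W i x * n i = ((∑ i, ‖partialAt W i x‖ ^ 2 : ℝ) : ℂ) := by
      push_cast
      exact Finset.sum_congr rfl fun i _ => Complex.mul_conj' _
    rw [h1]
    obtain ⟨i, hi⟩ := hx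
    have h2 : (0 : ℝ) < ‖partialAt W i x‖ ^ 2 := pow_pos (norm_pos_iff.mpr hi) 2
    have h3 : (0 : ℝ) < ∑ i, ‖partialAt W i x‖ ^ 2 :=
      Finset.sum_pos' (fun i _ => sq_nonneg ‖partialAt W i x‖) ⟨i, Finset.mem_univ i, h2⟩
    exact Complex.ofReal_ne_zero.mpr h3.ne'
  have hker : ∀ u : Fin (m + 1) → ℂ, ∑ i, partialAt W i x * u i = 0 → D u = 0 := by
    intro u hu
    have key : ∃ y : Fin (m + 1) → ℂ, y ≠ 0 ∧
        (Matrix.of (Fin.cons u v : Fin (m + 1) → Fin (m + 1) → ℂ)).mulVec y = 0 := by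
      refine ⟨fun i => partialAt W i x, ?_, ?_⟩
      · obtain ⟨i, hi⟩ := hx
        exact fun h0 => hi (congrFun h0 i)
      · ext i
        refine Fin.cases ?_ (fun i => ?_) i
        · simpa [Matrix.mulVec, dotProduct, mul_comm] using hu
        · simpa [Matrix.mulVec, dotProduct, mul_comm] using hv i
    exact Matrix.exists_mulVec_eq_zero_iff.mp key
  have hlin : D ((∑ i, partialAt W i x * n i) • ν - (∑ i, partialAt W i x * ν i) • n)
      = (∑ i, partialAt W i x * n i) * D ν - (∑ i, partialAt W i x * ν i) * D n := by
    simp only [hupd, sub_eq_add_neg, ← neg_smul]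
    rw [Matrix.det_updateRow_add, Matrix.det_updateRow_smul, Matrix.det_updateRow_smul]
    ring
  rw [hker] at hlin
  · change _ * (D n / _) = D ν
    rw [mul_div_assoc', div_eq_iff hc]
    linear_combination hlin
  · simp only [Pi.sub_apply, Pi.smul_apply, smul_eq_mul, mul_sub, Finset.sum_sub_distrib]
    have e : ∀ (c : ℂ) (y : Fin (m + 1) → ℂ),
        ∑ i, partialAt W i x * (c * y i) = c * ∑ i, partialAt W i x * y i := by
      intro c y
      rw [Finset.mul_sum]
      exact Finset.sum_congr rfl fun i _ => by ring
    rw [e, e]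
    ring

/-- A `g`-equivariant unitary frame (trivialization) along `γ(t) = R_t p`, `t ∈ [0, l]`, of the tangent
bundle of the Milnor fiber with its complex structure and the symplectic form `dλ`. -/
structure IsUnitaryFrame {m : ℕ} (W : MvPolynomial (Fin (m + 1)) ℂ) (w : Fin (m + 1) → ℕ) (h : ℕ)
    (g : Fin (m + 1) → ℂˣ) (l : ℝ) (p : Fin (m + 1) → ℂ)
    (F : ℝ → Fin m → Fin (m + 1) → ℂ) : Prop where
  contDiffOn : ContDiffOn ℝ 1 F (Set.Icc 0 l)
  tangent : ∀ t ∈ Set.Icc 0 l, ∀ j, F t j ∈ tangentSpace W (reebFlow w h t p)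
  unitary : ∀ t ∈ Set.Icc 0 l, ∀ i j, herm w (F t i) (F t j) = if i = j then 1 else 0
  equivariant : ∀ j, act g (F l j) = F 0 j

/-- The linearized Reeb flow `T_p → T_{γ(t)}` written in the frame `F`: the unitary matrix `A(t)` with
`R_t (F(0)ⱼ) = ∑ᵢ A(t)ᵢⱼ F(t)ᵢ`, as a real endomorphism of `ℂᵐ = ℝ²ᵐ`. -/
def linearizedFlow {m : ℕ} (w : Fin (m + 1) → ℕ) (h : ℕ) (F : ℝ → Fin m → Fin (m + 1) → ℂ)
    (t : ℝ) : EuclideanSpace ℂ (Fin m) →L[ℝ] EuclideanSpace ℂ (Fin m) :=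
  (Matrix.toEuclideanCLM (𝕜 := ℂ)
    (Matrix.of fun i j => herm w (F t i) (reebFlow w h t (F 0 j)))).restrictScalars ℝ

/-- `μ` is the (fractional) Robbin–Salamon index, with respect to the volume form `Ω`, of the
linearized Reeb flow along the `g`-twisted Reeb orbit `γ(t) = R_t p`, `t ∈ [0, l]`: the index of the
linearized flow in a `g`-equivariant unitary frame, plus twice the rotation number of the frame with
respect to `Ω`.  If `g` has order dividing `N`, then `Ω(F)^N` is a loop and `N` times the rotation
number is its winding number, so this is `1 / N` times the index with respect to `Ω^{⊗N}`. -/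
def IsRobbinSalamonIndex {m : ℕ} (W : MvPolynomial (Fin (m + 1)) ℂ) (w : Fin (m + 1) → ℕ) (h : ℕ)
    (g : Fin (m + 1) → ℂˣ) (l : ℝ) (p : Fin (m + 1) → ℂ) (μ : ℝ) : Prop :=
  ∃ (F : ℝ → Fin m → Fin (m + 1) → ℂ) (ρ : ℝ),
    IsUnitaryFrame W w h g l p F ∧
    RobbinSalamon.IsRegularPath (linearizedFlow w h F) 0 l ∧
    RobbinSalamon.IsRotationNumber (fun t => residueForm W (reebFlow w h t p) (F t)) 0 l ρ ∧
    μ = RobbinSalamon.index (linearizedFlow w h F) 0 l + 2 * ρ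

end LGOrbifold

end

noncomputable section

/-! ## The defect `Q(s) - 2s` as a function on the circle -/

namespace RobbinSalamon

/-! The function `Q(s) - 2s` has period 1, so it descends to a function `defect` on the unit circle,
whose only discontinuity is at `1`. For a unitary path `A` with `det A = exp (2πi φ)`, consider
`N(t) = ∑ defect(eigenvalues of A(t)) + 2 φ(t)`. Away from crossings the contributions `-2s` of the
moving eigenvalues cancel against `2φ`, so `N` is locally constant. At a regular crossing `N`
changes by half the signature of the crossing form on each side. Hence the index is `N(b) - N(a)`
(`index_realMap`).

The jump needs no differentiable choice of eigenvalues. Near a fixed time choose a chord of the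
circle from `1` to a point that is not an eigenvalue. Then `defect` is a continuous branch of `-arg
/ π` plus the sign of the side of the chord (`defect_eq_branch_add_sign`). The branch sum plus `2φ`
takes even integer values and is continuous, hence locally constant. The sum of the signs is half
the signature of the real quadratic form `Im (c ⟪v, (A - 1) v⟫)` (`signature_imForm`). Its radical
is `ker (A - 1)`, so to first order its signature changes by that of the derivative on the kernel,
which is the crossing form (`signature_perturbation`).

For the linearized flow, `A(0) = 1`, and equivariance of the frame makes `A(l)` the matrix of `g
R_l` on `ker dW_p`. Its eigenvalues are the `n` diagonal entries of `g R_l` with one copy of `exp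
(2πi l)` removed, the factor by which `g R_l` multiplies `W` (`charpoly_diagonal_eq`). Comparing
`Ω(R_t F(0))` with `Ω(F(t))` computes `det A(t)`, and the rotation number of `F` cancels out of
index plus `2ρ`, which is why the result is independent of `F`. For `i ∉ I` the entry of `g R_l` is
`exp (2πi l)` itself (`twist_eq_of_notMem_indexSet`), and the formula follows. A frame exists
because `g R_l` can be diagonalized unitarily on `ker dW_p`: transport eigenvectors by `R_t` and
unwind their phases linearly in `t` (`exists_unitaryFrame`). -/

theorem Q_add_int (s : ℝ) (k : ℤ) : Q (s + k) = Q s + 2 * k := by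
  have h : (∃ j : ℤ, (j : ℝ) = s + k) ↔ ∃ j : ℤ, (j : ℝ) = s := by
    constructor
    · rintro ⟨j, hj⟩
      exact ⟨j - k, by push_cast; linarith⟩
    · rintro ⟨j, hj⟩
      exact ⟨j + k, by push_cast; linarith⟩
  unfold Q
  by_cases hs : ∃ j : ℤ, (j : ℝ) = s
  · rw [if_pos hs, if_pos (h.mpr hs)]
    ring
  · rw [if_neg hs, if_neg (mt h.mp hs), Int.floor_add_intCast]
    push_cast
    ring

theorem Q_zero : Q 0 = 0 := by
  unfold Q
  rw [if_pos ⟨0, by simp⟩]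
  simp

/-- The interval around `0` must have length 2: angles measured from a cut near `-1` on either side
range over `(-2π, 2π)`. -/
theorem Q_eq_sign {s : ℝ} (h1 : -1 < s) (h2 : s < 1) : Q s = SignType.sign s := by
  rcases lt_trichotomy s 0 with h | h | h
  · have hfl : ⌊s⌋ = -1 := by
      rw [Int.floor_eq_iff]
      constructor <;> push_cast <;> linarith
    have hn : ¬ ∃ k : ℤ, (k : ℝ) = s := by
      rintro ⟨k, rfl⟩
      have h3 : -1 < k := by exact_mod_cast h1
      have h4 : k < 0 := by exact_mod_cast h
      omega
    unfold Q
    rw [if_neg hn, hfl, sign_neg h]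
    norm_num
  · subst h
    simp [Q_zero]
  · have hfl : ⌊s⌋ = 0 := by
      rw [Int.floor_eq_iff]
      constructor <;> push_cast <;> linarith
    have hn : ¬ ∃ k : ℤ, (k : ℝ) = s := by
      rintro ⟨k, rfl⟩
      have h3 : 0 < k := by exact_mod_cast h
      have h4 : k < 1 := by exact_mod_cast h2
      omega
    unfold Q
    rw [if_neg hn, hfl, sign_pos h]
    norm_num

/-- The function on the unit circle with `defect (exp (2πis)) = Q(s) - 2s`. -/
def defect (z : ℂ) : ℝ := Q (z.arg / (2 * Real.pi)) - z.arg / Real.pi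

theorem exists_int_arg_exp (s : ℝ) :
    ∃ k : ℤ, (Complex.exp (2 * Real.pi * Complex.I * s)).arg = 2 * Real.pi * (s + k) := by
  set z := Complex.exp (2 * Real.pi * Complex.I * s) with hz
  have hz1 : ‖z‖ = 1 := by
    have : 2 * Real.pi * Complex.I * s = ((2 * Real.pi * s : ℝ) : ℂ) * Complex.I := by
      push_cast; ring
    rw [hz, this, Complex.norm_exp_ofReal_mul_I]
  have h1 : Complex.exp (z.arg * Complex.I) = Complex.exp (2 * Real.pi * Complex.I * s) := by
    have := Complex.norm_mul_exp_arg_mul_I z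
    rwa [hz1, Complex.ofReal_one, one_mul] at this
  obtain ⟨k, hk⟩ := Complex.exp_eq_exp_iff_exists_int.mp h1
  refine ⟨k, Complex.ofReal_injective (mul_right_cancel₀ Complex.I_ne_zero ?_)⟩
  rw [hk]
  push_cast
  ring

/-- The choice of the argument does not matter, since `Q(s) - 2s` is invariant under integer shifts
by `Q_add_int`. -/
theorem defect_exp (s : ℝ) :
    defect (Complex.exp (2 * Real.pi * Complex.I * s)) = Q s - 2 * s := by
  obtain ⟨k, hk⟩ := exists_int_arg_exp s
  have hp := Real.pi_ne_zero
  have h1 : 2 * Real.pi * (s + k) / (2 * Real.pi) = s + k := by field_simp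
  have h2 : 2 * Real.pi * (s + k) / Real.pi = 2 * (s + k) := by field_simp
  rw [defect, hk, h1, h2, Q_add_int]
  ring

theorem defect_one : defect 1 = 0 := by
  simp [defect, Q_zero]

/-- `-1/π` times the branch of the argument with values in `(α - π, α + π]`. -/
def branch (α : ℝ) (z : ℂ) : ℝ := -(α + (Complex.exp (-(α * Complex.I)) * z).arg) / Real.pi

/-- With this normalization a sum of branches over the eigenvalues is determined by `det⁻¹` up to an
even integer. -/
theorem exp_branch (α : ℝ) {z : ℂ} (hz : ‖z‖ = 1) :
    Complex.exp (Real.pi * Complex.I * branch α z) = z⁻¹ := by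
  set y := Complex.exp (-(α * Complex.I)) * z with hy
  have hy1 : ‖y‖ = 1 := by
    rw [hy, norm_mul, hz, ← neg_mul, ← Complex.ofReal_neg, Complex.norm_exp_ofReal_mul_I, one_mul]
  have h1 : Complex.exp (y.arg * Complex.I) = y := by
    have := Complex.norm_mul_exp_arg_mul_I y
    rwa [hy1, Complex.ofReal_one, one_mul] at this
  have hp : (Real.pi : ℂ) ≠ 0 := by exact_mod_cast Real.pi_ne_zero
  have h2 : (Real.pi : ℂ) * Complex.I * branch α z = -(α * Complex.I) + -(y.arg * Complex.I) := by
    rw [branch]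
    push_cast
    rw [← hy]
    field_simp
    ring
  rw [h2, Complex.exp_add, Complex.exp_neg (y.arg * Complex.I), h1, hy, mul_inv]
  rw [← mul_assoc, mul_inv_cancel₀ (Complex.exp_ne_zero _), one_mul]

theorem continuousAt_branch {α : ℝ} {z : ℂ} (hz : ‖z‖ = 1)
    (hne : z ≠ -Complex.exp (α * Complex.I)) : ContinuousAt (branch α) z := by
  have hy : Complex.exp (-(α * Complex.I)) * z ∈ Complex.slitPlane := by
    rw [Complex.mem_slitPlane_iff_arg]
    refine ⟨fun h => hne ?_, mul_ne_zero (Complex.exp_ne_zero _) (by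
      intro h0; simp [h0] at hz)⟩
    have h1 := Complex.norm_mul_exp_arg_mul_I (Complex.exp (-(α * Complex.I)) * z)
    rw [h, norm_mul, hz, ← neg_mul, ← Complex.ofReal_neg, Complex.norm_exp_ofReal_mul_I,
      Complex.exp_pi_mul_I, Complex.ofReal_neg, neg_mul] at h1
    have h2 : z = Complex.exp (α * Complex.I) * (Complex.exp (-(α * Complex.I)) * z) := by
      rw [← mul_assoc, ← Complex.exp_add, add_neg_cancel, Complex.exp_zero, one_mul]
    rw [h2, ← h1]
    simp
  have h3 : ContinuousAt (fun z => (Complex.exp (-(α * Complex.I)) * z).arg) z :=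
    ContinuousAt.comp (f := fun z => Complex.exp (-(α * Complex.I)) * z)
      (Complex.continuousAt_arg hy) (by fun_prop)
  unfold branch
  exact ((continuousAt_const.add h3).neg).div_const _

theorem abs_branch_le (α : ℝ) (z : ℂ) : |branch α z| ≤ (|α| + Real.pi) / Real.pi := by
  unfold branch
  rw [abs_div, abs_neg, abs_of_pos Real.pi_pos]
  gcongr
  exact (abs_add_le _ _).trans (by gcongr; exact Complex.abs_arg_le_pi _)

/-- The zeros are `θ = 0` and `θ ≡ α + π` modulo `2π`, so the line in question is the chord from `1`
to `-exp (iα)`, the cut of `branch α`. -/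
theorem im_exp_mul_sub_one (α θ : ℝ) :
    (Complex.exp (-(α / 2 * Complex.I)) * (Complex.exp (θ * Complex.I) - 1)).im
      = 2 * Real.sin (θ / 2) * Real.cos ((θ - α) / 2) := by
  rw [mul_sub, mul_one, ← Complex.exp_add]
  have h1 : -((α : ℂ) / 2 * Complex.I) + θ * Complex.I = ((θ - α / 2 : ℝ) : ℂ) * Complex.I := by
    push_cast; ring
  have h2 : -((α : ℂ) / 2 * Complex.I) = ((-(α / 2) : ℝ) : ℂ) * Complex.I := by
    push_cast; ring
  rw [h1, h2, Complex.sub_im, Complex.exp_ofReal_mul_I_im, Complex.exp_ofReal_mul_I_im,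
    Real.sin_sub_sin]
  congr 2
  · ring_nf
  · ring_nf

/-- The branch of the argument and the position relative to a chord through `1`. -/
theorem exists_angle_chord {α : ℝ} (h1 : -Real.pi < α) (h2 : α < Real.pi) {z : ℂ}
    (hz : ‖z‖ = 1) (hne : z ≠ -Complex.exp (α * Complex.I)) :
    ∃ θ : ℝ, z = Complex.exp (θ * Complex.I) ∧ -(2 * Real.pi) < θ ∧ θ < 2 * Real.pi ∧
      branch α z = -θ / Real.pi ∧
      SignType.sign ((Complex.exp (-(α / 2 * Complex.I)) * (z - 1)).im) = SignType.sign θ := by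
  set y := Complex.exp (-(α * Complex.I)) * z with hy
  set θ := α + y.arg with hθ
  have hy1 : ‖y‖ = 1 := by
    rw [hy, norm_mul, hz, ← neg_mul, ← Complex.ofReal_neg, Complex.norm_exp_ofReal_mul_I, one_mul]
  have hyarg : Complex.exp (y.arg * Complex.I) = y := by
    have := Complex.norm_mul_exp_arg_mul_I y
    rwa [hy1, Complex.ofReal_one, one_mul] at this
  have hzθ : z = Complex.exp (θ * Complex.I) := by
    rw [hθ, Complex.ofReal_add, add_mul, Complex.exp_add, hyarg, hy, ← mul_assoc, ← Complex.exp_add,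
      add_neg_cancel, Complex.exp_zero, one_mul]
  have hlt : y.arg < Real.pi := by
    refine lt_of_le_of_ne (Complex.arg_le_pi y) fun h => hne ?_
    rw [hzθ, hθ, h, Complex.ofReal_add, add_mul, Complex.exp_add, Complex.exp_pi_mul_I]
    ring
  have hgt := Complex.neg_pi_lt_arg y
  have hp := Real.pi_pos
  -- Off the cut `θ - α = arg y` lies in `(-π, π)`, so only `sin (θ / 2)` decides the sign.
  have hcos : 0 < Real.cos ((θ - α) / 2) := by
    apply Real.cos_pos_of_mem_Ioo
    constructor <;> rw [hθ] <;> linarith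
  have hsin : SignType.sign (Real.sin (θ / 2)) = SignType.sign θ := by
    rcases lt_trichotomy θ 0 with h | h | h
    · rw [sign_neg h, sign_neg]
      exact Real.sin_neg_of_neg_of_neg_pi_lt (by linarith) (by linarith)
    · simp [h]
    · rw [sign_pos h, sign_pos]
      exact Real.sin_pos_of_pos_of_lt_pi (by linarith) (by linarith)
  refine ⟨θ, hzθ, by linarith, by linarith, rfl, ?_⟩
  rw [hzθ, im_exp_mul_sub_one, sign_mul, sign_mul, sign_pos hcos, sign_pos two_pos, hsin]
  simp

/-- The jump of `defect` at `1` is that of the sign of the coordinate transverse to a chord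
through `1`. -/
theorem defect_eq_branch_add_sign {α : ℝ} (h1 : -Real.pi < α) (h2 : α < Real.pi) {z : ℂ}
    (hz : ‖z‖ = 1) (hne : z ≠ -Complex.exp (α * Complex.I)) :
    defect z = branch α z
      + SignType.sign ((Complex.exp (-(α / 2 * Complex.I)) * (z - 1)).im) := by
  obtain ⟨θ, hzθ, hθ1, hθ2, hbr, hs⟩ := exists_angle_chord h1 h2 hz hne
  have hp := Real.pi_pos
  have hz2 : z = Complex.exp (2 * Real.pi * Complex.I * ((θ / (2 * Real.pi) : ℝ) : ℂ)) := by
    rw [hzθ]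
    congr 1
    have : (Real.pi : ℂ) ≠ 0 := by exact_mod_cast hp.ne'
    push_cast
    field_simp
  have hd : defect z = SignType.sign θ - θ / Real.pi := by
    rw [hz2, defect_exp, Q_eq_sign]
    · have h3 : SignType.sign (θ / (2 * Real.pi)) = SignType.sign θ := by
        rw [div_eq_mul_inv, sign_mul, sign_pos (inv_pos.mpr (by positivity)), mul_one]
      rw [h3]
      field_simp
    · rw [lt_div_iff₀ (by positivity)]; linarith
    · rw [div_lt_one (by positivity)]; linarith
  rw [hs, hd, hbr]
  ring

theorem eq_one_of_im_chord_eq_zero {α : ℝ} (h1 : -Real.pi < α) (h2 : α < Real.pi) {z : ℂ}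
    (hz : ‖z‖ = 1) (hne : z ≠ -Complex.exp (α * Complex.I))
    (h : (Complex.exp (-(α / 2 * Complex.I)) * (z - 1)).im = 0) : z = 1 := by
  obtain ⟨θ, hzθ, -, -, -, hs⟩ := exists_angle_chord h1 h2 hz hne
  rw [h, sign_zero, eq_comm, sign_eq_zero_iff] at hs
  simp [hzθ, hs]

end RobbinSalamon

end


noncomputable section

/-! ## Sums over the eigenvalues of a unitary matrix -/

namespace RobbinSalamon

open Matrix

theorem norm_eq_one_of_unitary_diagonal {m : ℕ} {d : Fin m → ℂ}
    (h : diagonal d ∈ unitaryGroup (Fin m) ℂ) (j : Fin m) : ‖d j‖ = 1 := by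
  rw [mem_unitaryGroup_iff, star_eq_conjTranspose, diagonal_conjTranspose, diagonal_mul_diagonal]
    at h
  have h1 := congrFun (congrFun h j) j
  rw [diagonal_apply_eq, one_apply_eq, Pi.star_apply, RCLike.star_def, Complex.mul_conj'] at h1
  have h2 : ‖d j‖ ^ 2 = 1 := by exact_mod_cast h1
  exact (pow_eq_one_iff_of_nonneg (norm_nonneg _) two_ne_zero).mp h2

/-- The circle has points other than `1` outside of any finite set. -/
theorem exists_angle_avoiding (s : Finset ℂ) :
    ∃ α : ℝ, -Real.pi < α ∧ α < Real.pi ∧ -Complex.exp (α * Complex.I) ∉ s := by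
  by_contra! hc
  have hinj : Set.InjOn (fun α : ℝ => -Complex.exp (α * Complex.I)) (Set.Ioo (-Real.pi) Real.pi) := by
    intro a ha b hb hab
    have h1 := neg_injective hab
    have h2 : (Complex.exp (a * Complex.I)).arg = (Complex.exp (b * Complex.I)).arg := by rw [h1]
    rwa [Complex.arg_exp_mul_I, Complex.arg_exp_mul_I,
      (toIocMod_eq_self _).mpr ⟨ha.1, by linarith [ha.2]⟩,
      (toIocMod_eq_self _).mpr ⟨hb.1, by linarith [hb.2]⟩] at h2
  have hfin : (Set.Ioo (-Real.pi) Real.pi).Finite :=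
    Set.Finite.of_finite_image (s.finite_toSet.subset (by
      rintro _ ⟨a, ha, rfl⟩
      exact hc a ha.1 ha.2)) hinj
  exact Set.Ioo_infinite (by linarith [Real.pi_pos]) hfin

/-- The Cayley transform reduces this to Hermitian matrices: if `c` on the circle is not an
eigenvalue of `U`, then `H = i (c + U) (c - U)⁻¹` is Hermitian, and its eigenvectors diagonalize
`U`. -/
theorem exists_unitary_diagonalization {m : ℕ} {U : Matrix (Fin m) (Fin m) ℂ}
    (hU : U ∈ unitaryGroup (Fin m) ℂ) :
    ∃ V ∈ unitaryGroup (Fin m) ℂ, ∃ d : Fin m → ℂ, (∀ j, ‖d j‖ = 1) ∧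
      U = V * diagonal d * star V := by
  obtain ⟨α, -, -, hα⟩ := exists_angle_avoiding U.charpoly.roots.toFinset
  set c : ℂ := -Complex.exp (α * Complex.I) with hc
  have hcc : c * star c = 1 := by
    rw [hc, RCLike.star_def, Complex.mul_conj', norm_neg, Complex.norm_exp_ofReal_mul_I]
    simp
  have hcc' : star c * c = 1 := by rw [mul_comm, hcc]
  have hdet : IsUnit (c • (1 : Matrix (Fin m) (Fin m) ℂ) - U).det := by
    rw [isUnit_iff_ne_zero]
    intro h0
    apply hα
    rw [Multiset.mem_toFinset, Polynomial.mem_roots (charpoly_monic U).ne_zero, Polynomial.IsRoot,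
      eval_charpoly, ← h0]
    congr 2
    rw [scalar_apply, smul_one_eq_diagonal]
  set P := c • (1 : Matrix (Fin m) (Fin m) ℂ) + U with hP
  set M := c • (1 : Matrix (Fin m) (Fin m) ℂ) - U with hM
  have hMM : M * M⁻¹ = 1 := mul_nonsing_inv M hdet
  have hMM' : M⁻¹ * M = 1 := nonsing_inv_mul M hdet
  have hUU : U * star U = 1 := mem_unitaryGroup_iff.mp hU
  have hUU' : star U * U = 1 := mem_unitaryGroup_iff'.mp hU
  set H := Complex.I • (P * M⁻¹) with hH
  have hPM : star P * M = - (star M * P) := by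
    simp only [hP, hM, star_add, star_sub, star_smul, star_one, add_mul, sub_mul, mul_add, mul_sub,
      smul_mul_assoc, mul_smul_comm, one_mul, mul_one, hUU']
    simp only [smul_add, smul_sub, smul_smul, hcc]
    module
  have hHerm : H.IsHermitian := by
    have h1 : star (M⁻¹) * star M = 1 := by rw [← star_mul, hMM, star_one]
    have h2 : star (M⁻¹) * star P = -(P * M⁻¹) := by
      calc star (M⁻¹) * star P = star (M⁻¹) * (star P * M) * M⁻¹ := by
            rw [mul_assoc, mul_assoc, hMM, mul_one]
        _ = -((star (M⁻¹) * star M) * P * M⁻¹) := by rw [hPM]; noncomm_ring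
        _ = -(P * M⁻¹) := by rw [h1, one_mul]
    rw [IsHermitian, ← star_eq_conjTranspose, hH, star_smul, star_mul, h2]
    simp
  have hHM : H * M = Complex.I • P := by
    rw [hH, smul_mul_assoc, mul_assoc, hMM', mul_one]
  set V := (hHerm.eigenvectorUnitary : Matrix (Fin m) (Fin m) ℂ) with hV
  have hVm : V ∈ unitaryGroup (Fin m) ℂ := hHerm.eigenvectorUnitary.2
  have hVV : V * star V = 1 := mem_unitaryGroup_iff.mp hVm
  have hVV' : star V * V = 1 := mem_unitaryGroup_iff'.mp hVm
  set e := hHerm.eigenvalues with he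
  have hspec : H = V * diagonal (fun j => (e j : ℂ)) * star V := hHerm.spectral_theorem
  have hne : ∀ j, (Complex.I + e j : ℂ) ≠ 0 := by
    intro j h0
    simpa using congrArg Complex.im h0
  -- This inverts the Cayley transform: `H (c - U) = i (c + U)`, solved for `U`.
  have key : (H + Complex.I • (1 : Matrix (Fin m) (Fin m) ℂ)) * U
      = c • (H - Complex.I • (1 : Matrix (Fin m) (Fin m) ℂ)) := by
    have h1 : c • H - H * U = Complex.I • (c • (1 : Matrix (Fin m) (Fin m) ℂ) + U) := by
      rw [← hP, ← hHM, hM, mul_sub, mul_smul_comm, mul_one]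
    have h3 : (H + Complex.I • (1 : Matrix (Fin m) (Fin m) ℂ)) * U = H * U + Complex.I • U := by
      rw [add_mul, smul_one_mul]
    rw [h3, smul_sub]
    have h2 : H * U = c • H - Complex.I • (c • (1 : Matrix (Fin m) (Fin m) ℂ) + U) := by
      rw [← h1]; abel
    rw [h2]
    module
  set d : Fin m → ℂ := fun j => c * (e j - Complex.I) / (Complex.I + e j) with hd
  have hUd : U = V * diagonal d * star V := by
    set Y := star V * U * V with hY
    have h1 : diagonal (fun j => (Complex.I + e j : ℂ)) * Y
        = diagonal (fun j => c * ((e j : ℂ) - Complex.I)) := by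
      have h3 : star V * ((H + Complex.I • (1 : Matrix (Fin m) (Fin m) ℂ)) * U) * V
          = star V * (c • (H - Complex.I • (1 : Matrix (Fin m) (Fin m) ℂ))) * V := by rw [key]
      have h4 : star V * (H + Complex.I • (1 : Matrix (Fin m) (Fin m) ℂ))
          = diagonal (fun j => (Complex.I + e j : ℂ)) * star V := by
        rw [mul_add, hspec, ← mul_assoc, ← mul_assoc, hVV', one_mul]
        rw [mul_smul_comm, mul_one, ← smul_one_mul, ← add_mul, smul_one_eq_diagonal,
          diagonal_add]
        congr 2
        ext j
        ring
      have h5 : star V * (c • (H - Complex.I • (1 : Matrix (Fin m) (Fin m) ℂ)))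
          = diagonal (fun j => c * ((e j : ℂ) - Complex.I)) * star V := by
        rw [mul_smul_comm, mul_sub, hspec, ← mul_assoc, ← mul_assoc, hVV', one_mul]
        rw [mul_smul_comm, mul_one, ← smul_one_mul Complex.I (star V), ← sub_mul,
          smul_one_eq_diagonal, diagonal_sub, ← smul_mul_assoc, ← diagonal_smul]
        rfl
      rw [h5, ← mul_assoc, h4, mul_assoc _ (star V) V, hVV', mul_one] at h3
      rw [hY, ← h3]
      noncomm_ring
    have h2 : Y = diagonal d := by
      ext i j
      have h3 := congrFun (congrFun h1 i) j
      rw [diagonal_mul] at h3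
      apply mul_left_cancel₀ (hne i)
      rw [h3]
      by_cases hij : i = j
      · subst hij
        rw [diagonal_apply_eq, diagonal_apply_eq, hd]
        field_simp [hne i]
      · rw [diagonal_apply_ne _ hij, diagonal_apply_ne _ hij, mul_zero]
    rw [← h2, hY]
    simp only [← mul_assoc]
    rw [hVV, one_mul, mul_assoc, hVV, mul_one]
  refine ⟨V, hVm, d, norm_eq_one_of_unitary_diagonal ?_, hUd⟩
  have : diagonal d = star V * U * V := by
    rw [hUd]
    simp only [← mul_assoc]
    rw [hVV', one_mul, mul_assoc, hVV', mul_one]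
  rw [this]
  exact mul_mem (mul_mem (Unitary.star_mem hVm) hU) hVm

/-- The sum of the values of `r` at the eigenvalues of `U`, with multiplicities. -/
def eigSum {E : Type*} [AddCommMonoid E] {ι : Type*} [Fintype ι] [DecidableEq ι] (r : ℂ → E)
    (U : Matrix ι ι ℂ) : E :=
  (U.charpoly.roots.map r).sum

theorem roots_charpoly_diagonal {ι : Type*} [Fintype ι] [DecidableEq ι] (d : ι → ℂ) :
    (diagonal d).charpoly.roots = Finset.univ.val.map d := by
  rw [charpoly_diagonal]
  have h := Polynomial.roots_multiset_prod_X_sub_C ((Finset.univ : Finset ι).val.map d)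
  rw [Multiset.map_map] at h
  exact h

theorem eigSum_diagonal {E : Type*} [AddCommMonoid E] {ι : Type*} [Fintype ι] [DecidableEq ι]
    (r : ℂ → E) (d : ι → ℂ) : eigSum r (diagonal d) = ∑ j, r (d j) := by
  rw [eigSum, roots_charpoly_diagonal, Multiset.map_map]
  rfl

theorem charpoly_conj {m : ℕ} {V D : Matrix (Fin m) (Fin m) ℂ} (hV : V ∈ unitaryGroup (Fin m) ℂ) :
    (V * D * star V).charpoly = D.charpoly := by
  rw [charpoly_mul_comm, ← mul_assoc, mem_unitaryGroup_iff'.mp hV, one_mul]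

theorem eigSum_conj_diagonal {E : Type*} [AddCommMonoid E] {m : ℕ} {V : Matrix (Fin m) (Fin m) ℂ}
    (hV : V ∈ unitaryGroup (Fin m) ℂ) (r : ℂ → E) (d : Fin m → ℂ) :
    eigSum r (V * diagonal d * star V) = ∑ j, r (d j) := by
  rw [eigSum, charpoly_conj hV, ← eigSum, eigSum_diagonal]

/-- Power sums of eigenvalues are traces of powers. The inverse of an eigenvalue on the circle is
its conjugate, so negative powers become powers of `star U`. Thus these sums are visibly continuous
in `U`. -/
theorem eigSum_zpow_ofNat {m : ℕ} {U : Matrix (Fin m) (Fin m) ℂ}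
    (hU : U ∈ unitaryGroup (Fin m) ℂ) (k : ℕ) :
    eigSum (fun z => z ^ (k : ℤ)) U = (U ^ k).trace
      ∧ eigSum (fun z => z ^ (-(k : ℤ))) U = ((star U) ^ k).trace := by
  obtain ⟨V, hV, d, hd, rfl⟩ := exists_unitary_diagonalization hU
  have hpow : ∀ e : Fin m → ℂ, ((V * diagonal e * star V) ^ k).trace = ∑ j, e j ^ k := by
    intro e
    have h1 : (V * diagonal e * star V) ^ k = V * diagonal (e ^ k) * star V := by
      induction k with
      | zero => simp [mem_unitaryGroup_iff.mp hV]
      | succ k ih =>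
        rw [pow_succ, ih]
        calc V * diagonal (e ^ k) * star V * (V * diagonal e * star V)
            = V * diagonal (e ^ k) * (star V * V) * diagonal e * star V := by noncomm_ring
          _ = V * diagonal (e ^ (k + 1)) * star V := by
            rw [mem_unitaryGroup_iff'.mp hV, mul_one, mul_assoc V, diagonal_mul_diagonal, pow_succ]
            rfl
    rw [h1, trace_mul_comm, ← mul_assoc, mem_unitaryGroup_iff'.mp hV, one_mul, trace_diagonal]
    rfl
  refine ⟨?_, ?_⟩
  · rw [eigSum_conj_diagonal hV, hpow]
    simp
  · have h2 : star (V * diagonal d * star V) = V * diagonal (star d) * star V := by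
      rw [star_mul, star_star, star_mul, star_eq_conjTranspose (diagonal d),
        diagonal_conjTranspose, mul_assoc]
    rw [eigSum_conj_diagonal hV, h2, hpow]
    refine Finset.sum_congr rfl fun j _ => ?_
    have h3 : star (d j) = (d j)⁻¹ := by
      rw [RCLike.star_def]
      exact (Complex.inv_eq_conj (hd j)).symm
    rw [_root_.zpow_neg, zpow_natCast, Pi.star_apply, h3, inv_pow]

theorem continuousOn_eigSum_zpow {m : ℕ} (n : ℤ) :
    ContinuousOn (fun U : Matrix (Fin m) (Fin m) ℂ => eigSum (fun z => z ^ n) U)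
      (unitaryGroup (Fin m) ℂ) := by
  obtain ⟨k, rfl | rfl⟩ := n.eq_nat_or_neg
  · refine ContinuousOn.congr (f := fun U => (U ^ k).trace) ?_
      fun U hU => (eigSum_zpow_ofNat hU k).1
    exact ((continuous_id.pow k).matrix_trace).continuousOn
  · refine ContinuousOn.congr (f := fun U => ((star U) ^ k).trace) ?_
      fun U hU => (eigSum_zpow_ofNat hU k).2
    exact ((continuous_star.pow k).matrix_trace).continuousOn

theorem eigSum_congr {E : Type*} [AddCommMonoid E] {m : ℕ} {U : Matrix (Fin m) (Fin m) ℂ}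
    (hU : U ∈ unitaryGroup (Fin m) ℂ) {r s : ℂ → E} (h : ∀ z, ‖z‖ = 1 → r z = s z) :
    eigSum r U = eigSum s U := by
  obtain ⟨V, hV, d, hd, rfl⟩ := exists_unitary_diagonalization hU
  rw [eigSum_conj_diagonal hV, eigSum_conj_diagonal hV]
  exact Finset.sum_congr rfl fun j _ => h _ (hd j)

/-- Transports functions on the unit circle to `AddCircle 1`, where trigonometric polynomials are
dense. -/
theorem toCircle_arg {z : ℂ} (hz : ‖z‖ = 1) (n : ℤ) :
    fourier n (((z.arg / (2 * Real.pi) : ℝ)) : AddCircle (1 : ℝ)) = z ^ n := by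
  have h1 : Complex.exp (z.arg * Complex.I) = z := by
    have := Complex.norm_mul_exp_arg_mul_I z
    rwa [hz, Complex.ofReal_one, one_mul] at this
  have hp : (Real.pi : ℂ) ≠ 0 := by exact_mod_cast Real.pi_ne_zero
  rw [fourier_coe_apply]
  conv_rhs => rw [← h1, ← Complex.exp_int_mul]
  congr 1
  push_cast
  field_simp

/-- Laurent polynomials in `z` have continuous eigenvalue sums because these are traces. They are
uniformly dense in the continuous functions on the circle, and a uniform error is multiplied by at
most the number `m` of eigenvalues. -/
theorem continuousOn_eigSum {m : ℕ} {r : ℂ → ℂ} (hr : ContinuousOn r (Metric.sphere 0 1)) :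
    ContinuousOn (fun U : Matrix (Fin m) (Fin m) ℂ => eigSum r U) (unitaryGroup (Fin m) ℂ) := by
  set lift : C(AddCircle (1 : ℝ), ℂ) → ℂ → ℂ :=
    fun f z => f ((z.arg / (2 * Real.pi) : ℝ) : AddCircle (1 : ℝ)) with hlift
  have hspan : ∀ f ∈ Submodule.span ℂ (Set.range (@fourier 1)),
      ContinuousOn (fun U : Matrix (Fin m) (Fin m) ℂ => eigSum (lift f) U)
        (unitaryGroup (Fin m) ℂ) := by
    intro f hf
    induction hf using Submodule.span_induction with
    | mem f hf =>
      obtain ⟨n, rfl⟩ := hf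
      exact (continuousOn_eigSum_zpow n).congr fun U hU =>
        eigSum_congr hU fun z hz => toCircle_arg hz n
    | zero =>
      refine continuousOn_const (c := 0) |>.congr fun U _ => ?_
      simp [hlift, eigSum]
    | add f g _ _ hf hg =>
      refine (hf.add hg).congr fun U _ => ?_
      simp [hlift, eigSum, Multiset.sum_map_add]
    | smul c f _ hf =>
      refine (hf.const_smul c).congr fun U _ => ?_
      simp [hlift, eigSum, Multiset.sum_map_mul_left]
  set f₀ : C(AddCircle (1 : ℝ), ℂ) := ⟨fun x => r (fourier 1 x), by
    refine hr.comp_continuous (map_continuous _) fun x => ?_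
    simp [fourier_apply, Circle.norm_coe]⟩ with hf₀
  have hf₀r : ∀ z, ‖z‖ = 1 → lift f₀ z = r z := by
    intro z hz
    simp only [hlift, hf₀, ContinuousMap.coe_mk]
    rw [toCircle_arg hz, zpow_one]
  have : Fact ((0 : ℝ) < 1) := ⟨one_pos⟩
  have hdense : f₀ ∈ (Submodule.span ℂ (Set.range (@fourier 1))).topologicalClosure := by
    rw [span_fourier_closure_eq_top]; trivial
  refine ContinuousOn.congr (f := fun U => eigSum (lift f₀) U) ?_
    fun U hU => (eigSum_congr hU hf₀r).symm
  refine continuousOn_of_uniform_approx_of_continuousOn fun u hu => ?_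
  obtain ⟨ε, hε, hu⟩ := Metric.mem_uniformity_dist.mp hu
  -- Dividing by `m + 1` instead of `m` also covers `m = 0` and leaves a strict inequality at the
  -- end.
  obtain ⟨f, hf, hdist⟩ := Metric.mem_closure_iff.mp hdense (ε / (m + 1)) (by positivity)
  refine ⟨_, hspan f hf, fun U hU => hu ?_⟩
  obtain ⟨V, hV, d, -, rfl⟩ := exists_unitary_diagonalization hU
  rw [eigSum_conj_diagonal hV, eigSum_conj_diagonal hV]
  calc dist (∑ j, lift f₀ (d j)) (∑ j, lift f (d j))
      ≤ ∑ j, dist (lift f₀ (d j)) (lift f (d j)) := dist_sum_sum_le _ _ _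
    _ ≤ ∑ _j : Fin m, ε / (m + 1) :=
      Finset.sum_le_sum fun j _ => (ContinuousMap.dist_apply_le_dist _).trans hdist.le
    _ < ε := by
      rw [Finset.sum_const, Finset.card_univ, Fintype.card_fin, nsmul_eq_mul, mul_div_assoc',
        div_lt_iff₀ (by positivity)]
      nlinarith

theorem continuousOn_eigSum_real {m : ℕ} {r : ℂ → ℝ} (hr : ContinuousOn r (Metric.sphere 0 1)) :
    ContinuousOn (fun U : Matrix (Fin m) (Fin m) ℂ => eigSum r U) (unitaryGroup (Fin m) ℂ) := by
  have h := continuousOn_eigSum (m := m) (r := fun z => (r z : ℂ))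
    (Complex.continuous_ofReal.comp_continuousOn hr)
  refine (Complex.continuous_re.comp_continuousOn h).congr fun U hU => ?_
  obtain ⟨V, hV, d, -, rfl⟩ := exists_unitary_diagonalization hU
  simp only [Function.comp, eigSum_conj_diagonal hV, Complex.re_sum, Complex.ofReal_re]

/-- A bounded function that is continuous at all points of the circle but `b` has a continuous
eigenvalue sum at the unitary matrices of which `b` is no eigenvalue. -/
theorem continuousWithinAt_eigSum {m : ℕ} {r : ℂ → ℝ} {b : ℂ} {C : ℝ}
    (hr : ∀ z, ‖z‖ = 1 → z ≠ b → ContinuousAt r z) (hC : ∀ z, |r z| ≤ C)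
    {U₀ : Matrix (Fin m) (Fin m) ℂ} (hU₀ : U₀ ∈ unitaryGroup (Fin m) ℂ)
    (hb : b ∉ U₀.charpoly.roots) :
    ContinuousWithinAt (fun U : Matrix (Fin m) (Fin m) ℂ => eigSum r U)
      (unitaryGroup (Fin m) ℂ) U₀ := by
  have hκ : ∃ κ > 0, ∀ z ∈ U₀.charpoly.roots, κ ≤ ‖z - b‖ := by
    have h1 : (U₀.charpoly.roots.toFinset : Set ℂ)ᶜ ∈ nhds b :=
      (Finset.finite_toSet _).isClosed.isOpen_compl.mem_nhds (by simpa using hb)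
    obtain ⟨κ, hκ, h2⟩ := Metric.mem_nhds_iff.mp h1
    refine ⟨κ, hκ, fun z hz => ?_⟩
    by_contra! h3
    have h4 := h2 (Metric.mem_ball.mpr (by rwa [dist_eq_norm]))
    exact h4 (by simpa using hz)
  obtain ⟨κ, hκ, hroots⟩ := hκ
  -- A cutoff that vanishes at `b` and equals `1` at the eigenvalues of `U₀`. Boundedness makes `r
  -- χ` continuous at `b` too, and the error `r (1 - χ)` is dominated by `C (1 - χ)`, whose
  -- continuous eigenvalue sum vanishes at `U₀`.
  set χ : ℂ → ℝ := fun z => min 1 (‖z - b‖ / κ) with hχ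
  have hχc : Continuous χ := by fun_prop
  have hχ0 : ∀ z, 0 ≤ χ z := fun z => le_min zero_le_one (by positivity)
  have hχ1 : ∀ z, χ z ≤ 1 := fun z => min_le_left _ _
  have hC0 : 0 ≤ C := (abs_nonneg _).trans (hC 0)
  have hrχ : ContinuousOn (fun z => r z * χ z) (Metric.sphere 0 1) := by
    intro z hz
    apply ContinuousAt.continuousWithinAt
    by_cases hzb : z = b
    · have h0 : χ z = 0 := by simp [hχ, hzb]
      have h1 : Filter.Tendsto (fun y => C * χ y) (nhds z) (nhds 0) := by
        have := (hχc.continuousAt (x := z)).tendsto.const_mul C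
        rwa [h0, mul_zero] at this
      rw [ContinuousAt, h0, mul_zero]
      refine squeeze_zero_norm (fun y => ?_) h1
      rw [Real.norm_eq_abs, abs_mul, abs_of_nonneg (hχ0 y)]
      exact mul_le_mul_of_nonneg_right (hC y) (hχ0 y)
    · exact (hr z (by simpa using hz) hzb).mul hχc.continuousAt
  have h1 := continuousOn_eigSum_real (m := m) hrχ U₀ hU₀
  have h2 := continuousOn_eigSum_real (m := m) (r := fun z => C * (1 - χ z))
    (by fun_prop) U₀ hU₀
  have hone : ∀ z ∈ U₀.charpoly.roots, χ z = 1 := fun z hz =>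
    min_eq_left ((one_le_div hκ).mpr (hroots z hz))
  have e1 : eigSum (fun z => r z * χ z) U₀ = eigSum r U₀ := by
    unfold eigSum
    congr 1
    exact Multiset.map_congr rfl fun z hz => by rw [hone z hz, mul_one]
  have e2 : eigSum (fun z => C * (1 - χ z)) U₀ = 0 := by
    unfold eigSum
    refine Multiset.sum_eq_zero fun x hx => ?_
    obtain ⟨z, hz, rfl⟩ := Multiset.mem_map.mp hx
    rw [hone z hz]
    ring
  have h3 : Filter.Tendsto (fun U : Matrix (Fin m) (Fin m) ℂ =>
      eigSum r U - eigSum (fun z => r z * χ z) U)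
      (nhdsWithin U₀ (unitaryGroup (Fin m) ℂ)) (nhds 0) := by
    refine squeeze_zero_norm' ?_ (by simpa only [ContinuousWithinAt, e2] using h2)
    filter_upwards [self_mem_nhdsWithin] with U hU
    obtain ⟨V, hV, d, -, rfl⟩ := exists_unitary_diagonalization hU
    rw [eigSum_conj_diagonal hV, eigSum_conj_diagonal hV, eigSum_conj_diagonal hV,
      ← Finset.sum_sub_distrib]
    refine norm_sum_le_of_le _ fun j _ => ?_
    rw [← mul_one_sub, Real.norm_eq_abs, abs_mul, abs_of_nonneg (sub_nonneg.mpr (hχ1 _))]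
    exact mul_le_mul_of_nonneg_right (hC _) (sub_nonneg.mpr (hχ1 _))
  have h4 := h3.add h1
  simp only [sub_add_cancel, zero_add, e1] at h4
  exact h4

end RobbinSalamon

end


noncomputable section

/-! ## The signature of a perturbed quadratic form -/

namespace RobbinSalamon

section Perturbation

variable {E : Type*} [NormedAddCommGroup E] [NormedSpace ℝ E] [FiniteDimensional ℝ E]

theorem continuous_quadraticForm (q : QuadraticForm ℝ E) : Continuous q := by
  have h : ∀ v, q v = QuadraticMap.associated (R := ℝ) q v v := fun v =>
    (QuadraticMap.associated_eq_self_apply ℝ q v).symm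
  have h2 : Continuous fun v : E => (QuadraticMap.associated (R := ℝ) q).toContinuousBilinearMap v v := by
    fun_prop
  refine h2.congr fun v => ?_
  rw [h v]
  rfl

theorem exists_polar_bound (q : QuadraticForm ℝ E) :
    ∃ C > 0, (∀ v, |q v| ≤ C * ‖v‖ ^ 2) ∧ ∀ u v, |QuadraticMap.polar q u v| ≤ C * (‖u‖ * ‖v‖) := by
  set B := (QuadraticMap.polarBilin q).toContinuousBilinearMap with hB
  have hBe : ∀ u v, B u v = QuadraticMap.polar q u v := fun u v => rfl
  refine ⟨‖B‖ + 1, by positivity, fun v => ?_, fun u v => ?_⟩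
  · have h1 : QuadraticMap.polar q v v = 2 * q v := by simp [QuadraticMap.polar_self]
    have h2 := B.le_opNorm₂ v v
    rw [hBe, h1, Real.norm_eq_abs, abs_mul, abs_two] at h2
    nlinarith [abs_nonneg (q v), sq_nonneg ‖v‖, norm_nonneg v]
  · have h2 := B.le_opNorm₂ u v
    rw [hBe, Real.norm_eq_abs] at h2
    nlinarith [mul_nonneg (norm_nonneg u) (norm_nonneg v)]

/-- Compactness of the unit sphere of `V`; if that sphere is empty then `V = 0` and any constant
works. -/
theorem exists_lower_bound (q : QuadraticForm ℝ E) (V : Submodule ℝ E) (h : (q.restrict V).PosDef) :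
    ∃ c > 0, ∀ v ∈ V, c * ‖v‖ ^ 2 ≤ q v := by
  have hpos : ∀ v ∈ V, v ≠ 0 → 0 < q v := fun v hv h0 =>
    h ⟨v, hv⟩ (by simpa [Subtype.ext_iff] using h0)
  have hK : IsCompact ((V : Set E) ∩ Metric.sphere 0 1) :=
    (isCompact_sphere 0 1).inter_left V.closed_of_finiteDimensional
  by_cases hne : ((V : Set E) ∩ Metric.sphere 0 1).Nonempty
  · obtain ⟨x, hx, hmin⟩ := hK.exists_isMinOn hne (continuous_quadraticForm q).continuousOn
    have hx1 : ‖x‖ = 1 := by simpa using hx.2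
    refine ⟨q x, hpos x hx.1 (by intro h0; simp [h0] at hx1), fun v hv => ?_⟩
    by_cases hv0 : v = 0
    · simp [hv0]
    have hn : ‖v‖ ≠ 0 := norm_ne_zero_iff.mpr hv0
    have h1 : q x ≤ q (‖v‖⁻¹ • v) := hmin ⟨V.smul_mem _ hv, by simp [norm_smul, hn]⟩
    rw [QuadraticMap.map_smul, smul_eq_mul] at h1
    calc q x * ‖v‖ ^ 2 ≤ (‖v‖⁻¹ * ‖v‖⁻¹ * q v) * ‖v‖ ^ 2 := by gcongr
      _ = q v := by field_simp
  · refine ⟨1, one_pos, fun v hv => ?_⟩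
    by_cases hv0 : v = 0
    · simp [hv0]
    exact absurd ⟨‖v‖⁻¹ • v, V.smul_mem _ hv, by simp [norm_smul, hv0]⟩ hne

/-- The positive index of a form that is close to `q + τ q'` is at least that of `q` plus that of `q'`
on a subspace of the radical of `q`, for small `τ > 0`. -/
theorem sigPos_add_le (q q' : QuadraticForm ℝ E) (R : Submodule ℝ E)
    (hR : ∀ b ∈ R, ∀ x, q (x + b) = q x) :
    ∃ ε > 0, ∃ τ₀ > 0, ∀ τ, 0 < τ → τ < τ₀ → ∀ q₁ : QuadraticForm ℝ E,
      (∀ v, |q₁ v - q v - τ * q' v| ≤ ε * τ * ‖v‖ ^ 2) →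
      sigPos q + sigPos (q'.restrict R) ≤ sigPos q₁ := by
  obtain ⟨V, hVr, hV⟩ := exists_finrank_eq_sigPos_and_posDef q
  obtain ⟨K, hKr, hK⟩ := exists_finrank_eq_sigPos_and_posDef (q'.restrict R)
  set K' := K.map R.subtype with hK'
  have hK'r : Module.finrank ℝ K' = Module.finrank ℝ K :=
    (Submodule.equivMapOfInjective _ (Submodule.injective_subtype R) K).symm.finrank_eq
  have hK'R : ∀ b ∈ K', b ∈ R := by
    rintro _ ⟨b, -, rfl⟩
    exact b.2
  have hK'pos : (q'.restrict K').PosDef := by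
    rintro ⟨_, b, hb, rfl⟩ h0
    exact hK ⟨b, hb⟩ (by
      intro h1
      apply h0
      have h2 : b = 0 := congrArg Subtype.val h1
      simp [h2])
  obtain ⟨c₁, hc₁, hqV⟩ := exists_lower_bound q V hV
  obtain ⟨c₂, hc₂, hqK⟩ := exists_lower_bound q' K' hK'pos
  obtain ⟨C, hC, hb1, hb2⟩ := exists_polar_bound q'
  set c := min c₁ c₂ with hc
  have hc0 : 0 < c := lt_min hc₁ hc₂
  -- `q` vanishes on `R` (take `x = 0` in `hR`) and is positive on `V` off the origin.
  have hdisj : Disjoint V K' := by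
    rw [Submodule.disjoint_def]
    intro x hx hx'
    have h1 := hqV x hx
    have h2 : q x = 0 := by
      have := hR x (hK'R x hx') 0
      rwa [zero_add, QuadraticMap.map_zero] at this
    rw [h2] at h1
    have h3 : ‖x‖ ^ 2 ≤ 0 := by nlinarith
    have h4 : ‖x‖ = 0 := by nlinarith [norm_nonneg x]
    exact norm_eq_zero.mp h4
  -- For `a ∈ V` and `b ∈ K'` the form `τ q'` contributes `τ c ‖b‖²`. Of this the cross term costs
  -- half and the error at most a quarter, as `‖a + b‖² ≤ 2 (‖a‖² + ‖b‖²)`. The bound on `τ` keeps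
  -- the total loss in `‖a‖²` below `c`, so that `q₁` is positive on `V ⊕ K'`.
  refine ⟨c / 8, by positivity, c / (C + C ^ 2 / (2 * c) + c / 4), by positivity, ?_⟩
  intro τ hτ hτ0 q₁ hq₁
  rw [lt_div_iff₀ (by positivity)] at hτ0
  have hpd : (q₁.restrict (V ⊔ K')).PosDef := by
    rintro ⟨v, hv⟩ hv0
    obtain ⟨a, ha, b, hb, rfl⟩ := Submodule.mem_sup.mp hv
    have h1 := (abs_le.mp (hq₁ (a + b))).1
    rw [hR b (hK'R b hb) a] at h1
    have h2 : q' (a + b) = q' a + q' b + QuadraticMap.polar q' a b := by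
      simp [QuadraticMap.polar]
    have h3 := (abs_le.mp (hb1 a)).1
    have h4 := (abs_le.mp (hb2 a b)).1
    have h5 := hqV a ha
    have h6 := hqK b hb
    set x := ‖a‖ with hx
    set y := ‖b‖ with hy
    have hx0 : 0 ≤ x := norm_nonneg a
    have hy0 : 0 ≤ y := norm_nonneg b
    have h7 : ‖a + b‖ ^ 2 ≤ 2 * (x ^ 2 + y ^ 2) := by
      have := norm_add_le a b
      nlinarith [norm_nonneg (a + b), sq_nonneg (x - y)]
    -- Young's inequality, weighted so that only half of the positive term `c y²` is spent.
    have h8 : C * (x * y) ≤ c / 2 * y ^ 2 + C ^ 2 / (2 * c) * x ^ 2 := by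
      have : c / 2 * y ^ 2 + C ^ 2 / (2 * c) * x ^ 2 - C * (x * y)
          = (c * y - C * x) ^ 2 / (2 * c) := by field_simp; ring
      have h9 : 0 ≤ (c * y - C * x) ^ 2 / (2 * c) := by positivity
      linarith
    have h9 : c * x ^ 2 ≤ q a := le_trans (by gcongr; exact min_le_left _ _) h5
    have h10 : c * y ^ 2 ≤ q' b := le_trans (by gcongr; exact min_le_right _ _) h6
    have h11 : q' (a + b) ≥ -(C * x ^ 2) + c * y ^ 2 - (c / 2 * y ^ 2 + C ^ 2 / (2 * c) * x ^ 2) := by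
      rw [h2]; linarith
    have h12 := mul_le_mul_of_nonneg_left h11 hτ.le
    have h13 : c / 8 * τ * ‖a + b‖ ^ 2 ≤ c / 8 * τ * (2 * (x ^ 2 + y ^ 2)) := by gcongr
    have h14 : q₁ (a + b) ≥ x ^ 2 * (c - τ * (C + C ^ 2 / (2 * c) + c / 4)) + τ * (c / 4) * y ^ 2 := by
      nlinarith
    have h15 : 0 < x ∨ 0 < y := by
      by_contra! h
      apply hv0
      have ha0 : a = 0 := norm_eq_zero.mp (le_antisymm h.1 hx0)
      have hb0 : b = 0 := norm_eq_zero.mp (le_antisymm h.2 hy0)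
      simp [ha0, hb0]
    have h16 : 0 < c - τ * (C + C ^ 2 / (2 * c) + c / 4) := by linarith
    change 0 < q₁ (a + b)
    refine lt_of_lt_of_le ?_ h14
    rcases h15 with h | h
    · have : 0 < x ^ 2 * (c - τ * (C + C ^ 2 / (2 * c) + c / 4)) := by positivity
      have : 0 ≤ τ * (c / 4) * y ^ 2 := by positivity
      linarith
    · have : 0 ≤ x ^ 2 * (c - τ * (C + C ^ 2 / (2 * c) + c / 4)) := by positivity
      have : 0 < τ * (c / 4) * y ^ 2 := by positivity
      linarith
  have h1 := le_sigPos_of_posDef q₁ hpd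
  have h2 := Submodule.finrank_sup_add_finrank_inf_eq V K'
  rw [hdisj.eq_bot, finrank_bot, add_zero] at h2
  omega

/-- The signature of a form that is close to `q + τ q'` is that of `q` plus that of `q'` on the radical
of `q`, for small `τ > 0`, if `q'` is nondegenerate on the radical. -/
theorem signature_perturbation (q q' : QuadraticForm ℝ E) (hnd : (q'.restrict q.radical).radical = ⊥) :
    ∃ ε > 0, ∃ τ₀ > 0, ∀ τ, 0 < τ → τ < τ₀ → ∀ q₁ : QuadraticForm ℝ E,
      (∀ v, |q₁ v - q v - τ * q' v| ≤ ε * τ * ‖v‖ ^ 2) →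
      (sigPos q₁ : ℝ) - sigNeg q₁ = (sigPos q - sigNeg q)
        + (sigPos (q'.restrict q.radical) - sigNeg (q'.restrict q.radical)) := by
  have hR : ∀ b ∈ q.radical, ∀ x, q (x + b) = q x := fun b hb x => by
    rw [add_comm]
    exact (QuadraticMap.mem_radical_iff'.mp hb).2 x
  obtain ⟨ε₁, hε₁, τ₁, hτ₁, h₁⟩ := sigPos_add_le q q' q.radical hR
  obtain ⟨ε₂, hε₂, τ₂, hτ₂, h₂⟩ := sigPos_add_le (-q) (-q') q.radical
    (fun b hb x => by simp [hR b hb x])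
  refine ⟨min ε₁ ε₂, lt_min hε₁ hε₂, min τ₁ τ₂, lt_min hτ₁ hτ₂, fun τ hτ hτ0 q₁ hq₁ => ?_⟩
  have e1 := h₁ τ hτ (hτ0.trans_le (min_le_left _ _)) q₁ fun v => (hq₁ v).trans (by
    gcongr; exact min_le_left _ _)
  have e2 := h₂ τ hτ (hτ0.trans_le (min_le_right _ _)) (-q₁) fun v => by
    have h3 : (-q₁) v - (-q) v - τ * (-q') v = -(q₁ v - q v - τ * q' v) := by
      simp; ring
    rw [h3, abs_neg]
    exact (hq₁ v).trans (by gcongr; exact min_le_right _ _)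
  have e2' : sigNeg q + sigNeg (q'.restrict q.radical) ≤ sigNeg q₁ := e2
  -- The two lower bounds already add up to the full dimension, because `q'` is nondegenerate on the
  -- radical. Hence both are equalities.
  have e3 := QuadraticForm.sigPos_add_sigNeg_add_radical (Q := q)
  have e4 := QuadraticForm.sigPos_add_sigNeg_add_radical (Q := q'.restrict q.radical)
  have e5 := QuadraticForm.sigPos_add_sigNeg_add_radical (Q := q₁)
  rw [hnd, finrank_bot, add_zero] at e4
  have e6 : sigPos q₁ = sigPos q + sigPos (q'.restrict q.radical) := by omega
  have e7 : sigNeg q₁ = sigNeg q + sigNeg (q'.restrict q.radical) := by omega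
  rw [e6, e7]
  push_cast
  ring

end Perturbation

theorem equivalent_smul {E : Type*} [AddCommGroup E] [Module ℝ E] {c : ℝ} (hc : 0 < c)
    (q : QuadraticForm ℝ E) : QuadraticMap.Equivalent (c • q) q := by
  refine ⟨⟨LinearEquiv.smulOfNeZero ℝ E (√c) (Real.sqrt_pos.mpr hc).ne', fun x => ?_⟩⟩
  change q (√c • x) = c • q x
  rw [QuadraticMap.map_smul, Real.mul_self_sqrt hc.le]

theorem sigPos_sub_sigNeg_weightedSumSquares {ι : Type*} [Fintype ι] (w : ι → ℝ) :
    (sigPos (QuadraticMap.weightedSumSquares ℝ w) : ℝ) - sigNeg (QuadraticMap.weightedSumSquares ℝ w)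
      = ∑ i, (SignType.sign (w i) : ℝ) := by
  classical
  rw [QuadraticForm.sigPos_weightedSumSquares, QuadraticForm.sigNeg_weightedSumSquares]
  have h : ∀ i, (SignType.sign (w i) : ℝ) = (if 0 < w i then 1 else 0) - (if w i < 0 then 1 else 0) := by
    intro i
    rcases lt_trichotomy (w i) 0 with h | h | h
    · simp [h, not_lt.mpr h.le]
    · simp [h]
    · simp [h, not_lt.mpr h.le]
  simp_rw [h]
  rw [Finset.sum_sub_distrib, Finset.sum_boole, Finset.sum_boole, Set.ncard_eq_toFinset_card',
    Set.ncard_eq_toFinset_card']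
  simp

end RobbinSalamon

end


noncomputable section

/-! ## The index of a path of unitary matrices -/

namespace RobbinSalamon

open Matrix

/-- A function on `[a, b]` whose left and right jumps at all points `t` are `s(t) / 2`. -/
theorem sub_eq_sum_of_jumps {a b : ℝ} (hab : a < b) {N s : ℝ → ℝ}
    (h : ∀ t ∈ Set.Icc a b, ∀ᶠ u in nhdsWithin t (Set.Icc a b),
      N u = N t + SignType.sign (u - t) * (s t / 2)) :
    N b - N a = s a / 2 + (∑ᶠ t ∈ Set.Ioo a b, s t) + s b / 2 := by
  -- Near `t` and on one side of it, `N` is constant by the hypothesis at `t`. A nearby point `u ≠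
  -- t` with `s u ≠ 0` would contradict the hypothesis at `u`. So the jumps are isolated, and finite
  -- in number by compactness.
  have hfin : (Set.Icc a b ∩ {t | s t ≠ 0}).Finite := by
    refine isCompact_Icc.induction_on (p := fun K => (K ∩ {t | s t ≠ 0}).Finite) (by simp)
      (fun K L hKL hL => hL.subset (Set.inter_subset_inter_left _ hKL))
      (fun K L hK hL => by rw [Set.union_inter_distrib_right]; exact hK.union hL) fun t ht => ?_
    have h1 := h t ht
    have h2 : ∀ᶠ u in nhdsWithin t (Set.Icc a b), u ∈ Set.Icc a b ∧ (u ≠ t → s u = 0) := by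
      rw [eventually_nhdsWithin_iff, Metric.eventually_nhds_iff] at h1
      obtain ⟨ε, hε, h1⟩ := h1
      have hnear : ∀ᶠ u in nhdsWithin t (Set.Icc a b), dist u t < ε :=
        mem_nhdsWithin_of_mem_nhds (Metric.ball_mem_nhds t hε)
      filter_upwards [self_mem_nhdsWithin, hnear] with u hu hut
      refine ⟨hu, fun hne => ?_⟩
      have h3 := h u hu
      rw [eventually_nhdsWithin_iff, Metric.eventually_nhds_iff] at h3
      obtain ⟨η, hη, h3⟩ := h3
      have hNu := h1 hut hu
      rw [Real.dist_eq, abs_lt] at hut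
      rcases lt_or_gt_of_ne hne with hlt | hgt
      -- The midpoint of `u` and `min t (u + η)`: it lies strictly between `u` and `t` and within
      -- reach of the hypothesis at `u`.
      · set v := min t (u + η) - (min t (u + η) - u) / 2 with hv
        have hm : u < min t (u + η) := lt_min hlt (by linarith)
        have hm1 := min_le_left t (u + η)
        have hm2 := min_le_right t (u + η)
        have hvI : v ∈ Set.Icc a b := ⟨by linarith [hu.1], by linarith [ht.2]⟩
        have e1 := h1 (y := v) (by rw [Real.dist_eq, abs_lt]; constructor <;> linarith) hvI
        have e2 := h3 (y := v) (by rw [Real.dist_eq, abs_lt]; constructor <;> linarith) hvI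
        rw [sign_neg (by linarith)] at e1
        rw [sign_neg (by linarith)] at hNu
        rw [sign_pos (by linarith)] at e2
        simp at e1 e2 hNu
        linarith
      · set v := max t (u - η) - (max t (u - η) - u) / 2 with hv
        have hm : max t (u - η) < u := max_lt hgt (by linarith)
        have hm1 := le_max_left t (u - η)
        have hm2 := le_max_right t (u - η)
        have hvI : v ∈ Set.Icc a b := ⟨by linarith [ht.1], by linarith [hu.2]⟩
        have e1 := h1 (y := v) (by rw [Real.dist_eq, abs_lt]; constructor <;> linarith) hvI
        have e2 := h3 (y := v) (by rw [Real.dist_eq, abs_lt]; constructor <;> linarith) hvI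
        rw [sign_pos (by linarith)] at e1
        rw [sign_pos (by linarith)] at hNu
        rw [sign_neg (by linarith)] at e2
        simp at e1 e2 hNu
        linarith
    refine ⟨_, h2, (Set.finite_singleton t).subset ?_⟩
    rintro u ⟨⟨-, hu⟩, hsu⟩
    by_contra hne
    exact hsu (hu hne)
  set S := hfin.toFinset with hS
  have hmem : ∀ t, t ∈ S ↔ t ∈ Set.Icc a b ∧ s t ≠ 0 := fun t => by simp [hS]
  have hdelta : ∀ x ∈ Set.Icc a b, ∀ c : ℝ, ∑ t ∈ S, (if t = x then s t * c else 0) = s x * c := by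
    intro x hx c
    rw [Finset.sum_ite_eq' S x]
    split_ifs with hxS
    · rfl
    · have : s x = 0 := by
        by_contra h0
        exact hxS ((hmem x).mpr ⟨hx, h0⟩)
      rw [this, zero_mul]
  -- Subtracting a step function for each jump leaves a locally constant function. The convention
  -- `sign 0 = 0` matches the symmetric form of the jumps.
  set M : ℝ → ℝ := fun x => N x - ∑ t ∈ S, s t * (SignType.sign (x - t) / 2) with hM
  have hloc : ∀ x ∈ Set.Icc a b, ∀ᶠ u in nhdsWithin x (Set.Icc a b), M u = M x := by
    intro x hx
    have h1 : ∀ᶠ u in nhdsWithin x (Set.Icc a b), ∀ t ∈ S, t ≠ x →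
        (SignType.sign (u - t) : ℝ) = SignType.sign (x - t) := by
      rw [Filter.eventually_all_finset]
      intro t _
      by_cases htx : t = x
      · simp [htx]
      · apply Filter.Eventually.filter_mono nhdsWithin_le_nhds
        rcases lt_or_gt_of_ne htx with hlt | hgt
        · filter_upwards [lt_mem_nhds hlt] with u hu _
          rw [sign_pos (by linarith), sign_pos (by linarith)]
        · filter_upwards [gt_mem_nhds hgt] with u hu _
          rw [sign_neg (by linarith), sign_neg (by linarith)]
    filter_upwards [h1, h x hx] with u hu1 hu2
    simp only [hM]
    have h3 : ∑ t ∈ S, s t * (SignType.sign (u - t) / 2) - ∑ t ∈ S, s t * (SignType.sign (x - t) / 2)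
        = s x * (SignType.sign (u - x) / 2) := by
      rw [← hdelta x hx, ← Finset.sum_sub_distrib]
      refine Finset.sum_congr rfl fun t ht => ?_
      split_ifs with htx
      · subst htx
        simp
      · rw [hu1 t ht htx, sub_self]
    rw [hu2]
    linarith
  have hconst := constant_of_has_deriv_right_zero (f := M) (a := a) (b := b)
    (fun x hx => by
      refine (continuousWithinAt_const (b := M x)).congr_of_eventuallyEq (hloc x hx) rfl)
    (fun x hx => by
      have h1 : nhdsWithin x (Set.Ici x) ≤ nhdsWithin x (Set.Icc a b) := by
        rw [← nhdsWithin_Icc_eq_nhdsGE hx.2]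
        exact nhdsWithin_mono _ (Set.Icc_subset_Icc_left hx.1)
      exact (hasDerivWithinAt_const x _ (M x)).congr_of_eventuallyEq
        ((hloc x ⟨hx.1, hx.2.le⟩).filter_mono h1) rfl) b ⟨hab.le, le_rfl⟩
  simp only [hM] at hconst
  have hsum : (∑ᶠ t ∈ Set.Ioo a b, s t) = ∑ t ∈ S, (if t ∈ Set.Ioo a b then s t else 0) := by
    classical
    rw [← Finset.sum_filter]
    refine finsum_mem_eq_sum_of_inter_support_eq _ ?_
    ext t
    simp only [Set.mem_inter_iff, Function.mem_support, Finset.coe_filter, Set.mem_ofPred_eq, hmem]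
    constructor
    · rintro ⟨h1, h2⟩
      exact ⟨⟨⟨⟨h1.1.le, h1.2.le⟩, h2⟩, h1⟩, h2⟩
    · rintro ⟨⟨_, h1⟩, h2⟩
      exact ⟨h1, h2⟩
  -- `sign (b - t) - sign (a - t)` is `2` at interior points and `1` at the two ends, which is the
  -- source of the factors one half.
  have h4 : ∑ t ∈ S, s t * (SignType.sign (b - t) / 2) - ∑ t ∈ S, s t * (SignType.sign (a - t) / 2)
      = s a * (1 / 2) + (∑ᶠ t ∈ Set.Ioo a b, s t) + s b * (1 / 2) := by
    rw [hsum, ← hdelta a ⟨le_rfl, hab.le⟩, ← hdelta b ⟨hab.le, le_rfl⟩, ← Finset.sum_sub_distrib,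
      ← Finset.sum_add_distrib, ← Finset.sum_add_distrib]
    refine Finset.sum_congr rfl fun t ht => ?_
    obtain ⟨⟨h1, h2⟩, -⟩ := (hmem t).mp ht
    rcases h1.eq_or_lt with rfl | h1
    · rw [sub_self, sign_zero, sign_pos (by linarith), if_pos rfl, if_neg hab.ne,
        if_neg (by simp)]
      simp
    rcases h2.eq_or_lt with rfl | h2
    · rw [sub_self, sign_zero, sign_neg (by linarith), if_neg hab.ne', if_pos rfl,
        if_neg (by simp)]
      simp
      ring
    · rw [sign_pos (by linarith), sign_neg (by linarith), if_neg h1.ne', if_neg h2.ne,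
        if_pos ⟨h1, h2⟩]
      simp
      ring
  linarith

/-- The real quadratic form `v ↦ Im (c ⟪v, L v⟫)`. -/
def imForm {m : ℕ} (c : ℂ) (L : EuclideanSpace ℂ (Fin m) →L[ℝ] EuclideanSpace ℂ (Fin m)) :
    QuadraticForm ℝ (EuclideanSpace ℂ (Fin m)) :=
  LinearMap.BilinMap.toQuadraticMap ((omega m).compl₂
    ((c • (LinearMap.id : EuclideanSpace ℂ (Fin m) →ₗ[ℂ] _)).restrictScalars ℝ ∘ₗ L.toLinearMap))

theorem imForm_apply {m : ℕ} (c : ℂ)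
    (L : EuclideanSpace ℂ (Fin m) →L[ℝ] EuclideanSpace ℂ (Fin m)) (v : EuclideanSpace ℂ (Fin m)) :
    imForm c L v = (c * inner ℂ v (L v)).im := by
  rw [← inner_smul_right]
  rfl

theorem imForm_sub {m : ℕ} (c : ℂ)
    (K L : EuclideanSpace ℂ (Fin m) →L[ℝ] EuclideanSpace ℂ (Fin m)) (v : EuclideanSpace ℂ (Fin m)) :
    imForm c (K - L) v = imForm c K v - imForm c L v := by
  simp only [imForm_apply, _root_.sub_apply, inner_sub_right, mul_sub, Complex.sub_im]

theorem imForm_smul {m : ℕ} (c : ℂ) (r : ℝ)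
    (L : EuclideanSpace ℂ (Fin m) →L[ℝ] EuclideanSpace ℂ (Fin m)) (v : EuclideanSpace ℂ (Fin m)) :
    imForm c (r • L) v = r * imForm c L v := by
  simp only [imForm_apply, _root_.smul_apply]
  rw [inner_smul_right_eq_smul, Complex.real_smul, mul_left_comm, Complex.im_ofReal_mul]

theorem abs_imForm_le {m : ℕ} (c : ℂ)
    (L : EuclideanSpace ℂ (Fin m) →L[ℝ] EuclideanSpace ℂ (Fin m)) (v : EuclideanSpace ℂ (Fin m)) :
    |imForm c L v| ≤ ‖c‖ * ‖L‖ * ‖v‖ ^ 2 := by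
  rw [imForm_apply]
  calc _ ≤ ‖c * inner ℂ v (L v)‖ := Complex.abs_im_le_norm _
    _ = ‖c‖ * ‖inner ℂ v (L v)‖ := norm_mul _ _
    _ ≤ ‖c‖ * (‖v‖ * (‖L‖ * ‖v‖)) := by
      gcongr
      exact (norm_inner_le_norm _ _).trans (by gcongr; exact L.le_opNorm v)
    _ = _ := by ring

/-- The real endomorphism of `ℂᵐ` of a complex matrix. -/
def realMap {m : ℕ} (A : Matrix (Fin m) (Fin m) ℂ) :
    EuclideanSpace ℂ (Fin m) →L[ℝ] EuclideanSpace ℂ (Fin m) :=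
  (Matrix.toEuclideanCLM (𝕜 := ℂ) A).restrictScalars ℝ

/-- In coordinates with respect to an orthonormal eigenbasis the form is diagonal: the eigenvalue
`dⱼ` contributes its signed distance `Im (c (dⱼ - 1))` from a line through `1`, up to the scale of
`c`. -/
theorem imForm_realMap_sub_one_apply {m : ℕ} {V : Matrix (Fin m) (Fin m) ℂ}
    (hV : V ∈ unitaryGroup (Fin m) ℂ) (d : Fin m → ℂ) (c : ℂ) (v : EuclideanSpace ℂ (Fin m)) :
    imForm c (realMap (V * diagonal d * star V) - 1) v
      = ∑ j, (c * (d j - 1)).im * ‖(star V *ᵥ v.ofLp) j‖ ^ 2 := by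
  set y := star V *ᵥ v.ofLp with hy
  have hvy : v.ofLp = V *ᵥ y := by
    rw [hy, mulVec_mulVec, mem_unitaryGroup_iff.mp hV, one_mulVec]
  have h1 : inner ℂ v ((realMap (V * diagonal d * star V) - 1) v)
      = ∑ j, star (y j) * ((d j - 1) * y j) := by
    have h2 : ((realMap (V * diagonal d * star V) - 1) v).ofLp
        = V *ᵥ (fun j => (d j - 1) * y j) := by
      have h3 : ((realMap (V * diagonal d * star V) - 1) v).ofLp
          = (V * diagonal d * star V) *ᵥ v.ofLp - v.ofLp := rfl
      rw [h3, ← mulVec_mulVec, ← hy, ← mulVec_mulVec]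
      nth_rewrite 1 [hvy]
      rw [← mulVec_sub]
      congr 1
      ext j
      rw [Pi.sub_apply, mulVec_diagonal]
      ring
    rw [EuclideanSpace.inner_eq_star_dotProduct, h2, hvy, star_mulVec, dotProduct_comm,
      ← dotProduct_mulVec, mulVec_mulVec, ← star_eq_conjTranspose, mem_unitaryGroup_iff'.mp hV,
      one_mulVec]
    rfl
  rw [imForm_apply, h1, Finset.mul_sum, Complex.im_sum]
  refine Finset.sum_congr rfl fun j _ => ?_
  have h4 : c * (star (y j) * ((d j - 1) * y j)) = c * (d j - 1) * ((‖y j‖ ^ 2 : ℝ) : ℂ) := by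
    push_cast
    rw [← Complex.conj_mul', RCLike.star_def]
    ring
  rw [h4, Complex.im_mul_ofReal]

/-- Each complex coordinate gives two real squares with the same weight, whence the factor `2` in
`signature_imForm`. The isometry is recorded explicitly because the radical has to be located, and
not only its dimension. -/
theorem equivalent_imForm {m : ℕ} {V : Matrix (Fin m) (Fin m) ℂ}
    (hV : V ∈ unitaryGroup (Fin m) ℂ) (d : Fin m → ℂ) (c : ℂ) :
    ∃ e : QuadraticMap.IsometryEquiv (imForm c (realMap (V * diagonal d * star V) - 1))
      (QuadraticMap.weightedSumSquares ℝ fun i : Fin m × Fin 2 => (c * (d i.1 - 1)).im),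
      ∀ v j, (e v (j, 0) = ((star V *ᵥ v.ofLp) j).re ∧ e v (j, 1) = ((star V *ᵥ v.ofLp) j).im) := by
  have hVV := mem_unitaryGroup_iff.mp hV
  have hVV' := mem_unitaryGroup_iff'.mp hV
  set e₁ : EuclideanSpace ℂ (Fin m) ≃ₗ[ℝ] (Fin m → ℂ) :=
    { toFun := fun v => star V *ᵥ v.ofLp
      invFun := fun y => WithLp.toLp 2 (V *ᵥ y)
      map_add' := fun u v => by simp [mulVec_add]
      map_smul' := fun r v => by
        simp [mulVec_smul]
      left_inv := fun v => by simp [mulVec_mulVec, hVV]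
      right_inv := fun y => by simp [mulVec_mulVec, hVV'] } with he₁
  set e₂ : EuclideanSpace ℂ (Fin m) ≃ₗ[ℝ] (Fin m × Fin 2 → ℝ) :=
    (e₁.trans (LinearEquiv.piCongrRight fun _ => Complex.basisOneI.equivFun)).trans
      (LinearEquiv.curry ℝ ℝ (Fin m) (Fin 2)).symm with he₂
  have he : ∀ v j, (e₂ v (j, 0) = ((star V *ᵥ v.ofLp) j).re
      ∧ e₂ v (j, 1) = ((star V *ᵥ v.ofLp) j).im) := by
    intro v j
    constructor
    · change Complex.basisOneI.equivFun ((star V *ᵥ v.ofLp) j) 0 = _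
      simp [Module.Basis.equivFun_apply]
    · change Complex.basisOneI.equivFun ((star V *ᵥ v.ofLp) j) 1 = _
      simp [Module.Basis.equivFun_apply]
  refine ⟨⟨e₂, fun v => ?_⟩, he⟩
  rw [imForm_realMap_sub_one_apply hV, QuadraticMap.weightedSumSquares_apply, Fintype.sum_prod_type]
  refine Finset.sum_congr rfl fun j _ => ?_
  change ∑ k, (c * (d j - 1)).im • (e₂ v (j, k) * e₂ v (j, k)) = _
  rw [Fin.sum_univ_two, (he v j).1, (he v j).2, ← Complex.normSq_eq_norm_sq, Complex.normSq_apply,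
    smul_eq_mul, smul_eq_mul]
  ring

/-- The signature of `Im (c ⟪v, (U - 1) v⟫)` counts the eigenvalues of `U` on both sides of a chord
through `1`. -/
theorem signature_imForm {m : ℕ} {U : Matrix (Fin m) (Fin m) ℂ}
    (hU : U ∈ unitaryGroup (Fin m) ℂ) (c : ℂ) :
    (sigPos (imForm c (realMap U - 1)) : ℝ) - sigNeg (imForm c (realMap U - 1))
      = 2 * eigSum (fun z => (SignType.sign ((c * (z - 1)).im) : ℝ)) U := by
  obtain ⟨V, hV, d, -, rfl⟩ := exists_unitary_diagonalization hU
  obtain ⟨e, -⟩ := equivalent_imForm hV d c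
  rw [(show QuadraticMap.Equivalent _ _ from ⟨e⟩).sigPos_eq,
    (show QuadraticMap.Equivalent _ _ from ⟨e⟩).sigNeg_eq, sigPos_sub_sigNeg_weightedSumSquares,
    eigSum_conj_diagonal hV, Fintype.sum_prod_type, Finset.mul_sum]
  refine Finset.sum_congr rfl fun j _ => ?_
  rw [Fin.sum_univ_two]
  ring

/-- The weights that vanish are those of the eigenvalues on the line through `1`. By `hc` the only
such eigenvalue is `1` itself. -/
theorem radical_imForm {m : ℕ} {U : Matrix (Fin m) (Fin m) ℂ}
    (hU : U ∈ unitaryGroup (Fin m) ℂ) (c : ℂ)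
    (hc : ∀ z ∈ U.charpoly.roots, (c * (z - 1)).im = 0 → z = 1) :
    (imForm c (realMap U - 1)).radical = LinearMap.ker (realMap U - 1).toLinearMap := by
  obtain ⟨V, hV, d, -, rfl⟩ := exists_unitary_diagonalization hU
  obtain ⟨e, he⟩ := equivalent_imForm hV d c
  have hd : ∀ j, (c * (d j - 1)).im = 0 → d j = 1 := fun j => hc _ (by
    rw [charpoly_conj hV, roots_charpoly_diagonal]
    exact Multiset.mem_map_of_mem _ (Finset.mem_univ j))
  ext v
  have h1 : v ∈ (imForm c (realMap (V * diagonal d * star V) - 1)).radical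
      ↔ ∀ j, d j ≠ 1 → (star V *ᵥ v.ofLp) j = 0 := by
    have h2 := e.map_radical
    rw [QuadraticForm.radical_weightedSumSquares] at h2
    have h3 : v ∈ (imForm c (realMap (V * diagonal d * star V) - 1)).radical ↔
        e v ∈ Pi.spanSubset ℝ {i : Fin m × Fin 2 | (c * (d i.1 - 1)).im = 0} := by
      rw [← h2]
      refine ⟨fun h => Submodule.mem_map_of_mem h, ?_⟩
      rintro ⟨u, hu, huv⟩
      rwa [← e.toLinearEquiv.injective huv]
    rw [h3, Pi.mem_spanSubset_iff]
    constructor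
    · intro h j hj
      have h4 : ∀ k : Fin 2, e v (j, k) = 0 := fun k => h (j, k) fun h5 => hj (hd j h5)
      apply Complex.ext
      · rw [← (he v j).1, h4]; rfl
      · rw [← (he v j).2, h4]; rfl
    · rintro h ⟨j, k⟩ hjk
      have h5 := h j (fun h6 => hjk (by simp [h6]))
      fin_cases k
      · exact (he v j).1.trans (by rw [h5]; rfl)
      · exact (he v j).2.trans (by rw [h5]; rfl)
  rw [h1]
  set y := star V *ᵥ v.ofLp with hy
  have hvy : v.ofLp = V *ᵥ y := by
    rw [hy, mulVec_mulVec, mem_unitaryGroup_iff.mp hV, one_mulVec]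
  have h2 : v ∈ LinearMap.ker (realMap (V * diagonal d * star V) - 1).toLinearMap
      ↔ V *ᵥ (diagonal d *ᵥ y) = V *ᵥ y := by
    rw [LinearMap.mem_ker]
    have h3 : ((realMap (V * diagonal d * star V) - 1) v).ofLp
        = V *ᵥ (diagonal d *ᵥ y) - V *ᵥ y := by
      have h4 : ((realMap (V * diagonal d * star V) - 1) v).ofLp
        = (V * diagonal d * star V) *ᵥ v.ofLp - v.ofLp := rfl
      rw [h4, ← mulVec_mulVec, ← hy, ← mulVec_mulVec, hvy]
    constructor
    · intro h
      have h5 := congrArg WithLp.ofLp h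
      exact sub_eq_zero.mp (h3.symm.trans h5)
    · intro h
      apply WithLp.ofLp_injective
      exact h3.trans (sub_eq_zero.mpr h)
  rw [h2]
  constructor
  · intro h
    congr 1
    ext j
    rw [mulVec_diagonal]
    by_cases hj : d j = 1
    · rw [hj, one_mul]
    · rw [h j hj, mul_zero]
  · intro h j hj
    have h3 := congrArg (fun x => star V *ᵥ x) h
    simp only [mulVec_mulVec, mem_unitaryGroup_iff'.mp hV, one_mulVec] at h3
    rw [← mul_assoc, mem_unitaryGroup_iff'.mp hV, one_mul] at h3
    have h4 := congrFun h3 j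
    rw [mulVec_diagonal] at h4
    have h5 : (d j - 1) * y j = 0 := by rw [sub_mul, h4, one_mul, sub_self]
    exact (mul_eq_zero.mp h5).resolve_left (sub_ne_zero.mpr hj)

end RobbinSalamon

end


/-! ### The jumps of the eigenvalue sum along a unitary path -/

noncomputable section

namespace RobbinSalamon

open Matrix

theorem exp_eigSum_branch {m : ℕ} {U : Matrix (Fin m) (Fin m) ℂ}
    (hU : U ∈ unitaryGroup (Fin m) ℂ) (α : ℝ) :
    Complex.exp (Real.pi * Complex.I * eigSum (branch α) U) = U.det⁻¹ := by
  obtain ⟨V, hV, d, hd, rfl⟩ := exists_unitary_diagonalization hU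
  have h1 : (V * diagonal d * star V).det = ∏ j, d j := by
    rw [det_mul_right_comm, mem_unitaryGroup_iff.mp hV, one_mul, det_diagonal]
  rw [eigSum_conj_diagonal hV, h1, Complex.ofReal_sum, Finset.mul_sum, Complex.exp_sum,
    ← Finset.prod_inv_distrib]
  exact Finset.prod_congr rfl fun j _ => exp_branch α (hd j)

theorem eigSum_defect_eq {m : ℕ} {U : Matrix (Fin m) (Fin m) ℂ}
    (hU : U ∈ unitaryGroup (Fin m) ℂ) {α : ℝ} (h1 : -Real.pi < α) (h2 : α < Real.pi)
    (hb : -Complex.exp (α * Complex.I) ∉ U.charpoly.roots) :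
    eigSum defect U = eigSum (branch α) U
      + ((sigPos (imForm (Complex.exp (-(α / 2 * Complex.I))) (realMap U - 1)) : ℝ)
        - sigNeg (imForm (Complex.exp (-(α / 2 * Complex.I))) (realMap U - 1))) / 2 := by
  rw [signature_imForm hU]
  obtain ⟨V, hV, d, hd, rfl⟩ := exists_unitary_diagonalization hU
  rw [eigSum_conj_diagonal hV, eigSum_conj_diagonal hV, eigSum_conj_diagonal hV,
    mul_div_cancel_left₀ _ two_ne_zero, ← Finset.sum_add_distrib]
  refine Finset.sum_congr rfl fun j _ => defect_eq_branch_add_sign h1 h2 (hd j) fun h => hb ?_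
  rw [charpoly_conj hV, roots_charpoly_diagonal, ← h]
  exact Multiset.mem_map_of_mem _ (Finset.mem_univ j)

theorem norm_eq_one_of_mem_roots {m : ℕ} {U : Matrix (Fin m) (Fin m) ℂ}
    (hU : U ∈ unitaryGroup (Fin m) ℂ) {z : ℂ} (hz : z ∈ U.charpoly.roots) : ‖z‖ = 1 := by
  obtain ⟨V, hV, d, hd, rfl⟩ := exists_unitary_diagonalization hU
  rw [charpoly_conj hV, roots_charpoly_diagonal] at hz
  obtain ⟨j, -, rfl⟩ := Multiset.mem_map.mp hz
  exact hd j

theorem inner_realMap {m : ℕ} {U : Matrix (Fin m) (Fin m) ℂ} (hU : U ∈ unitaryGroup (Fin m) ℂ)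
    (u v : EuclideanSpace ℂ (Fin m)) : inner ℂ (realMap U u) (realMap U v) = inner ℂ u v := by
  rw [EuclideanSpace.inner_eq_star_dotProduct, EuclideanSpace.inner_eq_star_dotProduct]
  change (U *ᵥ v.ofLp) ⬝ᵥ star (U *ᵥ u.ofLp) = _
  rw [star_mulVec, dotProduct_comm, ← dotProduct_mulVec, mulVec_mulVec, ← star_eq_conjTranspose,
    mem_unitaryGroup_iff'.mp hU, one_mulVec, dotProduct_comm]

variable {m : ℕ} {A : ℝ → Matrix (Fin m) (Fin m) ℂ} {a b : ℝ}

theorem continuousOn_of_realMap (h : ContinuousOn (fun t => realMap (A t)) (Set.Icc a b)) :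
    ContinuousOn A (Set.Icc a b) := by
  refine continuousOn_pi.mpr fun i => continuousOn_pi.mpr fun j => ?_
  have h1 : ContinuousOn (fun t => (realMap (A t) (EuclideanSpace.single j 1)) i) (Set.Icc a b) := by
    have h2 := h.clm_apply (continuousOn_const (c := EuclideanSpace.single j (1 : ℂ)))
    exact (EuclideanSpace.proj (𝕜 := ℂ) i).continuous.comp_continuousOn h2
  refine h1.congr fun t _ => ?_
  change _ = (A t *ᵥ Pi.single j 1) i
  simp

/-- On the kernel of `U - 1` the derivative of a unitary path is skew-Hermitian. -/
theorem imForm_restrict_ker (hab : a < b) (hA : ∀ t ∈ Set.Icc a b, A t ∈ unitaryGroup (Fin m) ℂ)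
    (hreg : IsRegularPath (fun t => realMap (A t)) a b) {t : ℝ} (ht : t ∈ Set.Icc a b) (c : ℂ) :
    (imForm c (derivWithin (fun t => realMap (A t)) (Set.Icc a b) t)).restrict
        (LinearMap.ker (realMap (A t) - 1).toLinearMap)
      = c.re • crossingForm (fun t => realMap (A t)) a b t := by
  set D := derivWithin (fun t => realMap (A t)) (Set.Icc a b) t with hD
  have hder : HasDerivWithinAt (fun t => realMap (A t)) D (Set.Icc a b) t :=
    ((hreg.contDiffOn.differentiableOn one_ne_zero) t ht).hasDerivWithinAt
  ext ⟨v, hv⟩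
  have hv' : realMap (A t) v = v := by
    rw [LinearMap.mem_ker] at hv
    exact sub_eq_zero.mp hv
  have h1 : HasDerivWithinAt (fun t => realMap (A t) v) (D v) (Set.Icc a b) t := by
    simpa using hder.clm_apply (hasDerivWithinAt_const t (Set.Icc a b) v)
  -- Differentiating the constant `⟪A v, A v⟫` at a fixed vector `v` of `A(t)` gives `Re ⟪v, A' v⟫ =
  -- 0`, so multiplication by `c` scales the imaginary part by `Re c`.
  have h2 := h1.inner ℂ h1
  have h3 : HasDerivWithinAt (fun t => inner ℂ (realMap (A t) v) (realMap (A t) v)) 0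
      (Set.Icc a b) t :=
    (hasDerivWithinAt_const t (Set.Icc a b) (inner ℂ v v)).congr
      (fun u hu => inner_realMap (hA u hu) v v) (inner_realMap (hA t ht) v v)
  have h4 := (uniqueDiffOn_Icc hab t ht).eq_deriv _ h2 h3
  rw [hv', ← inner_conj_symm (D v) v] at h4
  have h5 : (inner ℂ v (D v)).re = 0 := by
    have := congrArg Complex.re h4
    rw [Complex.add_re, Complex.conj_re, Complex.zero_re] at this
    linarith
  change imForm c D v = c.re * (inner ℂ v (D v)).im
  rw [imForm_apply, Complex.mul_im, h5, mul_zero, add_zero]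

/-- By `exp_eigSum_branch` the sum takes values in the even integers. It is continuous at `t`
because no eigenvalue of `A(t)` is on the cut, hence it is constant nearby. -/
theorem eventually_eigSum_branch (hA : ∀ t ∈ Set.Icc a b, A t ∈ unitaryGroup (Fin m) ℂ)
    (hAc : ContinuousOn A (Set.Icc a b)) {φ : ℝ → ℝ} (hφ : ContinuousOn φ (Set.Icc a b))
    (hdet : ∀ t ∈ Set.Icc a b, (A t).det = Complex.exp (2 * Real.pi * Complex.I * φ t))
    {t : ℝ} (ht : t ∈ Set.Icc a b) {α : ℝ}
    (hb : -Complex.exp (α * Complex.I) ∉ (A t).charpoly.roots) :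
    ∀ᶠ u in nhdsWithin t (Set.Icc a b),
      eigSum (branch α) (A u) + 2 * φ u = eigSum (branch α) (A t) + 2 * φ t := by
  set β : ℝ → ℝ := fun u => eigSum (branch α) (A u) + 2 * φ u with hβ
  have hint : ∀ u ∈ Set.Icc a b, ∃ k : ℤ, β u = 2 * k := by
    intro u hu
    have h1 : Complex.exp (Real.pi * Complex.I * β u) = 1 := by
      have : (Real.pi : ℂ) * Complex.I * β u
          = Real.pi * Complex.I * eigSum (branch α) (A u) + 2 * Real.pi * Complex.I * φ u := by
        simp only [hβ]
        push_cast
        ring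
      rw [this, Complex.exp_add, exp_eigSum_branch (hA u hu), ← hdet u hu]
      refine inv_mul_cancel₀ ?_
      rw [hdet u hu]
      exact Complex.exp_ne_zero _
    obtain ⟨k, hk⟩ := Complex.exp_eq_one_iff.mp h1
    refine ⟨k, ?_⟩
    have hp : (Real.pi : ℂ) * Complex.I ≠ 0 :=
      mul_ne_zero (by exact_mod_cast Real.pi_ne_zero) Complex.I_ne_zero
    have h2 : (β u : ℂ) = 2 * k := by
      apply mul_left_cancel₀ hp
      rw [hk]
      ring
    exact_mod_cast h2
  have hcont : ContinuousWithinAt β (Set.Icc a b) t := by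
    refine ContinuousWithinAt.add ?_ ((hφ t ht).const_mul 2)
    exact (continuousWithinAt_eigSum (r := branch α) (fun z hz hne => continuousAt_branch hz hne)
      (abs_branch_le α) (hA t ht) hb).comp (hAc t ht) hA
  filter_upwards [self_mem_nhdsWithin, hcont (Metric.ball_mem_nhds _ one_pos)] with u hu hu1
  obtain ⟨k, hk⟩ := hint u hu
  obtain ⟨j, hj⟩ := hint t ht
  have h2 : dist (β u) (β t) < 1 := hu1
  rw [Real.dist_eq, hk, hj, ← mul_sub, abs_mul, abs_two] at h2
  have h3 : |((k - j : ℤ) : ℝ)| < 1 := by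
    push_cast
    linarith [abs_nonneg ((k : ℝ) - j)]
  rw [← Int.cast_abs] at h3
  have h4 : |k - j| < 1 := by exact_mod_cast h3
  have h5 : k = j := by
    have := abs_lt.mp h4
    omega
  change β u = β t
  rw [hk, hj, h5]

theorem eventually_notMem_roots (hAc : ContinuousOn A (Set.Icc a b)) {t : ℝ}
    (ht : t ∈ Set.Icc a b) {z : ℂ} (hz : z ∉ (A t).charpoly.roots) :
    ∀ᶠ u in nhdsWithin t (Set.Icc a b), z ∉ (A u).charpoly.roots := by
  have hroot : ∀ u, z ∈ (A u).charpoly.roots ↔ (scalar (Fin m) z - A u).det = 0 := fun u => by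
    rw [Polynomial.mem_roots (charpoly_monic _).ne_zero, Polynomial.IsRoot, eval_charpoly]
  simp only [hroot] at hz ⊢
  have hdet : Continuous fun M : Matrix (Fin m) (Fin m) ℂ => (scalar (Fin m) z - M).det :=
    Continuous.matrix_det (continuous_const.sub continuous_id)
  exact (hdet.continuousAt.comp_continuousWithinAt (hAc t ht)).eventually_ne hz

/-- First-order expansion: the form at `u` is the form at `t` plus `(u - t)` times the form of the
derivative, up to `o(u - t)`. The derivative restricted to the radical is a positive multiple of the
crossing form, so `signature_perturbation` applies. -/
theorem eventually_signature_imForm (hab : a < b)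
    (hA : ∀ t ∈ Set.Icc a b, A t ∈ unitaryGroup (Fin m) ℂ)
    (hreg : IsRegularPath (fun t => realMap (A t)) a b) {t : ℝ} (ht : t ∈ Set.Icc a b)
    {c : ℂ} (hc1 : ‖c‖ = 1) (hc : 0 < c.re)
    (hroots : ∀ z ∈ (A t).charpoly.roots, (c * (z - 1)).im = 0 → z = 1) :
    ∀ᶠ u in nhdsWithin t (Set.Icc a b),
      (sigPos (imForm c (realMap (A u) - 1)) : ℝ) - sigNeg (imForm c (realMap (A u) - 1))
        = ((sigPos (imForm c (realMap (A t) - 1)) : ℝ) - sigNeg (imForm c (realMap (A t) - 1)))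
          + SignType.sign (u - t) * crossingSignature (fun t => realMap (A t)) a b t := by
  set Ψ := fun t => realMap (A t) with hΨ
  set D := derivWithin Ψ (Set.Icc a b) t with hD
  have hder : HasDerivWithinAt Ψ D (Set.Icc a b) t :=
    ((hreg.contDiffOn.differentiableOn one_ne_zero) t ht).hasDerivWithinAt
  set q := imForm c (realMap (A t) - 1) with hq
  have hrad : q.radical = LinearMap.ker (realMap (A t) - 1).toLinearMap :=
    radical_imForm (hA t ht) c hroots
  have hcross : (imForm c D).restrict (LinearMap.ker (realMap (A t) - 1).toLinearMap)
      = c.re • crossingForm Ψ a b t := imForm_restrict_ker hab hA hreg ht c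
  have hsig : (sigPos ((imForm c D).restrict q.radical) : ℝ)
      - sigNeg ((imForm c D).restrict q.radical) = crossingSignature Ψ a b t := by
    rw [hrad, hcross, (equivalent_smul hc _).sigPos_eq, (equivalent_smul hc _).sigNeg_eq]
    rfl
  have hnd : ((imForm c D).restrict q.radical).radical = ⊥ := by
    rw [hrad, hcross]
    have h1 := hreg.regular t ht
    rw [eq_bot_iff] at h1 ⊢
    refine fun v hv => h1 ?_
    rw [QuadraticMap.mem_radical_iff'] at hv ⊢
    refine ⟨?_, fun n => ?_⟩
    · have h2 : c.re * crossingForm Ψ a b t v = 0 := hv.1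
      exact (mul_eq_zero.mp h2).resolve_left hc.ne'
    · have h2 : c.re * crossingForm Ψ a b t (v + n) = c.re * crossingForm Ψ a b t n := hv.2 n
      exact mul_left_cancel₀ hc.ne' h2
  -- For `u < t` the perturbation lemma is used with `τ = t - u > 0` and the negated derivative.
  have hnd' : ((-imForm c D).restrict q.radical).radical = ⊥ := by
    rw [eq_bot_iff] at hnd ⊢
    refine fun v hv => hnd ?_
    rw [QuadraticMap.mem_radical_iff'] at hv ⊢
    refine ⟨?_, fun n => ?_⟩
    · exact neg_eq_zero.mp hv.1
    · exact neg_injective (hv.2 n)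
  obtain ⟨ε₁, hε₁, τ₁, hτ₁, H₁⟩ := signature_perturbation q (imForm c D) hnd
  obtain ⟨ε₂, hε₂, τ₂, hτ₂, H₂⟩ := signature_perturbation q (-imForm c D) hnd'
  have hlo := (hasDerivWithinAt_iff_isLittleO.mp hder).def (lt_min hε₁ hε₂)
  have hnear : ∀ᶠ u in nhdsWithin t (Set.Icc a b), dist u t < min τ₁ τ₂ :=
    mem_nhdsWithin_of_mem_nhds (Metric.ball_mem_nhds t (lt_min hτ₁ hτ₂))
  filter_upwards [hlo, hnear] with u hu hut
  have hest : ∀ v, |imForm c (realMap (A u) - 1) v - q v - (u - t) * imForm c D v|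
      ≤ min ε₁ ε₂ * |u - t| * ‖v‖ ^ 2 := by
    intro v
    have h1 : imForm c (realMap (A u) - 1) v - q v - (u - t) * imForm c D v
        = imForm c (Ψ u - Ψ t - (u - t) • D) v := by
      rw [hq, imForm_sub, imForm_sub, imForm_sub, imForm_sub, imForm_smul]
      ring
    rw [h1]
    refine (abs_imForm_le _ _ _).trans ?_
    rw [hc1, one_mul]
    gcongr
    exact hu
  rw [Real.dist_eq] at hut
  rcases lt_trichotomy u t with h | h | h
  · rw [abs_of_neg (sub_neg.mpr h)] at hest hut
    have h1 := H₂ (-(u - t)) (by linarith) (hut.trans_le (min_le_right _ _)) _ fun v => by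
      have h2 := hest v
      have h3 : imForm c (realMap (A u) - 1) v - q v - -(u - t) * (-imForm c D) v
          = imForm c (realMap (A u) - 1) v - q v - (u - t) * imForm c D v := by
        rw [_root_.neg_apply]
        ring
      rw [h3]
      exact h2.trans (by
        have : 0 ≤ -(u - t) := by linarith
        gcongr
        exact min_le_right _ _)
    have h2 : (-imForm c D).restrict q.radical = -((imForm c D).restrict q.radical) := rfl
    rw [h1, h2, sigPos_neg, sigNeg_neg, ← hsig, sign_neg (by linarith), SignType.coe_neg_one]
    ring
  · subst h
    simp [hq]
  · rw [abs_of_pos (sub_pos.mpr h)] at hest hut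
    have h1 := H₁ (u - t) (by linarith) (hut.trans_le (min_le_left _ _)) _ fun v =>
      (hest v).trans (by
        have : 0 ≤ u - t := by linarith
        gcongr
        exact min_le_left _ _)
    rw [h1, ← hsig, sign_pos (by linarith), SignType.coe_one]
    ring

/-- The index of a path of unitary matrices in terms of the rotation of the determinant and of the
eigenvalues at the ends. -/
theorem index_realMap (hab : a < b) (hA : ∀ t ∈ Set.Icc a b, A t ∈ unitaryGroup (Fin m) ℂ)
    (hreg : IsRegularPath (fun t => realMap (A t)) a b) {φ : ℝ → ℝ}
    (hφ : ContinuousOn φ (Set.Icc a b))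
    (hdet : ∀ t ∈ Set.Icc a b, (A t).det = Complex.exp (2 * Real.pi * Complex.I * φ t)) :
    index (fun t => realMap (A t)) a b
      = (eigSum defect (A b) + 2 * φ b) - (eigSum defect (A a) + 2 * φ a) := by
  have hAc : ContinuousOn A (Set.Icc a b) := continuousOn_of_realMap hreg.contDiffOn.continuousOn
  rw [index]
  refine (sub_eq_sum_of_jumps hab (N := fun t => eigSum defect (A t) + 2 * φ t) ?_).symm
  intro t ht
  -- The cut depends on `t`: it has to avoid the eigenvalues of `A(t)`, and it then avoids those of
  -- `A(u)` for `u` near `t`. Since `|α| < π`, the factor `c` has positive real part.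
  obtain ⟨α, h1, h2, hα⟩ := exists_angle_avoiding (A t).charpoly.roots.toFinset
  rw [Multiset.mem_toFinset] at hα
  set c := Complex.exp (-(α / 2 * Complex.I)) with hc
  have hcα : c = Complex.exp ((-(α / 2) : ℝ) * Complex.I) := by
    rw [hc]
    congr 1
    push_cast
    ring
  have hc1 : ‖c‖ = 1 := by rw [hcα, Complex.norm_exp_ofReal_mul_I]
  have hcre : 0 < c.re := by
    rw [hcα, Complex.exp_ofReal_mul_I_re]
    apply Real.cos_pos_of_mem_Ioo
    constructor <;> linarith
  filter_upwards [self_mem_nhdsWithin, eventually_eigSum_branch hA hAc hφ hdet ht hα,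
    eventually_notMem_roots hAc ht hα, eventually_signature_imForm hab hA hreg ht hc1 hcre
      fun z hz => eq_one_of_im_chord_eq_zero h1 h2 (norm_eq_one_of_mem_roots (hA t ht) hz)
        fun h => hα (h ▸ hz)] with u hu e1 e2 e3
  rw [eigSum_defect_eq (hA u hu) h1 h2 e2, eigSum_defect_eq (hA t ht) h1 h2 hα, e3]
  linarith

end RobbinSalamon

end


noncomputable section

/-! ## Diagonal symmetries and the link -/

namespace LGOrbifold

open MvPolynomial

section Polynomial

variable {n : ℕ} {W : MvPolynomial (Fin n) ℂ}

/-- The substitution `xᵢ ↦ Tᵢ xᵢ`. -/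
def rescale (T : Fin n → ℂ) : MvPolynomial (Fin n) ℂ →ₐ[ℂ] MvPolynomial (Fin n) ℂ :=
  bind₁ fun i => C (T i) * X i

theorem eval_rescale (T x : Fin n → ℂ) (P : MvPolynomial (Fin n) ℂ) :
    eval x (rescale T P) = eval (fun i => T i * x i) P := by
  rw [rescale, ← coe_aeval_eq_eval, ← coe_aeval_eq_eval]
  change aeval x (bind₁ _ P) = aeval _ P
  rw [aeval_bind₁]
  simp

theorem coeff_rescale (T : Fin n → ℂ) (P : MvPolynomial (Fin n) ℂ) (d : Fin n →₀ ℕ) :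
    coeff d (rescale T P) = (∏ i, T i ^ d i) * coeff d P := by
  induction P using MvPolynomial.induction_on' with
  | monomial e c =>
    have h : rescale T (monomial e c) = monomial e (c * ∏ i, T i ^ e i) := by
      rw [rescale, bind₁_monomial, monomial_eq, Finsupp.prod_fintype _ _ (by simp)]
      simp only [mul_pow, Finset.prod_mul_distrib, ← C_pow, ← map_prod]
      rw [C_mul, mul_assoc]
      congr 2
      · exact congrArg C (Finset.prod_subset (Finset.subset_univ e.support)
          fun x _ hx => by rw [Finsupp.notMem_support_iff.mp hx, pow_zero])
      · exact Finset.prod_subset (Finset.subset_univ e.support)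
          fun x _ hx => by rw [Finsupp.notMem_support_iff.mp hx, pow_zero]
    rw [h, coeff_monomial, coeff_monomial]
    split_ifs with hed
    · rw [hed, mul_comm]
    · rw [mul_zero]
  | add p q hp hq => rw [map_add, coeff_add, coeff_add, hp, hq, mul_add]

theorem pderiv_rescale (T : Fin n → ℂ) (i : Fin n) (P : MvPolynomial (Fin n) ℂ) :
    pderiv i (rescale T P) = C (T i) * rescale T (pderiv i P) := by
  classical
  induction P using MvPolynomial.induction_on with
  | C a => simp [rescale]
  | add p q hp hq => rw [map_add, map_add, hp, hq, map_add, map_add, mul_add]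
  | mul_X p j hp =>
    have hX : rescale T (X j) = C (T j) * X j := by simp [rescale]
    rw [map_mul, hX, pderiv_mul, pderiv_C_mul, hp, pderiv_mul, map_add, map_mul (rescale T),
      map_mul (rescale T), hX, pderiv_X]
    by_cases hij : j = i
    · subst hij
      simp
      ring
    · simp [hij]
      ring

theorem rescale_eq_of_eval {T : Fin n → ℂ} {κ : ℂ}
    (h : ∀ x : Fin n → ℂ, eval (fun i => T i * x i) W = κ * eval x W) :
    rescale T W = C κ * W :=
  MvPolynomial.funext fun x => by rw [eval_rescale, h, eval_mul, eval_C]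

/-- The chain rule for `W(Tx) = κ W(x)`. It governs the transport of tangent spaces and critical
points, and at a fixed point `x` of `T` it forces `Tᵢ = κ` whenever `∂ᵢW(x) ≠ 0`. -/
theorem partialAt_rescale {T : Fin n → ℂ} {κ : ℂ}
    (h : ∀ x : Fin n → ℂ, eval (fun i => T i * x i) W = κ * eval x W) (i : Fin n)
    (x : Fin n → ℂ) :
    partialAt W i (fun k => T k * x k) * T i = κ * partialAt W i x := by
  have h1 := congrArg (fun P => eval x (pderiv i P)) (rescale_eq_of_eval h)
  simp only [pderiv_rescale, pderiv_C_mul, eval_mul, eval_C, eval_rescale] at h1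
  rw [partialAt, partialAt, mul_comm]
  exact h1

theorem prod_pow_eq_one_of_mem_symmetryGroup {g : Fin n → ℂˣ} (hg : g ∈ symmetryGroup W)
    {d : Fin n →₀ ℕ} (hd : coeff d W ≠ 0) : ∏ i, (g i : ℂ) ^ d i = 1 := by
  have h1 : rescale (fun i => (g i : ℂ)) W = C 1 * W :=
    rescale_eq_of_eval fun x => by rw [one_mul]; exact hg x
  have h2 := congrArg (coeff d) h1
  rw [coeff_rescale, C_1, one_mul] at h2
  exact mul_right_cancel₀ hd (by rw [h2, one_mul])

theorem eval_weightedHomogeneous {w : Fin n → ℕ} {h : ℕ} (hW : IsWeightedHomogeneous w W h)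
    (y : ℂ) (x : Fin n → ℂ) : eval (fun i => y ^ w i * x i) W = y ^ h * eval x W := by
  rw [eval_eq', eval_eq', Finset.mul_sum]
  refine Finset.sum_congr rfl fun d hd => ?_
  have h1 : ∑ i, w i * d i = h := by
    have h2 := hW (mem_support_iff.mp hd)
    rw [Finsupp.weight_apply, Finsupp.sum_fintype _ _ (by simp)] at h2
    rw [← h2]
    exact Finset.sum_congr rfl fun i _ => by rw [smul_eq_mul, mul_comm]
  simp only [mul_pow, Finset.prod_mul_distrib, ← pow_mul, Finset.prod_pow_eq_pow_sum, h1]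
  ring

/-- A non-degenerate polynomial has a monomial `xᵢᵃ xⱼ`, with `a ≥ 2` or `i = j`, for each `i`. -/
theorem IsNondegenerate.exists_monomial (hnd : IsNondegenerate W) (i : Fin n) :
    ∃ (a : ℕ) (j : Fin n), coeff (Finsupp.single i a + Finsupp.single j 1) W ≠ 0 ∧
      1 ≤ a ∧ (2 ≤ a ∨ j = i) := by
  have h1 := eventually_nhdsWithin_iff.mp hnd.isolated
  have h2 : Filter.Tendsto (fun c : ℂ => (Pi.single i c : Fin n → ℂ)) (nhds 0) (nhds 0) := by
    have h3 : Continuous fun c : ℂ => (Pi.single i c : Fin n → ℂ) := by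
      simpa using continuous_single (A := fun _ : Fin n => ℂ) i
    have h4 := h3.tendsto 0
    rwa [Pi.single_zero] at h4
  -- At a point of the `i`-th axis near the origin some `∂ⱼW` does not vanish. A monomial of `∂ⱼW`
  -- that survives on this axis is a pure power of `xᵢ`, and it comes from a monomial `xᵢᵃ xⱼ` of
  -- `W`.
  obtain ⟨c, hc, hc0⟩ := (((h2.eventually h1).filter_mono
    (nhdsWithin_le_nhds (s := {0}ᶜ))).and self_mem_nhdsWithin).exists
  have hc0' : c ≠ 0 := hc0
  obtain ⟨j, hj⟩ := hc (by
    intro h0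
    have h4 : (Pi.single i c : Fin n → ℂ) i = 0 := by rw [h0]; rfl
    rw [Pi.single_eq_same] at h4
    exact hc0' h4)
  rw [partialAt, eval_eq'] at hj
  obtain ⟨d, hd, hd0⟩ := Finset.exists_ne_zero_of_sum_ne_zero hj
  have hprod : ∏ k, (Pi.single i c : Fin n → ℂ) k ^ d k ≠ 0 := right_ne_zero_of_mul hd0
  have hdi : d = Finsupp.single i (d i) := by
    ext k
    by_cases hk : k = i
    · rw [hk, Finsupp.single_eq_same]
    · rw [Finsupp.single_eq_of_ne hk]
      by_contra h0
      refine hprod (Finset.prod_eq_zero (Finset.mem_univ k) ?_)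
      rw [Pi.single_eq_of_ne hk, zero_pow h0]
  have hco : coeff (d + Finsupp.single j 1) W ≠ 0 := by
    have h5 := left_ne_zero_of_mul hd0
    rw [coeff_pderiv] at h5
    exact left_ne_zero_of_mul h5
  rw [hdi] at hco
  -- Exponent zero would be a linear term of `W`, which is impossible at a critical point.
  have hdi0 : d i ≠ 0 := by
    intro h6
    apply hco
    have h7 := hnd.singular j
    rw [partialAt, eval_zero] at h7
    change coeff 0 (pderiv j W) = 0 at h7
    rw [coeff_pderiv] at h7
    rw [h6, Finsupp.single_zero]
    simpa using h7
  refine ⟨d i, j, hco, by omega, ?_⟩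
  by_contra! h0
  have h7 : d i = 1 := by omega
  rw [h7] at hco
  exact hco (hnd.no_cross_term i j (Ne.symm h0.2))

/-- A monomial `xₖᵃ xⱼ` of `W` gives `gₖᵃ gⱼ = 1`, so `a log|gₖ| = -log|gⱼ|`. If `|log|gₖ||` is
maximal, then `a ≥ 2` or `j = k` forces it to vanish. -/
theorem norm_eq_one_of_mem_symmetryGroup (hnd : IsNondegenerate W) {g : Fin n → ℂˣ}
    (hg : g ∈ symmetryGroup W) (i : Fin n) : ‖(g i : ℂ)‖ = 1 := by
  have hpos : ∀ k, 0 < ‖(g k : ℂ)‖ := fun k => norm_pos_iff.mpr (g k).ne_zero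
  set u : Fin n → ℝ := fun k => Real.log ‖(g k : ℂ)‖ with hu
  obtain ⟨k, -, hk⟩ := Finset.exists_max_image Finset.univ (fun k => |u k|) ⟨i, Finset.mem_univ i⟩
  obtain ⟨a, j, hco, ha1, ha⟩ := hnd.exists_monomial k
  have h1 := prod_pow_eq_one_of_mem_symmetryGroup hg hco
  have h2 : (g k : ℂ) ^ a * (g j : ℂ) = 1 := by
    have h3 : ∀ (k : Fin n) (a : ℕ), ∏ i, (g i : ℂ) ^ (Finsupp.single k a i) = (g k : ℂ) ^ a := by
      intro k a
      rw [Finset.prod_eq_single k (fun i _ hik => by rw [Finsupp.single_eq_of_ne hik, pow_zero])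
        (by simp), Finsupp.single_eq_same]
    simp only [Finsupp.add_apply, pow_add, Finset.prod_mul_distrib, h3, pow_one] at h1
    exact h1
  have h3 : a * u k + u j = 0 := by
    have h4 := congrArg (fun z : ℂ => Real.log ‖z‖) h2
    simp only [norm_mul, norm_pow, norm_one, Real.log_one] at h4
    rw [Real.log_mul (pow_ne_zero _ (hpos k).ne') (hpos j).ne', Real.log_pow] at h4
    exact h4
  have h5 : |u k| = 0 := by
    have hj := hk j (Finset.mem_univ j)
    rcases ha with ha | rfl
    · have h6 : u j = -(a * u k) := by linarith
      rw [h6, abs_neg, abs_mul, Nat.abs_cast] at hj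
      have h7 : (2 : ℝ) ≤ a := by exact_mod_cast ha
      nlinarith [abs_nonneg (u k)]
    · have h6 : ((a : ℝ) + 1) * u j = 0 := by linarith
      have h7 : (a : ℝ) + 1 ≠ 0 := by positivity
      rw [(mul_eq_zero.mp h6).resolve_left h7, abs_zero]
  have h6 : |u i| ≤ 0 := h5 ▸ hk i (Finset.mem_univ i)
  have h7 : u i = 0 := abs_nonpos_iff.mp h6
  have h8 := Real.exp_log (hpos i)
  rw [← h8]
  exact Real.exp_eq_one_iff _ |>.mpr h7

/-- Along the flow `xᵢ ↦ s^{wᵢ} xᵢ` critical points stay critical, so the origin is the only one. -/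
theorem exists_partialAt_ne_zero {w : Fin n → ℕ} {h : ℕ} (hW : HasWeight W w h)
    (hnd : IsNondegenerate W) {p : Fin n → ℂ} (hp : p ≠ 0) : ∃ i, partialAt W i p ≠ 0 := by
  by_contra! hcrit
  have h1 : Filter.Tendsto (fun s : ℝ => fun i => ((s : ℂ) ^ w i * p i)) (nhdsWithin 0 (Set.Ioi 0))
      (nhdsWithin 0 {0}ᶜ) := by
    refine tendsto_nhdsWithin_iff.mpr ⟨?_, ?_⟩
    · have h2 : Continuous fun s : ℝ => fun i => ((s : ℂ) ^ w i * p i) := by fun_prop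
      have h3 := h2.tendsto 0
      have h4 : (fun i => (((0 : ℝ) : ℂ) ^ w i * p i)) = 0 := by
        ext i
        simp [(hW.weight_pos i).ne']
      rw [h4] at h3
      exact h3.mono_left nhdsWithin_le_nhds
    · filter_upwards [self_mem_nhdsWithin] with s hs
      have hs0 : (s : ℂ) ≠ 0 := by exact_mod_cast (ne_of_gt hs)
      intro h0
      apply hp
      ext i
      have h4 : (s : ℂ) ^ w i * p i = 0 := congrFun h0 i
      exact (mul_eq_zero.mp h4).resolve_left (pow_ne_zero _ hs0)
  obtain ⟨s, ⟨i, hi⟩, hs⟩ := ((h1.eventually hnd.isolated).and self_mem_nhdsWithin).exists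
  have hs0 : (s : ℂ) ≠ 0 := by exact_mod_cast (ne_of_gt hs)
  have h2 := partialAt_rescale (eval_weightedHomogeneous hW.homogeneous (s : ℂ)) i p
  rw [hcrit i, mul_zero] at h2
  exact hi ((mul_eq_zero.mp h2).resolve_right (pow_ne_zero _ hs0))

end Polynomial

/-! ### The flow -/

/-- The eigenvalues of `R_t`. -/
def flowFactor {n : ℕ} (w : Fin n → ℕ) (h : ℕ) (t : ℝ) (i : Fin n) : ℂ :=
  Complex.exp (2 * Real.pi * Complex.I * ((t * thetaJ w h i : ℝ) : ℂ))

theorem norm_exp_two_pi_mul (s : ℝ) : ‖Complex.exp (2 * Real.pi * Complex.I * s)‖ = 1 := by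
  have : 2 * Real.pi * Complex.I * s = ((2 * Real.pi * s : ℝ) : ℂ) * Complex.I := by
    push_cast; ring
  rw [this, Complex.norm_exp_ofReal_mul_I]

theorem eval_flow {n : ℕ} {W : MvPolynomial (Fin n) ℂ} {w : Fin n → ℕ} {h : ℕ}
    (hW : HasWeight W w h) (t : ℝ) (x : Fin n → ℂ) :
    eval (fun i => flowFactor w h t i * x i) W
      = Complex.exp (2 * Real.pi * Complex.I * t) * eval x W := by
  have hh : (h : ℂ) ≠ 0 := by exact_mod_cast hW.degree_pos.ne'
  have h1 := eval_weightedHomogeneous hW.homogeneous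
    (Complex.exp (2 * Real.pi * Complex.I * t / h)) x
  rw [← Complex.exp_nat_mul] at h1
  have h2 : (h : ℂ) * (2 * Real.pi * Complex.I * t / h) = 2 * Real.pi * Complex.I * t := by
    field_simp
  rw [h2] at h1
  rw [← h1]
  congr 2
  ext i
  rw [flowFactor, ← Complex.exp_nat_mul]
  congr 2
  rw [thetaJ]
  push_cast
  field_simp

end LGOrbifold

end


noncomputable section

namespace LGOrbifold

open MvPolynomial RobbinSalamon

/-! ### The Hermitian form -/

/-- `herm w u` as a linear form. -/
def hermLin {n : ℕ} (w : Fin n → ℕ) (u : Fin n → ℂ) : (Fin n → ℂ) →ₗ[ℂ] ℂ where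
  toFun := herm w u
  map_add' := fun v v' => by
    simp only [herm, ← Finset.sum_add_distrib, Pi.add_apply]
    exact Finset.sum_congr rfl fun k _ => by ring
  map_smul' := fun c v => by
    simp only [herm, Pi.smul_apply, smul_eq_mul, RingHom.id_apply, Finset.mul_sum]
    exact Finset.sum_congr rfl fun k _ => by ring

theorem herm_sum_smul_right {n : ℕ} (w : Fin n → ℕ) {ι : Type*} (s : Finset ι) (u : Fin n → ℂ)
    (c : ι → ℂ) (v : ι → Fin n → ℂ) :
    herm w u (∑ i ∈ s, c i • v i) = ∑ i ∈ s, c i * herm w u (v i) := by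
  change hermLin w u _ = _
  rw [map_sum]
  exact Finset.sum_congr rfl fun i _ => map_smul (hermLin w u) (c i) (v i)

theorem conj_herm {n : ℕ} (w : Fin n → ℕ) (u v : Fin n → ℂ) :
    (starRingEnd ℂ) (herm w u v) = herm w v u := by
  simp only [herm, map_sum, map_div₀, map_mul, Complex.conj_conj, Complex.conj_ofReal,
    map_natCast]
  exact Finset.sum_congr rfl fun k _ => by ring

theorem herm_sum_smul_left {n : ℕ} (w : Fin n → ℕ) {ι : Type*} (s : Finset ι) (v : Fin n → ℂ)
    (c : ι → ℂ) (u : ι → Fin n → ℂ) :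
    herm w (∑ i ∈ s, c i • u i) v = ∑ i ∈ s, (starRingEnd ℂ) (c i) * herm w (u i) v := by
  rw [← conj_herm, herm_sum_smul_right, map_sum]
  exact Finset.sum_congr rfl fun i _ => by rw [map_mul, conj_herm]

theorem herm_smul_left {n : ℕ} (w : Fin n → ℕ) (c : ℂ) (u v : Fin n → ℂ) :
    herm w (c • u) v = (starRingEnd ℂ) c * herm w u v := by
  simpa using herm_sum_smul_left w Finset.univ v (fun _ : Fin 1 => c) (fun _ => u)

theorem herm_smul_right {n : ℕ} (w : Fin n → ℕ) (c : ℂ) (u v : Fin n → ℂ) :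
    herm w u (c • v) = c * herm w u v := map_smul (hermLin w u) c v

theorem herm_diagonal {n : ℕ} (w : Fin n → ℕ) {T : Fin n → ℂ} (hT : ∀ i, ‖T i‖ = 1)
    (u v : Fin n → ℂ) : herm w (fun i => T i * u i) (fun i => T i * v i) = herm w u v := by
  simp only [herm, map_mul]
  refine Finset.sum_congr rfl fun k _ => ?_
  have h1 : (starRingEnd ℂ) (T k) * T k = 1 := by
    rw [Complex.conj_mul', hT k]
    simp
  rw [show (starRingEnd ℂ) (T k) * (starRingEnd ℂ) (u k) * (T k * v k)
    = ((starRingEnd ℂ) (T k) * T k) * ((starRingEnd ℂ) (u k) * v k) by ring, h1, one_mul]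

/-! ### Bordered matrices and frames -/

/-- The block diagonal matrix with the blocks `κ` and `A`. -/
def border {R : Type*} [Zero R] {m : ℕ} (κ : R) (A : Matrix (Fin m) (Fin m) R) :
    Matrix (Fin (m + 1)) (Fin (m + 1)) R :=
  Matrix.of fun i j => Fin.cases (Fin.cases κ (fun _ => 0) j)
    (fun i' => Fin.cases 0 (fun j' => A i' j') j) i

theorem det_border {R : Type*} [CommRing R] {m : ℕ} (κ : R) (A : Matrix (Fin m) (Fin m) R) :
    (border κ A).det = κ * A.det := by
  rw [Matrix.det_succ_row_zero, Fin.sum_univ_succ]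
  have h : (border κ A).submatrix Fin.succ (Fin.succAbove 0) = A := by
    ext i j
    simp [border]
  rw [h]
  simp [border]

theorem charpoly_border {m : ℕ} (κ : ℂ) (A : Matrix (Fin m) (Fin m) ℂ) :
    (border κ A).charpoly = (Polynomial.X - Polynomial.C κ) * A.charpoly := by
  have h : (border κ A).charmatrix = border (Polynomial.X - Polynomial.C κ) A.charmatrix := by
    ext i j : 2
    refine Fin.cases ?_ (fun i => ?_) i <;> refine Fin.cases ?_ (fun j => ?_) j
    · simp [border, Matrix.charmatrix_apply]
    · simp [border, Matrix.charmatrix_apply, Matrix.diagonal_apply, (Fin.succ_ne_zero j).symm]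
    · simp [border, Matrix.charmatrix_apply, Matrix.diagonal_apply, Fin.succ_ne_zero i]
    · simp [border, Matrix.charmatrix_apply, Matrix.diagonal_apply]
  rw [Matrix.charpoly, h, det_border, ← Matrix.charpoly]

variable {m : ℕ} {W : MvPolynomial (Fin (m + 1)) ℂ} {w : Fin (m + 1) → ℕ} {h : ℕ}

theorem mem_tangentSpace {n : ℕ} {W : MvPolynomial (Fin n) ℂ} {x v : Fin n → ℂ} :
    v ∈ tangentSpace W x ↔ ∑ i, partialAt W i x * v i = 0 := by
  simp [tangentSpace]

/-- The matrix with the conjugate of the gradient and the vectors of the frame as rows. -/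
def frameMatrix (W : MvPolynomial (Fin (m + 1)) ℂ) (x : Fin (m + 1) → ℂ)
    (v : Fin m → Fin (m + 1) → ℂ) : Matrix (Fin (m + 1)) (Fin (m + 1)) ℂ :=
  Matrix.of (Fin.cons (fun i => (starRingEnd ℂ) (partialAt W i x)) v)

theorem gradient_sq_ne_zero {x : Fin (m + 1) → ℂ} (hx : ∃ i, partialAt W i x ≠ 0) :
    ∑ i, partialAt W i x * (starRingEnd ℂ) (partialAt W i x) ≠ 0 := by
  have h1 : ∑ i, partialAt W i x * (starRingEnd ℂ) (partialAt W i x)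
      = ((∑ i, ‖partialAt W i x‖ ^ 2 : ℝ) : ℂ) := by
    push_cast
    exact Finset.sum_congr rfl fun i _ => Complex.mul_conj' _
  rw [h1]
  obtain ⟨i, hi⟩ := hx
  have h2 : (0 : ℝ) < ‖partialAt W i x‖ ^ 2 := pow_pos (norm_pos_iff.mpr hi) 2
  have h3 : (0 : ℝ) < ∑ i, ‖partialAt W i x‖ ^ 2 :=
    Finset.sum_pos' (fun i _ => sq_nonneg ‖partialAt W i x‖) ⟨i, Finset.mem_univ i, h2⟩
  exact Complex.ofReal_ne_zero.mpr h3.ne'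

theorem vecMul_frameMatrix (x : Fin (m + 1) → ℂ) (v : Fin m → Fin (m + 1) → ℂ)
    (c : Fin (m + 1) → ℂ) :
    Matrix.vecMul c (frameMatrix W x v)
      = c 0 • (fun i => (starRingEnd ℂ) (partialAt W i x)) + ∑ j : Fin m, c j.succ • v j := by
  rw [Matrix.vecMul_eq_sum, Fin.sum_univ_succ]
  rfl

/-- The coefficients of a vector with respect to the conjugate gradient and a unitary frame. -/
theorem coeff_of_vecMul_frameMatrix {x : Fin (m + 1) → ℂ} (hx : ∃ i, partialAt W i x ≠ 0)
    {v : Fin m → Fin (m + 1) → ℂ} (hv : ∀ j, v j ∈ tangentSpace W x)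
    (hu : ∀ i j, herm w (v i) (v j) = if i = j then 1 else 0) {c : Fin (m + 1) → ℂ}
    (hc : Matrix.vecMul c (frameMatrix W x v) ∈ tangentSpace W x) :
    c 0 = 0 ∧ ∀ j : Fin m, c j.succ = herm w (v j) (Matrix.vecMul c (frameMatrix W x v)) := by
  -- Applying `dW` kills the frame vectors and turns the conjugate gradient into `|∇W|² ≠ 0`.
  have h0 : c 0 = 0 := by
    rw [vecMul_frameMatrix, Submodule.add_mem_iff_left _
      (Submodule.sum_mem _ fun j _ => Submodule.smul_mem _ _ (hv j)), mem_tangentSpace] at hc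
    simp only [Pi.smul_apply, smul_eq_mul, mul_left_comm _ (c 0), ← Finset.mul_sum] at hc
    exact (mul_eq_zero.mp hc).resolve_right (gradient_sq_ne_zero hx)
  refine ⟨h0, fun j => ?_⟩
  rw [vecMul_frameMatrix, h0, zero_smul, zero_add, herm_sum_smul_right]
  simp [hu]

/-- A left null vector is the coefficient vector of `0`, which is tangent, so all its entries
vanish. -/
theorem det_frameMatrix_ne_zero {x : Fin (m + 1) → ℂ} (hx : ∃ i, partialAt W i x ≠ 0)
    {v : Fin m → Fin (m + 1) → ℂ} (hv : ∀ j, v j ∈ tangentSpace W x)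
    (hu : ∀ i j, herm w (v i) (v j) = if i = j then 1 else 0) : (frameMatrix W x v).det ≠ 0 := by
  intro hdet
  obtain ⟨c, hc0, hc⟩ := Matrix.exists_vecMul_eq_zero_iff.mpr hdet
  obtain ⟨h1, h2⟩ := coeff_of_vecMul_frameMatrix (c := c) hx hv hu (by
    rw [hc]; exact Submodule.zero_mem _)
  apply hc0
  ext i
  refine Fin.cases h1 (fun j => ?_) i
  rw [h2, hc]
  exact map_zero (hermLin w (v j))

theorem eq_sum_herm_smul {x : Fin (m + 1) → ℂ} (hx : ∃ i, partialAt W i x ≠ 0)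
    {v : Fin m → Fin (m + 1) → ℂ} (hv : ∀ j, v j ∈ tangentSpace W x)
    (hu : ∀ i j, herm w (v i) (v j) = if i = j then 1 else 0) {y : Fin (m + 1) → ℂ}
    (hy : y ∈ tangentSpace W x) : y = ∑ i, herm w (v i) y • v i := by
  set c := Matrix.vecMul y (frameMatrix W x v)⁻¹ with hc
  have h1 : Matrix.vecMul c (frameMatrix W x v) = y := by
    rw [hc, Matrix.vecMul_vecMul, Matrix.nonsing_inv_mul _
      (isUnit_iff_ne_zero.mpr (det_frameMatrix_ne_zero hx hv hu)), Matrix.vecMul_one]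
  obtain ⟨h2, h3⟩ := coeff_of_vecMul_frameMatrix (c := c) hx hv hu (by rwa [h1])
  rw [h1] at h3
  nth_rewrite 1 [← h1]
  rw [vecMul_frameMatrix, h2, zero_smul, zero_add]
  exact Finset.sum_congr rfl fun j _ => by rw [h3]

theorem residueForm_ne_zero {x : Fin (m + 1) → ℂ} (hx : ∃ i, partialAt W i x ≠ 0)
    {v : Fin m → Fin (m + 1) → ℂ} (hv : ∀ j, v j ∈ tangentSpace W x)
    (hu : ∀ i j, herm w (v i) (v j) = if i = j then 1 else 0) : residueForm W x v ≠ 0 :=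
  div_ne_zero (det_frameMatrix_ne_zero hx hv hu) (gradient_sq_ne_zero hx)

theorem residueForm_sum_smul (x : Fin (m + 1) → ℂ) {u v : Fin m → Fin (m + 1) → ℂ}
    (A : Matrix (Fin m) (Fin m) ℂ) (hu : ∀ j, u j = ∑ i, A i j • v i) :
    residueForm W x u = A.det * residueForm W x v := by
  have h1 : frameMatrix W x u = border 1 A.transpose * frameMatrix W x v := by
    ext i k
    rw [Matrix.mul_apply, Fin.sum_univ_succ]
    refine Fin.cases ?_ (fun j => ?_) i
    · simp [frameMatrix, border]
    · simp [frameMatrix, border, hu j, Finset.sum_apply]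
  have h2 : (frameMatrix W x u).det = A.det * (frameMatrix W x v).det := by
    rw [h1, Matrix.det_mul, det_border, one_mul, Matrix.det_transpose]
  change (frameMatrix W x u).det / _ = _ * ((frameMatrix W x v).det / _)
  rw [h2, mul_div_assoc]

theorem sum_partialAt_diagonal {T : Fin (m + 1) → ℂ} {κ : ℂ}
    (hT : ∀ x : Fin (m + 1) → ℂ, eval (fun i => T i * x i) W = κ * eval x W)
    (x v : Fin (m + 1) → ℂ) :
    ∑ i, partialAt W i (fun k => T k * x k) * (T i * v i) = κ * ∑ i, partialAt W i x * v i := by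
  rw [Finset.mul_sum]
  refine Finset.sum_congr rfl fun i _ => ?_
  rw [← mul_assoc, partialAt_rescale hT, mul_assoc]

theorem diagonal_mem_tangentSpace {T : Fin (m + 1) → ℂ} {κ : ℂ}
    (hT : ∀ x : Fin (m + 1) → ℂ, eval (fun i => T i * x i) W = κ * eval x W)
    {x v : Fin (m + 1) → ℂ} (hv : v ∈ tangentSpace W x) :
    (fun i => T i * v i) ∈ tangentSpace W (fun k => T k * x k) := by
  rw [mem_tangentSpace] at hv ⊢
  rw [sum_partialAt_diagonal hT, hv, mul_zero]

theorem exists_partialAt_diagonal_ne_zero {T : Fin (m + 1) → ℂ} {κ : ℂ} (hκ : κ ≠ 0)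
    (hT : ∀ x : Fin (m + 1) → ℂ, eval (fun i => T i * x i) W = κ * eval x W)
    {x : Fin (m + 1) → ℂ} (hx : ∃ i, partialAt W i x ≠ 0) :
    ∃ i, partialAt W i (fun k => T k * x k) ≠ 0 := by
  obtain ⟨i, hi⟩ := hx
  refine ⟨i, fun h0 => hi ?_⟩
  have h1 := partialAt_rescale hT i x
  rw [h0, zero_mul] at h1
  exact (mul_eq_zero.mp h1.symm).resolve_left hκ

/-- The behaviour of the residue form under a diagonal map that multiplies `W` by `κ`. -/
theorem mul_residueForm_diagonal {T : Fin (m + 1) → ℂ} {κ : ℂ} (hκ : κ ≠ 0)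
    (hT : ∀ x : Fin (m + 1) → ℂ, eval (fun i => T i * x i) W = κ * eval x W)
    {x : Fin (m + 1) → ℂ} (hx : ∃ i, partialAt W i x ≠ 0) {v : Fin m → Fin (m + 1) → ℂ}
    (hv : ∀ j, v j ∈ tangentSpace W x) :
    κ * residueForm W (fun k => T k * x k) (fun j i => T i * v j i)
      = (∏ i, T i) * residueForm W x v := by
  set ν : Fin (m + 1) → ℂ := fun i => (starRingEnd ℂ) (partialAt W i x) with hν
  -- At `Tx` the transported vector `Tν` serves as the normal vector in place of the conjugate
  -- gradient there; by `mul_residueForm` any vector is allowed.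
  have h1 := mul_residueForm W (fun k => T k * x k) (fun i => T i * ν i) (fun j i => T i * v j i)
    (exists_partialAt_diagonal_ne_zero hκ hT hx)
    (fun j => mem_tangentSpace.mp (diagonal_mem_tangentSpace hT (hv j)))
  have h2 := mul_residueForm W x ν v hx (fun j => mem_tangentSpace.mp (hv j))
  have h3 : (Matrix.of (Fin.cons (fun i => T i * ν i) (fun j i => T i * v j i)) :
      Matrix (Fin (m + 1)) (Fin (m + 1)) ℂ)
      = Matrix.of (Fin.cons ν v) * Matrix.diagonal T := by
    ext i k
    rw [Matrix.mul_diagonal]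
    refine Fin.cases ?_ (fun j => ?_) i
    · simp [mul_comm]
    · simp [mul_comm]
  rw [h3, Matrix.det_mul, Matrix.det_diagonal, sum_partialAt_diagonal hT, ← h2] at h1
  have h4 : ∑ i, partialAt W i x * ν i ≠ 0 := gradient_sq_ne_zero hx
  apply mul_left_cancel₀ h4
  linear_combination h1

/-- The eigenvalues of a diagonal map `T` that fixes `x` and multiplies `W` by `κ` are `κ` and those
on the tangent space. -/
theorem charpoly_diagonal_eq {T : Fin (m + 1) → ℂ} {κ : ℂ}
    (hT : ∀ y : Fin (m + 1) → ℂ, eval (fun i => T i * y i) W = κ * eval y W)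
    {x : Fin (m + 1) → ℂ} (hx : ∃ i, partialAt W i x ≠ 0) (hfix : (fun i => T i * x i) = x)
    {v : Fin m → Fin (m + 1) → ℂ} (hv : ∀ j, v j ∈ tangentSpace W x)
    (hu : ∀ i j, herm w (v i) (v j) = if i = j then 1 else 0)
    {A : Matrix (Fin m) (Fin m) ℂ} (hA : ∀ j, (fun i => T i * v j i) = ∑ i, A i j • v i) :
    (Matrix.diagonal T).charpoly = (Polynomial.X - Polynomial.C κ) * A.charpoly := by
  set P := frameMatrix W x v with hP
  have hunit : IsUnit P.det := isUnit_iff_ne_zero.mpr (det_frameMatrix_ne_zero hx hv hu)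
  -- In the basis of the conjugate gradient and the frame, `T` is block diagonal, not merely
  -- triangular, with block `κ` on the conjugate gradient.
  have h1 : P * Matrix.diagonal T = border κ A.transpose * P := by
    ext i k
    rw [Matrix.mul_diagonal, Matrix.mul_apply, Fin.sum_univ_succ]
    refine Fin.cases ?_ (fun j => ?_) i
    · have h2 := partialAt_rescale hT k x
      rw [hfix] at h2
      -- Since `T` fixes `x`, `Tₖ = κ` wherever `∂ₖW(x) ≠ 0`; hence the conjugate gradient is an
      -- eigenvector too.
      have h3 : (starRingEnd ℂ) (partialAt W k x) * T k = κ * (starRingEnd ℂ) (partialAt W k x) := by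
        by_cases h0 : partialAt W k x = 0
        · simp [h0]
        · have h4 : T k = κ := mul_left_cancel₀ h0 (by rw [h2, mul_comm])
          rw [h4, mul_comm]
      simpa [hP, frameMatrix, border] using h3
    · have h2 := congrFun (hA j) k
      simp only [Finset.sum_apply, Pi.smul_apply, smul_eq_mul] at h2
      simp only [hP, frameMatrix, border, Matrix.of_apply, Fin.cons_succ, Fin.cases_zero,
        Fin.cases_succ, zero_mul, zero_add, Matrix.transpose_apply]
      rw [mul_comm, h2]
  have h2 : Matrix.diagonal T = P⁻¹ * (border κ A.transpose * P) := by
    rw [← h1, ← mul_assoc, Matrix.nonsing_inv_mul _ hunit, one_mul]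
  rw [h2, Matrix.charpoly_mul_comm, mul_assoc, Matrix.mul_nonsing_inv _ hunit, mul_one,
    charpoly_border, Matrix.charpoly_transpose]

end LGOrbifold

end


/-! ### The linearized flow in an equivariant unitary frame -/

noncomputable section

namespace LGOrbifold

open MvPolynomial RobbinSalamon

variable {m : ℕ} {W : MvPolynomial (Fin (m + 1)) ℂ} {w : Fin (m + 1) → ℕ} {h : ℕ}

theorem norm_flowFactor {n : ℕ} (w : Fin n → ℕ) (h : ℕ) (t : ℝ) (i : Fin n) :
    ‖flowFactor w h t i‖ = 1 := norm_exp_two_pi_mul _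

theorem flowFactor_zero {n : ℕ} (w : Fin n → ℕ) (h : ℕ) (i : Fin n) : flowFactor w h 0 i = 1 := by
  simp [flowFactor]

theorem reebFlow_zero {n : ℕ} (w : Fin n → ℕ) (h : ℕ) (x : Fin n → ℂ) : reebFlow w h 0 x = x := by
  ext i
  change flowFactor w h 0 i * x i = x i
  rw [flowFactor_zero, one_mul]

theorem prod_flowFactor {n : ℕ} (w : Fin n → ℕ) (h : ℕ) (t : ℝ) :
    ∏ i, flowFactor w h t i
      = Complex.exp (2 * Real.pi * Complex.I * ((t * ∑ i, thetaJ w h i : ℝ) : ℂ)) := by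
  simp only [flowFactor]
  rw [← Complex.exp_sum, ← Finset.mul_sum, ← Complex.ofReal_sum, ← Finset.mul_sum]

theorem ne_zero_of_mem_link {n : ℕ} {W : MvPolynomial (Fin n) ℂ} {δ : ℝ} (hδ : 0 < δ)
    {p : Fin n → ℂ} (hp : p ∈ link W δ) : p ≠ 0 := by
  rintro rfl
  have h1 := hp.2
  simp only [Pi.zero_apply, norm_zero, ne_eq, OfNat.ofNat_ne_zero, not_false_eq_true, zero_pow,
    Finset.sum_const_zero] at h1
  exact (pow_pos hδ 2).ne h1

theorem exists_partialAt_reebFlow_ne_zero (hW : HasWeight W w h) {p : Fin (m + 1) → ℂ}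
    (hp : ∃ i, partialAt W i p ≠ 0) (t : ℝ) : ∃ i, partialAt W i (reebFlow w h t p) ≠ 0 :=
  exists_partialAt_diagonal_ne_zero (Complex.exp_ne_zero _) (eval_flow hW t) hp

theorem reebFlow_mem_tangentSpace (hW : HasWeight W w h) {p v : Fin (m + 1) → ℂ}
    (hv : v ∈ tangentSpace W p) (t : ℝ) :
    reebFlow w h t v ∈ tangentSpace W (reebFlow w h t p) :=
  diagonal_mem_tangentSpace (eval_flow hW t) hv

theorem herm_reebFlow {n : ℕ} (w : Fin n → ℕ) (h : ℕ) (t : ℝ) (u v : Fin n → ℂ) :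
    herm w (reebFlow w h t u) (reebFlow w h t v) = herm w u v :=
  herm_diagonal w (norm_flowFactor w h t) u v

/-- `R_t` multiplies `dz₁ ∧ ⋯ ∧ dzₙ` by `exp (2πi t ∑ θ_J)` and `dW` by `exp (2πi t)`; `Ω` is their
quotient. -/
theorem residueForm_reebFlow (hW : HasWeight W w h) {p : Fin (m + 1) → ℂ}
    (hp : ∃ i, partialAt W i p ≠ 0) {v : Fin m → Fin (m + 1) → ℂ}
    (hv : ∀ j, v j ∈ tangentSpace W p) (t : ℝ) :
    residueForm W (reebFlow w h t p) (fun j => reebFlow w h t (v j))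
      = Complex.exp (2 * Real.pi * Complex.I * ((t * (∑ i, thetaJ w h i - 1) : ℝ) : ℂ))
        * residueForm W p v := by
  have h1 := mul_residueForm_diagonal (Complex.exp_ne_zero _) (eval_flow hW t) hp hv
  rw [prod_flowFactor] at h1
  apply mul_left_cancel₀ (Complex.exp_ne_zero (2 * Real.pi * Complex.I * t))
  refine h1.trans ?_
  rw [← mul_assoc, ← Complex.exp_add]
  congr 2
  push_cast
  ring

/-- The matrix of the linearized flow in the frame `F`. -/
def flowMatrix (w : Fin (m + 1) → ℕ) (h : ℕ) (F : ℝ → Fin m → Fin (m + 1) → ℂ) (t : ℝ) :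
    Matrix (Fin m) (Fin m) ℂ :=
  Matrix.of fun i j => herm w (F t i) (reebFlow w h t (F 0 j))

section Frame

variable {g : Fin (m + 1) → ℂˣ} {l : ℝ} {p : Fin (m + 1) → ℂ} {F : ℝ → Fin m → Fin (m + 1) → ℂ}

theorem IsUnitaryFrame.mem_tangentSpace_zero (hF : IsUnitaryFrame W w h g l p F) (hl : 0 ≤ l)
    (j : Fin m) : F 0 j ∈ tangentSpace W p := by
  have h1 := hF.tangent 0 ⟨le_rfl, hl⟩ j
  rwa [reebFlow_zero] at h1

theorem IsUnitaryFrame.reebFlow_eq_sum (hF : IsUnitaryFrame W w h g l p F) (hW : HasWeight W w h)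
    (hp : ∃ i, partialAt W i p ≠ 0) {t : ℝ} (ht : t ∈ Set.Icc 0 l) (j : Fin m) :
    reebFlow w h t (F 0 j) = ∑ i, flowMatrix w h F t i j • F t i :=
  eq_sum_herm_smul (exists_partialAt_reebFlow_ne_zero hW hp t) (hF.tangent t ht) (hF.unitary t ht)
    (reebFlow_mem_tangentSpace hW (hF.mem_tangentSpace_zero (ht.1.trans ht.2) j) t)

theorem IsUnitaryFrame.flowMatrix_mem (hF : IsUnitaryFrame W w h g l p F) (hW : HasWeight W w h)
    (hp : ∃ i, partialAt W i p ≠ 0) {t : ℝ} (ht : t ∈ Set.Icc 0 l) :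
    flowMatrix w h F t ∈ Matrix.unitaryGroup (Fin m) ℂ := by
  rw [Matrix.mem_unitaryGroup_iff']
  ext j k
  have h1 := herm_reebFlow w h t (F 0 j) (F 0 k)
  rw [hF.unitary 0 ⟨le_rfl, ht.1.trans ht.2⟩, hF.reebFlow_eq_sum hW hp ht j,
    herm_sum_smul_left] at h1
  rw [Matrix.one_apply, ← h1, Matrix.mul_apply]
  rfl

theorem IsUnitaryFrame.flowMatrix_zero (hF : IsUnitaryFrame W w h g l p F) (hl : 0 ≤ l) :
    flowMatrix w h F 0 = 1 := by
  ext i j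
  rw [flowMatrix, Matrix.of_apply, reebFlow_zero, hF.unitary 0 ⟨le_rfl, hl⟩, Matrix.one_apply]

theorem eval_twist (hW : HasWeight W w h) (hg : g ∈ symmetryGroup W) (l : ℝ)
    (x : Fin (m + 1) → ℂ) :
    eval (fun i => ((g i : ℂ) * flowFactor w h l i) * x i) W
      = Complex.exp (2 * Real.pi * Complex.I * l) * eval x W := by
  rw [← eval_flow hW l x, ← hg (fun i => flowFactor w h l i * x i)]
  simp only [mul_assoc]

/-- Applying `g` at time `l` and using `g F(l) = F(0)` shows that `A(l)` is the matrix of `g R_l` on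
`ker dW_p` in the basis `F(0)`. The remaining eigenvalue of `g R_l` on `ℂⁿ` is `exp (2πi l)`. -/
theorem IsUnitaryFrame.eigSum_flowMatrix (hF : IsUnitaryFrame W w h g l p F)
    (hW : HasWeight W w h) (hg : g ∈ symmetryGroup W) (hl : 0 ≤ l)
    (hp : ∃ i, partialAt W i p ≠ 0) (hfix : p ∈ fixedLocus w h g l) :
    eigSum defect (flowMatrix w h F l)
      = ∑ i, defect ((g i : ℂ) * flowFactor w h l i)
        - defect (Complex.exp (2 * Real.pi * Complex.I * l)) := by
  have hfix' : (fun i => ((g i : ℂ) * flowFactor w h l i) * p i) = p := by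
    have h1 : act g (reebFlow w h l p) = p := hfix
    ext i
    rw [mul_assoc]
    exact congrFun h1 i
  have h1 := charpoly_diagonal_eq (eval_twist hW hg l) hp hfix'
    (hF.mem_tangentSpace_zero hl) (hF.unitary 0 ⟨le_rfl, hl⟩) (A := flowMatrix w h F l) (by
      intro j
      have h2 := congrArg (act g) (hF.reebFlow_eq_sum hW hp ⟨hl, le_rfl⟩ j)
      have h3 : act g (∑ i, flowMatrix w h F l i j • F l i)
          = ∑ i, flowMatrix w h F l i j • F 0 i := by
        ext k
        simp only [act, Finset.sum_apply, Pi.smul_apply, smul_eq_mul, Finset.mul_sum]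
        refine Finset.sum_congr rfl fun i _ => ?_
        rw [← hF.equivariant i, act]
        ring
      rw [h3] at h2
      rw [← h2]
      ext k
      simp only [act, reebFlow, flowFactor]
      ring)
  have h2 := congrArg (fun P : Polynomial ℂ => (P.roots.map defect).sum) h1
  rw [Polynomial.roots_mul (mul_ne_zero (Polynomial.X_sub_C_ne_zero _)
    (Matrix.charpoly_monic _).ne_zero), Polynomial.roots_X_sub_C, Multiset.map_add,
    Multiset.sum_add, Multiset.map_singleton, Multiset.sum_singleton] at h2
  have h3 := eigSum_diagonal defect fun i => (g i : ℂ) * flowFactor w h l i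
  rw [eigSum] at h3 ⊢
  linarith

/-- The index of the linearized flow, corrected by the rotation number of the frame. -/
theorem IsUnitaryFrame.index_add_rotation (hF : IsUnitaryFrame W w h g l p F)
    (hW : HasWeight W w h) (hg : g ∈ symmetryGroup W) (hl : 0 < l)
    (hp : ∃ i, partialAt W i p ≠ 0) (hfix : p ∈ fixedLocus w h g l)
    (hreg : IsRegularPath (linearizedFlow w h F) 0 l) {ρ : ℝ}
    (hρ : IsRotationNumber (fun t => residueForm W (reebFlow w h t p) (F t)) 0 l ρ) :
    index (linearizedFlow w h F) 0 l + 2 * ρ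
      = ∑ i, defect ((g i : ℂ) * flowFactor w h l i)
        - defect (Complex.exp (2 * Real.pi * Complex.I * l))
        + 2 * (l * (∑ i, thetaJ w h i - 1)) := by
  obtain ⟨φ, hφ, hres, rfl⟩ := hρ
  have h0 : (0 : ℝ) ∈ Set.Icc 0 l := ⟨le_rfl, hl.le⟩
  set σ := ∑ i, thetaJ w h i - 1 with hσ
  set c : ℝ → ℂ := fun t => residueForm W (reebFlow w h t p) (F t) with hc
  have hA : ∀ t ∈ Set.Icc 0 l, flowMatrix w h F t ∈ Matrix.unitaryGroup (Fin m) ℂ :=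
    fun t ht => hF.flowMatrix_mem hW hp ht
  -- `Ω(R_t F(0)) = det A(t) · Ω(F(t))`, where the left side rotates with speed `σ`. So the phase of
  -- the determinant is `tσ` minus the rotation of the frame.
  have hdet : ∀ t ∈ Set.Icc 0 l, (flowMatrix w h F t).det
      = Complex.exp (2 * Real.pi * Complex.I * ((t * σ + φ 0 - φ t : ℝ) : ℂ)) := by
    intro t ht
    have h1 := residueForm_sum_smul (W := W) (reebFlow w h t p) (flowMatrix w h F t)
      (fun j => hF.reebFlow_eq_sum hW hp ht j)
    rw [residueForm_reebFlow hW hp (hF.mem_tangentSpace_zero hl.le)] at h1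
    have h2 : residueForm W p (F 0) = c 0 := by rw [hc]; simp only [reebFlow_zero]
    obtain ⟨hc0, hc0'⟩ := hres 0 h0
    obtain ⟨hct, hct'⟩ := hres t ht
    have h3 : residueForm W (reebFlow w h t p) (F t) = c t := rfl
    rw [h2, h3, ← hσ] at h1
    -- `|det A(t)| = 1`, so `|Ω(F)|` is constant and only the phases remain to be compared.
    have hn : ‖c 0‖ = ‖c t‖ := by
      have h4 := congrArg norm h1
      rw [norm_mul, norm_mul, norm_exp_two_pi_mul, one_mul] at h4
      have h5 : ‖(flowMatrix w h F t).det‖ = 1 :=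
        CStarRing.norm_of_mem_unitary (Matrix.det_of_mem_unitary (hA t ht))
      rw [h4, h5, one_mul]
    have hcn : (‖c t‖ : ℂ) ≠ 0 := by
      exact_mod_cast norm_ne_zero_iff.mpr hct
    rw [show c 0 = _ from hc0', show c t = _ from hct', hn] at h1
    have h6 : Complex.exp (2 * Real.pi * Complex.I * ((t * σ : ℝ) : ℂ))
        * Complex.exp (2 * Real.pi * Complex.I * φ 0)
        = (flowMatrix w h F t).det * Complex.exp (2 * Real.pi * Complex.I * φ t) := by
      apply mul_left_cancel₀ hcn
      linear_combination h1
    apply mul_right_cancel₀ (Complex.exp_ne_zero (2 * Real.pi * Complex.I * φ t))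
    rw [← h6, ← Complex.exp_add, ← Complex.exp_add]
    congr 1
    push_cast
    ring
  have h1 := index_realMap (A := flowMatrix w h F) hl hA hreg
    (φ := fun t => t * σ + φ 0 - φ t) (by fun_prop) hdet
  have h2 : eigSum defect (flowMatrix w h F 0) = 0 := by
    rw [hF.flowMatrix_zero hl.le, ← Matrix.diagonal_one, eigSum_diagonal]
    simp [defect_one]
  rw [hF.eigSum_flowMatrix hW hg hl.le hp hfix, h2] at h1
  have h3 : index (linearizedFlow w h F) 0 l = _ := h1
  rw [h3]
  ring

end Frame

/-! ### Evaluation of the eigenvalue sum for `g R_l` -/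

theorem exp_theta {n : ℕ} {g : Fin n → ℂˣ} {i : Fin n} (hg : ‖(g i : ℂ)‖ = 1) :
    Complex.exp (2 * Real.pi * Complex.I * theta g i) = g i := by
  have h1 : Complex.exp ((g i : ℂ).arg * Complex.I) = g i := by
    have := Complex.norm_mul_exp_arg_mul_I (g i : ℂ)
    rwa [hg, Complex.ofReal_one, one_mul] at this
  conv_rhs => rw [← h1]
  rw [Complex.exp_eq_exp_iff_exists_int]
  refine ⟨-⌊(g i : ℂ).arg / (2 * Real.pi)⌋, ?_⟩
  have hp : (Real.pi : ℂ) ≠ 0 := by exact_mod_cast Real.pi_ne_zero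
  rw [theta, Int.fract]
  push_cast
  field_simp
  ring

theorem defect_twist {n : ℕ} (w : Fin n → ℕ) (h : ℕ) {g : Fin n → ℂˣ} {i : Fin n}
    (hg : ‖(g i : ℂ)‖ = 1) (l : ℝ) :
    defect ((g i : ℂ) * flowFactor w h l i)
      = Q (l * thetaJ w h i + theta g i) - 2 * (l * thetaJ w h i + theta g i) := by
  rw [← exp_theta hg, flowFactor, ← Complex.exp_add, ← defect_exp]
  congr 2
  push_cast
  ring

/-- There is a fixed point `x` of `g R_l` with `∂ᵢW(x) ≠ 0`, where the chain rule gives `∂ᵢW(x) · (g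
R_l)ᵢ = exp (2πi l) · ∂ᵢW(x)`. -/
theorem twist_eq_of_notMem_indexSet (hW : HasWeight W w h) {g : Fin (m + 1) → ℂˣ}
    (hg : g ∈ symmetryGroup W) {l : ℝ} {i : Fin (m + 1)} (hi : i ∉ indexSet W w h g l) :
    (g i : ℂ) * flowFactor w h l i = Complex.exp (2 * Real.pi * Complex.I * l) := by
  classical
  simp only [indexSet, Finset.mem_filter, Finset.mem_univ, true_and, not_forall] at hi
  obtain ⟨x, hx, hi⟩ := hi
  have h1 := partialAt_rescale (eval_twist hW hg l) i x
  have h2 : (fun k => ((g k : ℂ) * flowFactor w h l k) * x k) = x := by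
    have h3 : act g (reebFlow w h l x) = x := hx
    ext k
    rw [mul_assoc]
    exact congrFun h3 k
  rw [h2, mul_comm] at h1
  exact mul_right_cancel₀ hi h1

/-- On `I` the terms `-2 l θ_J` cancel against the rotation of `Ω`, leaving `-2 θ_g`. Each of the
other entries contributes `Q(l) - 2l`, and one such term is removed for the normal direction; its
`2l` cancels the `-2l` coming from `dW` in `Ω`. -/
theorem sum_defect_eq (hW : HasWeight W w h) (hnd : IsNondegenerate W) {g : Fin (m + 1) → ℂˣ}
    (hg : g ∈ symmetryGroup W) (l : ℝ) :
    ∑ i, defect ((g i : ℂ) * flowFactor w h l i)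
        - defect (Complex.exp (2 * Real.pi * Complex.I * l))
        + 2 * (l * (∑ i, thetaJ w h i - 1))
      = 2 * (-(∑ i ∈ indexSet W w h g l, theta g i)
              + ∑ j ∈ (indexSet W w h g l)ᶜ, (l * thetaJ w h j - l))
          + ∑ i ∈ indexSet W w h g l, Q (l * thetaJ w h i + theta g i)
          + (((indexSet W w h g l)ᶜ.card : ℝ) - 1) * Q l := by
  set S := indexSet W w h g l with hS
  have hn := norm_eq_one_of_mem_symmetryGroup hnd hg
  have h1 : ∑ i ∈ S, defect ((g i : ℂ) * flowFactor w h l i)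
      = ∑ i ∈ S, Q (l * thetaJ w h i + theta g i) - 2 * (l * ∑ i ∈ S, thetaJ w h i)
        - 2 * ∑ i ∈ S, theta g i := by
    rw [Finset.mul_sum, Finset.mul_sum, Finset.mul_sum, ← Finset.sum_sub_distrib,
      ← Finset.sum_sub_distrib]
    refine Finset.sum_congr rfl fun i _ => ?_
    rw [defect_twist w h (hn i)]
    ring
  have h2 : ∑ i ∈ Sᶜ, defect ((g i : ℂ) * flowFactor w h l i) = Sᶜ.card * (Q l - 2 * l) := by
    rw [← nsmul_eq_mul, ← Finset.sum_const]
    refine Finset.sum_congr rfl fun i hi => ?_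
    rw [twist_eq_of_notMem_indexSet hW hg (Finset.mem_compl.mp hi), defect_exp]
  have h3 : ∑ j ∈ Sᶜ, (l * thetaJ w h j - l) = l * ∑ j ∈ Sᶜ, thetaJ w h j - Sᶜ.card * l := by
    rw [Finset.sum_sub_distrib, Finset.mul_sum, Finset.sum_const, nsmul_eq_mul]
  rw [← Finset.sum_add_sum_compl S, ← Finset.sum_add_sum_compl S (thetaJ w h), h1, h2, h3,
    defect_exp]
  ring

end LGOrbifold

end


noncomputable section

/-! ## Existence of frames -/

namespace RobbinSalamon

open Matrix

/-- `d ↦ realMap (diagonal d)` as a continuous linear map. -/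
def diagonalMap (m : ℕ) :
    (Fin m → ℂ) →L[ℝ] EuclideanSpace ℂ (Fin m) →L[ℝ] EuclideanSpace ℂ (Fin m) :=
  LinearMap.toContinuousLinearMap
    { toFun := fun d => realMap (diagonal d)
      map_add' := fun c d => by
        ext v i
        change (diagonal (c + d) *ᵥ v.ofLp) i
          = (diagonal c *ᵥ v.ofLp) i + (diagonal d *ᵥ v.ofLp) i
        simp only [mulVec_diagonal, Pi.add_apply, add_mul]
      map_smul' := fun r d => by
        ext v i
        change (diagonal (r • d) *ᵥ v.ofLp) i = r • (diagonal d *ᵥ v.ofLp) i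
        simp only [mulVec_diagonal, Pi.smul_apply, smul_mul_assoc] }

theorem diagonalMap_apply {m : ℕ} (d : Fin m → ℂ) (v : EuclideanSpace ℂ (Fin m)) (i : Fin m) :
    diagonalMap m d v i = d i * v i :=
  mulVec_diagonal d v.ofLp i

/-- A diagonal path of rotations with positive speeds has regular crossings. -/
theorem isRegularPath_diagonal {m : ℕ} {b : Fin m → ℝ} (hb : ∀ j, 0 < b j) {l : ℝ} (hl : 0 < l) :
    IsRegularPath (fun t => realMap (diagonal fun j =>
      Complex.exp (2 * Real.pi * Complex.I * ((b j * t : ℝ) : ℂ)))) 0 l := by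
  set e : ℝ → Fin m → ℂ := fun t j => Complex.exp (2 * Real.pi * Complex.I * ((b j * t : ℝ) : ℂ))
    with he
  have hder : ∀ t, HasDerivAt e (fun j => 2 * Real.pi * Complex.I * b j * e t j) t := by
    intro t
    rw [hasDerivAt_pi]
    intro j
    have h1 : HasDerivAt (fun s : ℝ => 2 * Real.pi * Complex.I * ((b j * s : ℝ) : ℂ))
        (2 * Real.pi * Complex.I * b j) t := by
      have := ((hasDerivAt_id t).const_mul (b j)).ofReal_comp.const_mul (2 * Real.pi * Complex.I)
      simpa using this
    exact h1.cexp.congr_deriv (by rw [mul_comm])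
  have hL : ∀ t, HasDerivAt (fun t => realMap (diagonal (e t)))
      (diagonalMap m (fun j => 2 * Real.pi * Complex.I * b j * e t j)) t := fun t =>
    (diagonalMap m).hasFDerivAt.comp_hasDerivAt t (hder t)
  have hunit : ∀ t, diagonal (e t) ∈ unitaryGroup (Fin m) ℂ := by
    intro t
    rw [mem_unitaryGroup_iff, star_eq_conjTranspose, diagonal_conjTranspose, diagonal_mul_diagonal,
      ← diagonal_one]
    congr 1
    ext j
    have h2 : ‖e t j‖ = 1 := by
      have : 2 * Real.pi * Complex.I * ((b j * t : ℝ) : ℂ)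
          = ((2 * Real.pi * (b j * t) : ℝ) : ℂ) * Complex.I := by
        push_cast; ring
      simp only [he]
      rw [this, Complex.norm_exp_ofReal_mul_I]
    rw [Pi.star_apply, RCLike.star_def, Complex.mul_conj', h2]
    simp
  refine ⟨?_, fun t _ u v => ?_, fun t ht => ?_⟩
  · have hcd : ContDiff ℝ 1 e := by
      rw [contDiff_pi]
      intro j
      simp only [he]
      have : ContDiff ℝ 1 fun t : ℝ => ((b j * t : ℝ) : ℂ) :=
        Complex.ofRealCLM.contDiff.comp (contDiff_const.mul contDiff_id)
      exact (contDiff_const.mul this).cexp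
    exact ((diagonalMap m).contDiff.comp hcd).contDiffOn
  · exact congrArg Complex.im (inner_realMap (hunit t) u v)
  · rw [eq_bot_iff]
    rintro ⟨v, hv⟩ hrad
    have h0 := (QuadraticMap.mem_radical_iff'.mp hrad).1
    have hD : derivWithin (fun t => realMap (diagonal (e t))) (Set.Icc 0 l) t
        = diagonalMap m (fun j => 2 * Real.pi * Complex.I * b j * e t j) :=
      (hL t).hasDerivWithinAt.derivWithin (uniqueDiffOn_Icc hl t ht)
    have hv' : ∀ j, e t j * v j = v j := by
      intro j
      rw [LinearMap.mem_ker] at hv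
      have h1 : diagonalMap m (e t) v = v := sub_eq_zero.mp hv
      have h2 := congrArg (fun x : EuclideanSpace ℂ (Fin m) => x j) h1
      simp only [diagonalMap_apply] at h2
      exact h2
    have h1 : (inner ℂ v (diagonalMap m (fun j => 2 * Real.pi * Complex.I * b j * e t j) v)).im
        = 0 := by
      rw [← hD]
      exact h0
    -- On the kernel `eⱼ vⱼ = vⱼ`, so the crossing form is `∑ 2π bⱼ |vⱼ|²`, which is positive
    -- definite.
    have h2 : inner ℂ v (diagonalMap m (fun j => 2 * Real.pi * Complex.I * b j * e t j) v)
        = ((∑ j, 2 * Real.pi * b j * ‖v j‖ ^ 2 : ℝ) : ℂ) * Complex.I := by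
      rw [PiLp.inner_apply, Complex.ofReal_sum, Finset.sum_mul]
      refine Finset.sum_congr rfl fun j _ => ?_
      rw [diagonalMap_apply, mul_assoc, hv', RCLike.inner_apply]
      push_cast
      rw [← Complex.conj_mul']
      ring
    rw [h2, Complex.im_ofReal_mul, Complex.I_im, mul_one] at h1
    rw [Finset.sum_eq_zero_iff_of_nonneg (fun j _ => by have := hb j; positivity)] at h1
    have h3 : v = 0 := by
      ext j
      have h4 := h1 j (Finset.mem_univ j)
      have h5 : 2 * Real.pi * b j ≠ 0 := by have := hb j; positivity
      have h6 := (mul_eq_zero.mp h4).resolve_left h5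
      exact norm_eq_zero.mp (pow_eq_zero_iff two_ne_zero |>.mp h6)
    exact (Submodule.mem_bot ℝ).mpr (Subtype.ext h3)

end RobbinSalamon

namespace LGOrbifold

open MvPolynomial RobbinSalamon

variable {m : ℕ} {W : MvPolynomial (Fin (m + 1)) ℂ} {w : Fin (m + 1) → ℕ} {h : ℕ}

/-- Rescaling the coordinates by `√(π wₖ)` turns `herm` into the standard inner product and `ker dW`
into the orthogonal complement of `ν`. -/
theorem exists_unitary_basis (hw : ∀ i, 0 < w i) {x : Fin (m + 1) → ℂ}
    (hx : ∃ i, partialAt W i x ≠ 0) :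
    ∃ v : Fin m → Fin (m + 1) → ℂ, (∀ j, v j ∈ tangentSpace W x) ∧
      ∀ i j, herm w (v i) (v j) = if i = j then 1 else 0 := by
  set s : Fin (m + 1) → ℝ := fun k => √(Real.pi * w k) with hs
  have hs0 : ∀ k, 0 < Real.pi * w k := fun k =>
    mul_pos Real.pi_pos (by exact_mod_cast hw k)
  have hss : ∀ k, (s k : ℂ) * s k = Real.pi * w k := fun k => by
    rw [← Complex.ofReal_mul, Real.mul_self_sqrt (hs0 k).le]
    push_cast
    rfl
  set ν : EuclideanSpace ℂ (Fin (m + 1)) :=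
    WithLp.toLp 2 fun k => (starRingEnd ℂ) (partialAt W k x) * s k with hν
  have hν0 : ν ≠ 0 := by
    obtain ⟨i, hi⟩ := hx
    intro h0
    have h1 : (starRingEnd ℂ) (partialAt W i x) * s i = 0 :=
      congrArg (fun y : EuclideanSpace ℂ (Fin (m + 1)) => y i) h0
    rcases mul_eq_zero.mp h1 with h2 | h2
    · exact hi ((map_eq_zero _).mp h2)
    · have h3 : s i = 0 := by exact_mod_cast h2
      exact (Real.sqrt_pos.mpr (hs0 i)).ne' h3
  have : Fact (Module.finrank ℂ (EuclideanSpace ℂ (Fin (m + 1))) = m + 1) := ⟨by simp⟩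
  set e := OrthonormalBasis.fromOrthogonalSpanSingleton (𝕜 := ℂ) m hν0 with he
  refine ⟨fun j k => s k * (e j : EuclideanSpace ℂ (Fin (m + 1))) k, fun j => ?_, fun i j => ?_⟩
  · rw [mem_tangentSpace]
    have h1 : inner ℂ ν (e j : EuclideanSpace ℂ (Fin (m + 1))) = 0 :=
      Submodule.mem_orthogonal_singleton_iff_inner_right.mp (e j).2
    rw [← h1, PiLp.inner_apply]
    refine Finset.sum_congr rfl fun k _ => ?_
    rw [RCLike.inner_apply]
    simp only [hν, map_mul, Complex.conj_conj, Complex.conj_ofReal]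
    ring
  · have h1 := orthonormal_iff_ite.mp e.orthonormal i j
    rw [← h1, Submodule.coe_inner, PiLp.inner_apply, herm]
    refine Finset.sum_congr rfl fun k _ => ?_
    rw [RCLike.inner_apply]
    simp only [map_mul, Complex.conj_ofReal]
    have h2 : (Real.pi : ℂ) * w k ≠ 0 := by
      have := (hs0 k).ne'
      exact_mod_cast this
    rw [div_eq_iff h2, ← hss k]
    ring

/-- A unitary frame of eigenvectors of a diagonal map on the tangent space. -/
theorem exists_unitary_eigenbasis (hw : ∀ i, 0 < w i) {T : Fin (m + 1) → ℂ} {κ : ℂ}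
    (hTn : ∀ i, ‖T i‖ = 1)
    (hT : ∀ y : Fin (m + 1) → ℂ, eval (fun i => T i * y i) W = κ * eval y W)
    {x : Fin (m + 1) → ℂ} (hx : ∃ i, partialAt W i x ≠ 0) (hfix : (fun i => T i * x i) = x) :
    ∃ (v : Fin m → Fin (m + 1) → ℂ) (a : Fin m → ℝ), (∀ j, v j ∈ tangentSpace W x) ∧
      (∀ i j, herm w (v i) (v j) = if i = j then 1 else 0) ∧ (∀ j, 0 < a j) ∧
      ∀ j, (fun i => T i * v j i) = Complex.exp (2 * Real.pi * Complex.I * a j) • v j := by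
  obtain ⟨u, hu, huu⟩ := exists_unitary_basis (W := W) hw hx
  have hTu : ∀ j, (fun i => T i * u j i) ∈ tangentSpace W x := fun j => by
    have h1 := diagonal_mem_tangentSpace hT (hu j)
    rwa [hfix] at h1
  set A : Matrix (Fin m) (Fin m) ℂ := Matrix.of fun i j => herm w (u i) (fun k => T k * u j k)
    with hA
  have hexp : ∀ j, (fun i => T i * u j i) = ∑ i, A i j • u i := fun j =>
    eq_sum_herm_smul hx hu huu (hTu j)
  have hAu : A ∈ Matrix.unitaryGroup (Fin m) ℂ := by
    rw [Matrix.mem_unitaryGroup_iff']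
    ext j k
    have h1 := herm_diagonal w hTn (u j) (u k)
    rw [huu, hexp j, herm_sum_smul_left] at h1
    rw [Matrix.one_apply, ← h1, Matrix.mul_apply]
    rfl
  obtain ⟨V, hV, d, hd, hAd⟩ := exists_unitary_diagonalization hAu
  have hVV := Matrix.mem_unitaryGroup_iff'.mp hV
  -- Adding `1` makes the exponent positive without changing the eigenvalue; positive speeds will
  -- make every crossing regular.
  refine ⟨fun j => ∑ i, V i j • u i, fun j => (d j).arg / (2 * Real.pi) + 1, fun j =>
    Submodule.sum_mem _ fun i _ => Submodule.smul_mem _ _ (hu i), fun i j => ?_, fun j => ?_,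
    fun j => ?_⟩
  · rw [herm_sum_smul_left]
    simp only [herm_sum_smul_right, huu]
    have h1 := congrFun (congrFun hVV i) j
    rw [Matrix.one_apply, Matrix.mul_apply] at h1
    rw [← h1]
    refine Finset.sum_congr rfl fun k _ => ?_
    simp
  · have h1 := Complex.neg_pi_lt_arg (d j)
    have h2 : -1 < (d j).arg / (2 * Real.pi) := by
      rw [lt_div_iff₀ (by positivity)]
      linarith [Real.pi_pos]
    linarith
  · have h1 : Complex.exp (2 * Real.pi * Complex.I * ((d j).arg / (2 * Real.pi) + 1 : ℝ)) = d j := by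
      have h2 := Complex.norm_mul_exp_arg_mul_I (d j)
      rw [hd, Complex.ofReal_one, one_mul] at h2
      conv_rhs => rw [← h2]
      rw [Complex.exp_eq_exp_iff_exists_int]
      refine ⟨1, ?_⟩
      have hp : (Real.pi : ℂ) ≠ 0 := by exact_mod_cast Real.pi_ne_zero
      push_cast
      field_simp
    rw [h1]
    have h2 : A * V = V * Matrix.diagonal d := by
      rw [hAd, mul_assoc, hVV, mul_one]
    have h3 : (fun i => T i * (∑ k, V k j • u k) i) = ∑ k, V k j • fun i => T i * u k i := by
      ext i
      simp only [Finset.sum_apply, Pi.smul_apply, smul_eq_mul, Finset.mul_sum]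
      exact Finset.sum_congr rfl fun k _ => by ring
    rw [h3]
    calc ∑ k, V k j • (fun i => T i * u k i) = ∑ k, V k j • ∑ i, A i k • u i :=
          Finset.sum_congr rfl fun k _ => by rw [hexp k]
      _ = ∑ i, (A * V) i j • u i := by
        simp only [Finset.smul_sum, smul_smul]
        rw [Finset.sum_comm]
        refine Finset.sum_congr rfl fun i _ => ?_
        rw [← Finset.sum_smul, Matrix.mul_apply]
        congr 1
        exact Finset.sum_congr rfl fun k _ => mul_comm _ _
      _ = d j • ∑ i, V i j • u i := by
        rw [h2, Finset.smul_sum]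
        refine Finset.sum_congr rfl fun i _ => ?_
        rw [Matrix.mul_diagonal, smul_smul, mul_comm]

theorem conj_exp_two_pi_mul (s : ℝ) :
    (starRingEnd ℂ) (Complex.exp (2 * Real.pi * Complex.I * s))
      = Complex.exp (2 * Real.pi * Complex.I * ((-s : ℝ) : ℂ)) := by
  rw [← Complex.exp_conj]
  congr 1
  simp only [map_mul, map_ofNat, Complex.conj_ofReal, Complex.conj_I]
  push_cast
  ring

theorem contDiff_exp_two_pi_mul (b : ℝ) :
    ContDiff ℝ 1 fun t : ℝ => Complex.exp (2 * Real.pi * Complex.I * ((t * b : ℝ) : ℂ)) := by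
  have : ContDiff ℝ 1 fun t : ℝ => ((t * b : ℝ) : ℂ) :=
    Complex.ofRealCLM.contDiff.comp (contDiff_id.mul contDiff_const)
  exact (contDiff_const.mul this).cexp

/-- There are equivariant unitary frames in which the linearized flow has regular crossings. -/
theorem exists_unitaryFrame (hW : HasWeight W w h) (hnd : IsNondegenerate W)
    {g : Fin (m + 1) → ℂˣ} (hg : g ∈ symmetryGroup W) {l : ℝ} (hl : 0 < l)
    {p : Fin (m + 1) → ℂ} (hp : ∃ i, partialAt W i p ≠ 0) (hfix : p ∈ fixedLocus w h g l) :
    ∃ (F : ℝ → Fin m → Fin (m + 1) → ℂ) (ρ : ℝ), IsUnitaryFrame W w h g l p F ∧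
      IsRegularPath (linearizedFlow w h F) 0 l ∧
      IsRotationNumber (fun t => residueForm W (reebFlow w h t p) (F t)) 0 l ρ := by
  have hfix' : (fun i => ((g i : ℂ) * flowFactor w h l i) * p i) = p := by
    have h1 : act g (reebFlow w h l p) = p := hfix
    ext i
    rw [mul_assoc]
    exact congrFun h1 i
  obtain ⟨v, a, hv, hu, ha, hTv⟩ := exists_unitary_eigenbasis (w := w) hW.weight_pos
    (fun i => by
      rw [norm_mul, norm_eq_one_of_mem_symmetryGroup hnd hg, norm_flowFactor, one_mul])
    (eval_twist hW hg l) hp hfix'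
  -- The phase that unwinds the eigenvalue `exp (2πi aⱼ)` of `g R_l` linearly in `t`, so that `c t j
  -- • R_t vⱼ` closes up under `g`. In this frame the flow is the diagonal matrix of the conjugate
  -- phases.
  set c : ℝ → Fin m → ℂ :=
    fun t j => Complex.exp (2 * Real.pi * Complex.I * ((t * (-(a j / l)) : ℝ) : ℂ)) with hc
  have hc0 : ∀ j, c 0 j = 1 := fun j => by simp [hc]
  set F : ℝ → Fin m → Fin (m + 1) → ℂ := fun t j => c t j • reebFlow w h t (v j) with hF
  have hF0 : F 0 = v := by
    ext j : 1
    simp only [hF, hc0, one_smul, reebFlow_zero]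
  have hconj : ∀ t j, (starRingEnd ℂ) (c t j)
      = Complex.exp (2 * Real.pi * Complex.I * ((a j / l * t : ℝ) : ℂ)) := fun t j => by
    simp only [hc]
    rw [conj_exp_two_pi_mul]
    congr 3
    ring
  have hflow : linearizedFlow w h F = fun t => realMap (Matrix.diagonal fun j =>
      Complex.exp (2 * Real.pi * Complex.I * ((a j / l * t : ℝ) : ℂ))) := by
    ext t : 1
    change realMap (flowMatrix w h F t) = _
    congr 1
    ext i j
    rw [flowMatrix, Matrix.of_apply, hF0]
    simp only [hF]
    rw [herm_smul_left, herm_reebFlow, hu, hconj, Matrix.diagonal_apply]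
    split_ifs <;> simp
  have hcc : ∀ t j, (starRingEnd ℂ) (c t j) * c t j = 1 := fun t j => by
    rw [Complex.conj_mul', show ‖c t j‖ = 1 from norm_exp_two_pi_mul _]
    simp
  set σ : ℝ := ∑ i, thetaJ w h i - 1 with hσ
  set b : ℝ := ∑ j, -(a j / l) with hb
  have hres : ∀ t, residueForm W (reebFlow w h t p) (F t)
      = Complex.exp (2 * Real.pi * Complex.I * ((t * (b + σ) : ℝ) : ℂ)) * residueForm W p v := by
    intro t
    rw [residueForm_sum_smul (v := fun j => reebFlow w h t (v j)) (reebFlow w h t p)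
      (Matrix.diagonal (c t)) (fun j => by simp [hF, Matrix.diagonal_apply]),
      residueForm_reebFlow hW hp hv, Matrix.det_diagonal, ← mul_assoc]
    congr 1
    simp only [hc]
    rw [← Complex.exp_sum, ← Finset.mul_sum, ← Complex.exp_add, ← Complex.ofReal_sum,
      ← Finset.mul_sum, ← hb, ← hσ]
    congr 1
    push_cast
    ring
  have hr0 : residueForm W p v ≠ 0 := residueForm_ne_zero hp hv hu
  -- `b` is the total speed of the unwinding phases and `σ` that of `Ω` under `R_t`; `Ω(F)` rotates
  -- uniformly with speed `b + σ`.
  refine ⟨F, l * (b + σ), ⟨?_, fun t _ j => ?_, fun t _ i j => ?_, fun j => ?_⟩, ?_,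
    fun t => t * (b + σ) + (residueForm W p v).arg / (2 * Real.pi), by fun_prop, fun t _ => ?_, ?_⟩
  · refine ContDiff.contDiffOn ?_
    refine contDiff_pi.mpr fun j => contDiff_pi.mpr fun i => ?_
    exact (contDiff_exp_two_pi_mul _).mul ((contDiff_exp_two_pi_mul _).mul contDiff_const)
  · exact Submodule.smul_mem _ _ (reebFlow_mem_tangentSpace hW (hv j) t)
  · simp only [hF]
    rw [herm_smul_left, herm_smul_right, herm_reebFlow, hu]
    split_ifs with hij
    · rw [hij, mul_one, hcc]
    · simp
  · rw [hF0]
    have h1 : act g (F l j) = c l j • fun i => ((g i : ℂ) * flowFactor w h l i) * v j i := by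
      ext i
      simp only [hF, act, Pi.smul_apply, smul_eq_mul, reebFlow, flowFactor]
      ring
    rw [h1, hTv, smul_smul]
    have h2 : c l j * Complex.exp (2 * Real.pi * Complex.I * a j) = 1 := by
      simp only [hc]
      rw [← Complex.exp_add, ← Complex.exp_zero]
      congr 1
      have : (l : ℂ) ≠ 0 := by exact_mod_cast hl.ne'
      push_cast
      field_simp
      ring
    rw [h2, one_smul]
  · rw [hflow]
    exact isRegularPath_diagonal (fun j => div_pos (ha j) hl) hl
  · simp only [hres]
    refine ⟨mul_ne_zero (Complex.exp_ne_zero _) hr0, ?_⟩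
    rw [norm_mul, norm_exp_two_pi_mul, one_mul]
    have hp' : (Real.pi : ℂ) ≠ 0 := by exact_mod_cast Real.pi_ne_zero
    have h1 : 2 * Real.pi * Complex.I
        * ((t * (b + σ) + (residueForm W p v).arg / (2 * Real.pi) : ℝ) : ℂ)
        = 2 * Real.pi * Complex.I * ((t * (b + σ) : ℝ) : ℂ)
          + (residueForm W p v).arg * Complex.I := by
      push_cast
      field_simp
    rw [h1, Complex.exp_add, mul_left_comm, Complex.norm_mul_exp_arg_mul_I]
  · simp only
    ring

end LGOrbifold

end

theorem mainTheorem6 {m : ℕ} (W : MvPolynomial (Fin (m + 1)) ℂ) (w : Fin (m + 1) → ℕ) (h : ℕ)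
    (hW : LGOrbifold.HasWeight W w h) (hnd : LGOrbifold.IsNondegenerate W)
    (g : Fin (m + 1) → ℂˣ) (hg : g ∈ LGOrbifold.symmetryGroup W)
    (l : ℝ) (hl : 0 < l) (δ : ℝ) (hδ : 0 < δ)
    (p : Fin (m + 1) → ℂ) (hp : p ∈ LGOrbifold.twistedOrbits W w h δ g l) (μ : ℝ) :
    LGOrbifold.IsRobbinSalamonIndex W w h g l p μ ↔
      μ = 2 * (-(∑ i ∈ LGOrbifold.indexSet W w h g l, LGOrbifold.theta g i)
              + ∑ j ∈ (LGOrbifold.indexSet W w h g l)ᶜ, (l * LGOrbifold.thetaJ w h j - l))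
          + ∑ i ∈ LGOrbifold.indexSet W w h g l,
              RobbinSalamon.Q (l * LGOrbifold.thetaJ w h i + LGOrbifold.theta g i)
          + (((LGOrbifold.indexSet W w h g l)ᶜ.card : ℝ) - 1) * RobbinSalamon.Q l := by
  have hcrit := LGOrbifold.exists_partialAt_ne_zero hW hnd (LGOrbifold.ne_zero_of_mem_link hδ hp.2)
  rw [← LGOrbifold.sum_defect_eq hW hnd hg l]
  constructor
  · rintro ⟨F, ρ, hF, hreg, hρ, rfl⟩
    exact hF.index_add_rotation hW hg hl hcrit hp.1 hreg hρ
  -- Existence of one admissible frame suffices, as the index computed in it is already known to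
  -- have this value.
  · rintro rfl
    obtain ⟨F, ρ, hF, hreg, hρ⟩ := LGOrbifold.exists_unitaryFrame hW hnd hg hl hcrit hp.1
    exact ⟨F, ρ, hF, hreg, hρ, (hF.index_add_rotation hW hg hl hcrit hp.1 hreg hρ).symm⟩
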